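/- Let $n\ge 1$ and $m\ge 0$ be integers, let $p>1+\frac{m+2}{n}$, let $\nu\in\mathbb C$ with $\operatorname{Re}\nu>0$, and let $f:\mathbb C\to\mathbb C$ satisfy $f(0)=0$ and, for some $K>0$, $$|f(\xi)-f(\eta)|\le K\left(|\xi|^{p-1}+|\eta|^{p-1}\right)|\xi-\eta|\qquad\text{for all }\xi,\eta\in\mathbb C.$$ All function spaces are spaces of complex-valued functions on $\mathbb R^n$, and $\|\cdot\|_q$ is the norm of $L^q(\mathbb R^n)$. Put $G_{t\nu}(x)=(4\pi t\nu)^{-n/2}\exp\left(-\frac{|x|^2}{4t\nu}\right)$ (principal branch of the power) and $e^{t\nu\Delta}\varphi=G_{t\nu}*\varphi$ for $t>0$, $e^{0\nu\Delta}\varphi=\varphi$. Let $L^1_{m+1}$ be the set of $\varphi\in L^1$ with $x^\alpha\varphi\in L^1$ for all multi-indices $\alpha$ with $|\alpha|\le m+1$. Let $u_0\in L^1_{m+1}\cap L^\infty$, and let $$u\in X:=(C\cap L^\infty)\left([0,\infty);L^1\right)\cap(C\cap L^\infty)\left((0,\infty);L^\infty\right)$$ be a global (mild) solution of $\partial_tu-\nu\Delta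 u=f(u)$, $u(0)=u_0$, that is, $$u(t)=e^{t\nu\Delta}u_0+\int_0^te^{(t-s)\nu\Delta}f(u(s))\,ds\qquad\text{in }L^1\cap L^\infty\text{ for all }t>0.$$ Suppose that $$\sup_{q\in[1,\infty]}\ \sup_{t>0}\ t^{\frac n2\left(1-\frac1q\right)}\|u(t)\|_q<\infty .$$ For multi-indices $\alpha,\beta$, an integer $N\ge0$ and $t>0$ put $$\mathcal M_\beta(\varphi)=\frac1{\beta!}\int_{\mathbb R^n}y^\beta\varphi(y)\,dy,\qquad (\delta_t\varphi)(x)=t^{-n/2}\varphi(t^{-1/2}x),$$ $$\boldsymbol h_{\nu,\alpha}(x)=\sum_{2\beta\le\alpha}\frac{(-1)^{|\beta|}\alpha!}{\beta!\,(\alpha-2\beta)!}\,\nu^{-|\alpha-\beta|}x^{\alpha-2\beta},\qquad \psi_k=\int_0^\infty s^kf(u(s))\,ds,$$ $$\Lambda_{\alpha,N}(t;\varphi)=(-2)^{-|\alpha|}t^{-\frac{|\alpha|}2}\sum_{k=0}^N2^{-k}t^{-\frac k2}\sum_{|\beta|=k}\mathcal M_\beta(\varphi)\,\delta_t\left(\boldsymbol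 h_{\nu,\alpha+\beta}G_\nu\right),$$ $$\mathcal A_m(t)=\Lambda_{0,m}(t;u_0)+\sum_{|\gamma|\le m/2}\frac{(-\nu)^{|\gamma|}}{\gamma!}\Lambda_{2\gamma,\,m-2|\gamma|}\left(t;\psi_{|\gamma|}\right).$$ Then the integrals defining $\psi_k\in L^1$ (for $2k\le m$) and the moments $\mathcal M_\beta(\psi_k)$ (for $|\beta|+2k\le m$) converge absolutely, $\sigma:=\frac n2(p-1)-1>\frac m2$, and for every $q\in[1,\infty]$ there exists $C>0$ such that, for all $t>0$, $$t^{\frac n2\left(1-\frac1q\right)+\frac m2}\left\|u(t)-\mathcal A_m(t)\right\|_q\le\begin{cases}C\,t^{-\left(\sigma-\frac m2\right)}&\text{if }1+\frac{m+2}n<p<1+\frac{m+3}n,\\[2pt] C\,t^{-\frac12}\log(2+t)&\text{if }p=1+\frac{m+3}n,\\[2pt] C\,t^{-\frac12}&\text{if }p>1+\frac{m+3}n.\end{cases}$$ -/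

import Mathlib

open MeasureTheory Filter Topology Set
open scoped ENNReal Convolution

namespace CGL

noncomputable section

/-- The space `ℝⁿ` with its Euclidean norm and Lebesgue measure. -/
abbrev Sp (n : ℕ) : Type := EuclideanSpace ℝ (Fin n)

/-- Multi-indices `α ∈ ℤ_{≥0}ⁿ`. -/
abbrev MIdx (n : ℕ) : Type := Fin n → ℕ

/-- The length `|α| = α₁ + ⋯ + αₙ`. -/
def len {n : ℕ} (α : MIdx n) : ℕ := ∑ i, α i

/-- The factorial `α! = α₁! ⋯ αₙ!`. -/
def fact {n : ℕ} (α : MIdx n) : ℕ := ∏ i, (α i).factorial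

/-- The monomial `x^α`. -/
def monom {n : ℕ} (α : MIdx n) (x : Sp n) : ℝ := ∏ i, x i ^ α i

/-- The finite set of multi-indices of length `k`. -/
def ofLen (n k : ℕ) : Finset (MIdx n) := Finset.piAntidiag Finset.univ k

theorem mem_ofLen {n k : ℕ} (α : MIdx n) : α ∈ ofLen n k ↔ len α = k := by
  simp [ofLen, len, Finset.mem_piAntidiag]

/-- Membership in the weighted space `L¹_m(ℝⁿ)`: `φ ∈ L¹` and `x^α φ ∈ L¹` for `|α| ≤ m`. -/
def MemWeightedL1 {n : ℕ} (m : ℕ) (φ : Sp n → ℂ) : Prop :=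
  MemLp φ 1 volume ∧
    ∀ α : MIdx n, len α ≤ m → MemLp (fun x => (monom α x : ℂ) * φ x) 1 volume

/-- The fundamental solution `G_{tν}(x) = (4πtν)^{-n/2} exp(-|x|²/(4tν))`
(principal branch of the power). -/
def gauss {n : ℕ} (ν : ℂ) (t : ℝ) (x : Sp n) : ℂ :=
  (4 * (Real.pi : ℂ) * (t : ℂ) * ν) ^ (-(n : ℂ) / 2) *
    Complex.exp (-((‖x‖ ^ 2 : ℝ) : ℂ) / (4 * (t : ℂ) * ν))

theorem integrable_gauss {n : ℕ} {ν : ℂ} (hν : 0 < ν.re) {t : ℝ} (ht : 0 < t) :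
    Integrable (gauss ν t : Sp n → ℂ) volume := by
  have hb : 0 < ((4 * (t : ℂ) * ν)⁻¹).re := by
    have h1 : (4 * (t : ℂ) * ν).re = 4 * t * ν.re := by simp
    rw [Complex.inv_re, h1]
    have h2 : (4 * (t : ℂ) * ν) ≠ 0 := by
      intro h
      rw [h] at h1
      have : 0 < 4 * t * ν.re := by positivity
      simp at h1
      rcases h1 with h | h <;> linarith
    have := Complex.normSq_pos.mpr h2
    positivity
  have h := GaussianFourier.integrable_cexp_neg_mul_sq_norm_add (V := Sp n) hb 0 0
  refine (h.const_mul ((4 * (Real.pi : ℂ) * (t : ℂ) * ν) ^ (-(n : ℂ) / 2))).congr ?_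
  refine Eventually.of_forall fun x => ?_
  simp only [gauss]
  congr 2
  push_cast
  simp
  ring

/-- The CGL semigroup `e^{tνΔ}`: convolution with `G_{tν}` for `t > 0`, the identity at `t = 0`. -/
def semigroup {n : ℕ} (ν : ℂ) (t : ℝ) (φ : Sp n → ℂ) : Sp n → ℂ :=
  if t = 0 then φ else (gauss ν t) ⋆[ContinuousLinearMap.mul ℝ ℂ, volume] φ

theorem memLp_semigroup {n : ℕ} {ν : ℂ} (hν : 0 < ν.re) {t : ℝ} (ht : 0 ≤ t)
    {φ : Sp n → ℂ} (hφ : MemLp φ 1 volume) : MemLp (semigroup ν t φ) 1 volume := by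
  unfold semigroup
  split_ifs with h
  · exact hφ
  · rw [memLp_one_iff_integrable] at hφ ⊢
    exact (integrable_gauss hν (lt_of_le_of_ne ht (Ne.symm h))).integrable_convolution _ hφ

open Classical in
/-- The class in `L¹(ℝⁿ; ℂ)` of an integrable function (and `0` for a function that is not
integrable, a case that does not occur below, by `memLp_semigroup` and `memLp_nonlin`). -/
def toL1 {n : ℕ} (g : Sp n → ℂ) : Lp ℂ 1 (volume : Measure (Sp n)) :=
  if h : MemLp g 1 volume then h.toLp g else 0

/-- The growth condition on the nonlinear term:
`|f(ξ) - f(η)| ≤ K (|ξ|^{p-1} + |η|^{p-1}) |ξ - η|`. -/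
def PowerLipschitz (f : ℂ → ℂ) (K p : ℝ) : Prop :=
  ∀ ξ η : ℂ, ‖f ξ - f η‖ ≤ K * (‖ξ‖ ^ (p - 1) + ‖η‖ ^ (p - 1)) * ‖ξ - η‖

theorem continuous_of_powerLipschitz {f : ℂ → ℂ} {K p : ℝ} (hp : 1 < p)
    (hf : PowerLipschitz f K p) : Continuous f := by
  rw [continuous_iff_continuousAt]
  intro η
  rw [ContinuousAt, tendsto_iff_norm_sub_tendsto_zero]
  have hc : Continuous fun ξ : ℂ =>
      K * (‖ξ‖ ^ (p - 1) + ‖η‖ ^ (p - 1)) * ‖ξ - η‖ := by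
    have : Continuous fun ξ : ℂ => ‖ξ‖ ^ (p - 1) :=
      continuous_norm.rpow_const fun _ => Or.inr (by linarith)
    fun_prop
  have h0 := hc.tendsto η
  simp only [sub_self, norm_zero, mul_zero] at h0
  exact squeeze_zero (fun _ => norm_nonneg _) (fun ξ => hf ξ η) h0

/-- For `v ∈ L¹ ∩ L^∞` the function `f(v)` lies in `L¹`. -/
theorem memLp_nonlin {n : ℕ} {f : ℂ → ℂ} {K p : ℝ} (hp : 1 < p) (hK : 0 < K) (hf0 : f 0 = 0)
    (hf : PowerLipschitz f K p) {v : Sp n → ℂ} (h1 : MemLp v 1 volume) (h2 : MemLp v ∞ volume) :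
    MemLp (fun x => f (v x)) 1 volume := by
  have hmeas : AEStronglyMeasurable (fun x => f (v x)) volume :=
    (continuous_of_powerLipschitz hp hf).comp_aestronglyMeasurable h1.1
  have hb := ae_le_eLpNormEssSup (f := v) (μ := (volume : Measure (Sp n)))
  have hfin : eLpNormEssSup v (volume : Measure (Sp n)) < ∞ := by simpa using h2.2
  set M := (eLpNormEssSup v (volume : Measure (Sp n))).toReal with hM
  refine MemLp.of_le_mul (c := K * M ^ (p - 1)) h1 hmeas ?_
  filter_upwards [hb] with x hx
  have hxM : ‖v x‖ ≤ M := by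
    have := ENNReal.toReal_mono hfin.ne hx
    simpa using this
  have h := hf (v x) 0
  have hz : (0 : ℝ) ^ (p - 1) = 0 := Real.zero_rpow (by linarith)
  simp only [hf0, sub_zero, norm_zero, hz, add_zero] at h
  refine h.trans ?_
  have : ‖v x‖ ^ (p - 1) ≤ M ^ (p - 1) :=
    Real.rpow_le_rpow (norm_nonneg _) hxM (by linarith)
  gcongr

/-- Membership of `u : [0,∞) → L¹(ℝⁿ)` in
`X = (C ∩ L^∞)([0,∞); L¹) ∩ (C ∩ L^∞)((0,∞); L^∞)`.
The values `u t` at times `t < 0` play no role. -/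
structure MemX {n : ℕ} (u : ℝ → Lp ℂ 1 (volume : Measure (Sp n))) : Prop where
  continuousOn_L1 : ContinuousOn u (Ici 0)
  bounded_L1 : ∃ M : ℝ, ∀ t : ℝ, 0 ≤ t → ‖u t‖ ≤ M
  memLp_top : ∀ t : ℝ, 0 < t → MemLp (u t) ∞ volume
  continuous_top : ∀ t : ℝ, 0 < t →
    Tendsto (fun s => eLpNorm (fun x => u s x - u t x) ∞ volume) (𝓝 t) (𝓝 0)
  bounded_top : ∃ M : ℝ, ∀ t : ℝ, 0 < t → eLpNorm (u t) ∞ volume ≤ ENNReal.ofReal M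

/-- The nonlinear term `f(u(s))` as an element of `L¹(ℝⁿ)`. -/
def nonlin {n : ℕ} (f : ℂ → ℂ) (u : ℝ → Lp ℂ 1 (volume : Measure (Sp n))) (s : ℝ) :
    Lp ℂ 1 (volume : Measure (Sp n)) :=
  toL1 fun x => f (u s x)

/-- `u ∈ X` is a global (mild) solution of `∂ₜu - νΔu = f(u)`, `u(0) = u₀`:
`u(t) = e^{tνΔ} u₀ + ∫₀ᵗ e^{(t-s)νΔ} f(u(s)) ds` for all `t > 0`, the integral being a
Bochner integral in `L¹(ℝⁿ)`. -/
structure IsGlobalSolution {n : ℕ} (ν : ℂ) (f : ℂ → ℂ) (u₀ : Sp n → ℂ)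
    (u : ℝ → Lp ℂ 1 (volume : Measure (Sp n))) : Prop where
  memX : MemX u
  duhamel : ∀ t : ℝ, 0 < t →
    u t = toL1 (semigroup ν t u₀) + ∫ s in (0 : ℝ)..t, toL1 (semigroup ν (t - s) (nonlin f u s))

/-- The exponent `(n/2)(1 - 1/q)` for `q ∈ [1,∞]`, with `1/∞ = 0`. -/
def decayExp (n : ℕ) (q : ℝ≥0∞) : ℝ := (n : ℝ) / 2 * (1 - (q⁻¹).toReal)

/-- The decay assumption `sup_{q ∈ [1,∞]} sup_{t>0} t^{(n/2)(1-1/q)} ‖u(t)‖_q < ∞`. -/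
def HasFreeDecay {n : ℕ} (u : ℝ → Lp ℂ 1 (volume : Measure (Sp n))) : Prop :=
  (⨆ (q : ℝ≥0∞) (_ : 1 ≤ q) (t : ℝ) (_ : 0 < t),
    ENNReal.ofReal (t ^ decayExp n q) * eLpNorm (u t) q volume) < ∞

/-- The moment `M_β(φ) = (1/β!) ∫ y^β φ(y) dy`. -/
def moment {n : ℕ} (β : MIdx n) (φ : Sp n → ℂ) : ℂ :=
  (1 / (fact β : ℂ)) * ∫ y, (monom β y : ℂ) * φ y

/-- The Hermite polynomial
`h_{ν,α}(x) = ∑_{2β ≤ α} (-1)^{|β|} α! / (β! (α-2β)!) ν^{-|α-β|} x^{α-2β}`. -/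
def hermite {n : ℕ} (ν : ℂ) (α : MIdx n) (x : Sp n) : ℂ :=
  ∑ β ∈ (Finset.Iic α).filter (fun β => ∀ i, 2 * β i ≤ α i),
    ((-1) ^ len β * (fact α : ℂ) / ((fact β : ℂ) * (fact (fun i => α i - 2 * β i) : ℂ))) *
      (ν⁻¹) ^ len (fun i => α i - β i) * (monom (fun i => α i - 2 * β i) x : ℂ)

/-- The dilation `(δ_t φ)(x) = t^{-n/2} φ(t^{-1/2} x)`. -/
def dilation {n : ℕ} (t : ℝ) (φ : Sp n → ℂ) (x : Sp n) : ℂ :=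
  ((t ^ (-(n : ℝ) / 2) : ℝ) : ℂ) * φ (t ^ (-(1 : ℝ) / 2) • x)

/-- The profile `Λ_{α,N}(t; φ) = (-2)^{-|α|} t^{-|α|/2}
∑_{k=0}^N 2^{-k} t^{-k/2} ∑_{|β|=k} M_β(φ) δ_t(h_{ν,α+β} G_ν)`. -/
def Lam {n : ℕ} (ν : ℂ) (α : MIdx n) (N : ℕ) (t : ℝ) (φ : Sp n → ℂ) (x : Sp n) : ℂ :=
  ((-2 : ℂ)⁻¹) ^ len α * ((t ^ (-(len α : ℝ) / 2) : ℝ) : ℂ) *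
    ∑ k ∈ Finset.range (N + 1), ((2 : ℂ)⁻¹) ^ k * ((t ^ (-(k : ℝ) / 2) : ℝ) : ℂ) *
      ∑ β ∈ ofLen n k,
        moment β φ * dilation t (fun y => hermite ν (α + β) y * gauss ν 1 y) x

/-- `ψ_k = ∫₀^∞ s^k f(u(s)) ds`, a Bochner integral in `L¹(ℝⁿ)`. -/
def psi {n : ℕ} (f : ℂ → ℂ) (u : ℝ → Lp ℂ 1 (volume : Measure (Sp n))) (k : ℕ) :
    Lp ℂ 1 (volume : Measure (Sp n)) :=
  ∫ s in Ioi (0 : ℝ), s ^ k • nonlin f u s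

/-- The asymptotic profile of order `m`:
`A_m(t) = Λ_{0,m}(t; u₀) + ∑_{|γ| ≤ m/2} ((-ν)^{|γ|}/γ!) Λ_{2γ, m-2|γ|}(t; ψ_{|γ|})`;
the sum over `γ` is grouped by the length `k = |γ| ≤ ⌊m/2⌋`. -/
def profile {n : ℕ} (ν : ℂ) (f : ℂ → ℂ) (u₀ : Sp n → ℂ)
    (u : ℝ → Lp ℂ 1 (volume : Measure (Sp n))) (m : ℕ) (t : ℝ) (x : Sp n) : ℂ :=
  Lam ν 0 m t u₀ x +
    ∑ k ∈ Finset.range (m / 2 + 1), ∑ γ ∈ ofLen n k,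
      ((-ν) ^ k / (fact γ : ℂ)) * Lam ν (2 • γ) (m - 2 * k) t (psi f u k) x

/-- The left-hand side `t^{(n/2)(1-1/q) + m/2} ‖u(t) - A_m(t)‖_q`, with values in `[0,∞]`. -/
def rescaledRemainder {n : ℕ} (ν : ℂ) (f : ℂ → ℂ) (u₀ : Sp n → ℂ)
    (u : ℝ → Lp ℂ 1 (volume : Measure (Sp n))) (m : ℕ) (q : ℝ≥0∞) (t : ℝ) : ℝ≥0∞ :=
  ENNReal.ofReal (t ^ (decayExp n q + (m : ℝ) / 2)) *
    eLpNorm (fun x => u t x - profile ν f u₀ u m t x) q volume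

end

end CGL

/-! Write `F s` for the nonlinear term at time `s` and σ + 1 = (n/2)(p - 1). Since f(0) = 0, the
growth condition and the sup-norm decay of the solution give |F(s)| ≤ κ (1+s)^{-(σ+1)} |u(s)| almost
everywhere (`enorm_nonlin_le`). So the source is u times a factor integrable in time, and the
equation is a perturbation of the linear flow. Everything after this observation uses only the data
collected in `DecayingSolution`.

Moments come first. The heat kernel spreads the weight |x|^j at the parabolic rate t^{j/2}, and
Grönwall's inequality with the integrable factor shows that u(t) has j-th moment O((1+t)^{j/2}) for
j ≤ m+1 (`DecayingSolution.exists_wnorm_le`). Hence F(s) has j-th moment O((1+s)^{j/2-σ-1}). As σ >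
m/2, the integrals of s^k M_β(F(s)) converge for 2k + |β| ≤ m, and they equal the moments of ψ_k
(`integral_monom_mul_integral`).

On the linear side, the dilated Hermite functions of the profile are the derivatives ∂^α G_{tν}
(`kernel_eq`), and Λ is the moment expansion of ∂^α G_{tν} * φ (`Lam_eq`). Expanding G_{(t-s)ν}(x-y)
in s, where each time derivative is νΔ, and then in y, to total parabolic order m, leaves an error
of parabolic order m+1: for s ≤ t/2 it is t^{-(m+1)/2} (1+s)^{(m+1)/2} times the size of the datum
(`exists_bnorm_sub_delayedProfile_le`).

Duhamel's formula is then cut at t/2. Early times contribute t^{-(m+1)/2} ∫_0^{t/2}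
(1+s)^{(m+1)/2-σ-1} ds. Late times, and the tails beyond t/2 of the integrals defining the
coefficients, contribute t^{-σ} (`DecayingSolution.exists_eLpNorm_sub_profile_le`). The three rates
are the three behaviours of that integral: growing as a power, logarithmic, bounded. For t ≤ 1 the
most singular term of the profile alone bounds the remainder. Only q = 1 and q = ∞ are estimated;
the other exponents follow from `eLpNorm_interpolation`.

Duhamel's integral is a Bochner integral in L¹ only, so its L^∞ and weighted bounds need a separate
argument: their unit balls are convex and closed in L¹ (`sublinear_integral_le`). -/

namespace CGL

/-! ### General analysis -/

/-- A subset of `L¹` that is stable under almost everywhere limits is closed. -/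
theorem isClosed_of_ae_limit {α : Type*} [MeasurableSpace α] {μ : Measure α}
    {S : Set (Lp ℂ 1 μ)}
    (h : ∀ (v : ℕ → Lp ℂ 1 μ) (g : Lp ℂ 1 μ), (∀ k, v k ∈ S) →
      (∀ᵐ x ∂μ, Tendsto (fun k => v k x) atTop (𝓝 (g x))) → g ∈ S) : IsClosed S := by
  refine IsSeqClosed.isClosed fun v g hv hg => ?_
  have h1 : TendstoInMeasure μ (fun k => (v k : α → ℂ)) atTop g :=
    tendstoInMeasure_of_tendsto_Lp hg
  obtain ⟨ns, -, hns⟩ := h1.exists_seq_tendsto_ae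
  exact h (fun k => v (ns k)) g (fun k => hv _) hns

/-- Minkowski's inequality for a sublinear functional with closed unit ball on a Banach space. -/
theorem sublinear_integral_le {E Ω : Type*} [NormedAddCommGroup E] [NormedSpace ℝ E]
    [CompleteSpace E] [MeasurableSpace Ω] {μ : Measure Ω} {N : E → ℝ≥0∞}
    (hadd : ∀ g h, N (g + h) ≤ N g + N h)
    (hsmul : ∀ (c : ℝ) (g : E), 0 ≤ c → N (c • g) ≤ ENNReal.ofReal c * N g)
    (hclosed : IsClosed {g | N g ≤ 1})
    {F : Ω → E} (hF : Integrable F μ) {b : Ω → ℝ} (hb : Integrable b μ)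
    (hpos : ∀ᵐ s ∂μ, 0 < b s) (hN : ∀ᵐ s ∂μ, N (F s) ≤ ENNReal.ofReal (b s)) :
    N (∫ s, F s ∂μ) ≤ ENNReal.ofReal (∫ s, b s ∂μ) := by
  have hN0 : N 0 = 0 := by
    have := hsmul 0 0 le_rfl
    simpa using this
  by_cases hμ : μ = 0
  · simp [hμ, hN0]
  have hI : 0 < ∫ s, b s ∂μ := by
    rw [integral_pos_iff_support_of_nonneg_ae (hpos.mono fun s hs => hs.le) hb]
    have : Function.support b =ᵐ[μ] univ := by
      filter_upwards [hpos] with s hs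
      have : s ∈ Function.support b := hs.ne'
      exact propext ⟨fun _ => trivial, fun _ => this⟩
    rw [measure_congr this]
    simpa [Measure.measure_univ_eq_zero, pos_iff_ne_zero] using hμ
  set I := ∫ s, b s ∂μ with hIdef
  -- With respect to the probability density b/I, the integral of F is I times the mean of F/b. The
  -- values of F/b lie in the unit ball of N, which is convex and closed, so the mean lies there
  -- too.
  set d : Ω → ℝ≥0∞ := fun s => ENNReal.ofReal (b s / I) with hd
  have hdm : AEMeasurable d μ := (hb.aestronglyMeasurable.aemeasurable.div_const I).ennreal_ofReal
  have hdt : ∀ᵐ s ∂μ, d s < ∞ := Eventually.of_forall fun s => ENNReal.ofReal_lt_top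
  have hprob : IsProbabilityMeasure (μ.withDensity d) := by
    constructor
    rw [withDensity_apply _ MeasurableSet.univ, Measure.restrict_univ,
      ← ofReal_integral_eq_lintegral_ofReal (hb.div_const I)
        (hpos.mono fun s hs => (div_pos hs hI).le), integral_div, ← hIdef, div_self hI.ne']
    simp
  have hconv : Convex ℝ {g | N g ≤ 1} := by
    intro x hx y hy a c ha hc hac
    simp only [mem_ofPred_eq] at *
    calc N (a • x + c • y) ≤ ENNReal.ofReal a * N x + ENNReal.ofReal c * N y :=
          (hadd _ _).trans (add_le_add (hsmul _ _ ha) (hsmul _ _ hc))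
      _ ≤ ENNReal.ofReal a * 1 + ENNReal.ofReal c * 1 := by gcongr
      _ = 1 := by rw [mul_one, mul_one, ← ENNReal.ofReal_add ha hc, hac]; simp
  have hkey : ∀ᵐ s ∂μ, (d s).toReal • ((b s)⁻¹ • F s) = I⁻¹ • F s := by
    filter_upwards [hpos] with s hs
    rw [hd, smul_smul, ENNReal.toReal_ofReal (div_pos hs hI).le]
    congr 1
    field_simp
  have hint : Integrable (fun s => (b s)⁻¹ • F s) (μ.withDensity d) := by
    rw [integrable_withDensity_iff_integrable_smul₀' hdm hdt]
    exact (integrable_congr hkey).mpr (hF.smul I⁻¹)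
  have hmem : ∫ s, (b s)⁻¹ • F s ∂(μ.withDensity d) ∈ {g | N g ≤ 1} := by
    refine hconv.integral_mem hclosed ?_ hint
    refine (withDensity_absolutelyContinuous μ d) ?_
    filter_upwards [hpos, hN] with s hs hs2
    calc N ((b s)⁻¹ • F s) ≤ ENNReal.ofReal (b s)⁻¹ * N (F s) := hsmul _ _ (inv_pos.mpr hs).le
      _ ≤ ENNReal.ofReal (b s)⁻¹ * ENNReal.ofReal (b s) := by gcongr
      _ = 1 := by
        rw [← ENNReal.ofReal_mul (inv_pos.mpr hs).le, inv_mul_cancel₀ hs.ne']; simp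
  rw [integral_withDensity_eq_integral_toReal_smul₀ hdm hdt, integral_congr_ae hkey,
    integral_smul] at hmem
  calc N (∫ s, F s ∂μ) = N (I • (I⁻¹ • ∫ s, F s ∂μ)) := by
        rw [smul_smul, mul_inv_cancel₀ hI.ne', one_smul]
    _ ≤ ENNReal.ofReal I * N (I⁻¹ • ∫ s, F s ∂μ) := hsmul _ _ hI.le
    _ ≤ ENNReal.ofReal I * 1 := by gcongr; exact hmem
    _ = ENNReal.ofReal I := mul_one _

/-- The unit ball of the L^q norm is closed in L¹ by Fatou's lemma along an almost everywhere
convergent subsequence. This gives L^∞ bounds without F being measurable into L^∞. -/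
theorem eLpNorm_integral_L1_le {α Ω : Type*} [MeasurableSpace α] {ρ : Measure α}
    [MeasurableSpace Ω] {μ : Measure Ω} {q : ℝ≥0∞} (hq : 1 ≤ q)
    {F : Ω → Lp ℂ 1 ρ} (hF : Integrable F μ) {b : Ω → ℝ} (hb : Integrable b μ)
    (hpos : ∀ᵐ s ∂μ, 0 < b s)
    (hN : ∀ᵐ s ∂μ, eLpNorm (F s) q ρ ≤ ENNReal.ofReal (b s)) :
    eLpNorm (∫ s, F s ∂μ : Lp ℂ 1 ρ) q ρ ≤ ENNReal.ofReal (∫ s, b s ∂μ) := by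
  refine sublinear_integral_le (N := fun g : Lp ℂ 1 ρ => eLpNorm g q ρ) ?_ ?_ ?_ hF hb hpos hN
  · intro g h
    rw [eLpNorm_congr_ae (Lp.coeFn_add g h)]
    exact eLpNorm_add_le (Lp.aestronglyMeasurable g) (Lp.aestronglyMeasurable h) hq
  · intro c g hc
    rw [eLpNorm_congr_ae (Lp.coeFn_smul c g), eLpNorm_const_smul, Real.enorm_of_nonneg hc]
  · refine isClosed_of_ae_limit fun v g hv hg => ?_
    refine (Lp.eLpNorm_lim_le_liminf_eLpNorm (fun k => Lp.aestronglyMeasurable (v k)) _ hg).trans ?_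
    exact (liminf_le_liminf (Eventually.of_forall hv)).trans (by simp)

/-- Fatou's lemma again gives closedness. Finiteness of w excludes the product ∞ · 0, at which
multiplication by w x would fail to be continuous. -/
theorem weighted_integral_L1_le {α Ω : Type*} [MeasurableSpace α] {ρ : Measure α}
    [MeasurableSpace Ω] {μ : Measure Ω} {w : α → ℝ≥0∞} (hw : Measurable w) (hw' : ∀ x, w x ≠ ∞)
    {F : Ω → Lp ℂ 1 ρ} (hF : Integrable F μ) {b : Ω → ℝ} (hb : Integrable b μ)
    (hpos : ∀ᵐ s ∂μ, 0 < b s)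
    (hN : ∀ᵐ s ∂μ, ∫⁻ x, w x * ‖F s x‖ₑ ∂ρ ≤ ENNReal.ofReal (b s)) :
    ∫⁻ x, w x * ‖(∫ s, F s ∂μ : Lp ℂ 1 ρ) x‖ₑ ∂ρ ≤ ENNReal.ofReal (∫ s, b s ∂μ) := by
  have hm : ∀ g : Lp ℂ 1 ρ, AEMeasurable (fun x => w x * ‖g x‖ₑ) ρ := fun g =>
    hw.aemeasurable.mul (Lp.aestronglyMeasurable g).enorm
  refine sublinear_integral_le (N := fun g : Lp ℂ 1 ρ => ∫⁻ x, w x * ‖g x‖ₑ ∂ρ)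
    ?_ ?_ ?_ hF hb hpos hN
  · intro g h
    rw [← lintegral_add_left' (hm g)]
    refine lintegral_mono_ae ?_
    filter_upwards [Lp.coeFn_add g h] with x hx
    rw [hx, ← mul_add]
    gcongr
    exact enorm_add_le _ _
  · intro c g hc
    rw [← lintegral_const_mul' _ _ ENNReal.ofReal_ne_top]
    refine lintegral_mono_ae ?_
    filter_upwards [Lp.coeFn_smul c g] with x hx
    rw [hx, Pi.smul_apply, enorm_smul, Real.enorm_of_nonneg hc]
    exact (mul_left_comm _ _ _).le
  · refine isClosed_of_ae_limit fun v g hv hg => ?_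
    calc ∫⁻ x, w x * ‖g x‖ₑ ∂ρ ≤ ∫⁻ x, liminf (fun k => w x * ‖v k x‖ₑ) atTop ∂ρ := by
          refine lintegral_mono_ae ?_
          filter_upwards [hg] with x hx
          have : Tendsto (fun k => w x * ‖v k x‖ₑ) atTop (𝓝 (w x * ‖g x‖ₑ)) :=
            ENNReal.Tendsto.const_mul hx.enorm (Or.inr (hw' x))
          exact this.liminf_eq.ge
      _ ≤ liminf (fun k => ∫⁻ x, w x * ‖v k x‖ₑ ∂ρ) atTop :=
          lintegral_liminf_le' fun k => hm (v k)
      _ ≤ 1 := (liminf_le_liminf (Eventually.of_forall hv)).trans (by simp)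

/-- Taylor's formula with integral remainder on `[0, 1]`. -/
theorem taylor_zero_one {φ : ℕ → ℝ → ℂ} (N : ℕ)
    (hφ : ∀ k, ∀ θ ∈ Icc (0 : ℝ) 1, HasDerivAt (φ k) (φ (k + 1) θ) θ) :
    φ 0 1 - ∑ k ∈ Finset.range (N + 1), φ k 0 / (k.factorial : ℂ) =
      ∫ θ in (0 : ℝ)..1, (((1 - θ) ^ N / N.factorial : ℝ) : ℂ) * φ (N + 1) θ := by
  have hc : ∀ k, ContinuousOn (φ k) (Icc 0 1) := fun k θ hθ =>
    (hφ k θ hθ).continuousAt.continuousWithinAt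
  -- The derivative of the Taylor sum with moving base point θ telescopes to its last term. At θ = 1
  -- only the term k = 0 survives, and at θ = 0 the sum is the Taylor polynomial.
  have hderiv : ∀ N, ∀ θ ∈ Icc (0 : ℝ) 1, HasDerivAt
      (fun θ : ℝ => ∑ k ∈ Finset.range (N + 1),
        (((1 - θ) ^ k / k.factorial : ℝ) : ℂ) * φ k θ)
      ((((1 - θ) ^ N / N.factorial : ℝ) : ℂ) * φ (N + 1) θ) θ := by
    intro N θ hθ
    induction N with
    | zero => simpa using hφ 0 θ hθ
    | succ N ih =>
      simp_rw [Finset.sum_range_succ _ (N + 1)]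
      have h1 : HasDerivAt (fun θ : ℝ => (1 - θ) ^ (N + 1) / (N + 1).factorial)
          (-((1 - θ) ^ N / N.factorial)) θ := by
        refine ((((hasDerivAt_id' θ).const_sub 1).fun_pow (N + 1)).div_const
          ((N + 1).factorial : ℝ)).congr_deriv ?_
        rw [Nat.factorial_succ]
        have : (N.factorial : ℝ) ≠ 0 := by positivity
        push_cast
        simp
        field_simp
      have h2 := (h1.ofReal_comp.mul (hφ (N + 1) θ hθ))
      refine (ih.add h2).congr_deriv ?_
      push_cast
      ring
  have h0 := intervalIntegral.integral_eq_sub_of_hasDerivAt (a := 0) (b := 1)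
    (f := fun θ : ℝ => ∑ k ∈ Finset.range (N + 1),
        (((1 - θ) ^ k / k.factorial : ℝ) : ℂ) * φ k θ)
    (f' := fun θ => (((1 - θ) ^ N / N.factorial : ℝ) : ℂ) * φ (N + 1) θ)
    (fun θ hθ => hderiv N θ (by simpa using hθ)) (by
      apply ContinuousOn.intervalIntegrable
      rw [uIcc_of_le zero_le_one]
      refine ContinuousOn.mul ?_ (hc _)
      exact (by fun_prop : Continuous fun θ : ℝ =>
        (((1 - θ) ^ N / N.factorial : ℝ) : ℂ)).continuousOn)
  rw [h0]
  congr 1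
  · rw [Finset.sum_range_succ', Finset.sum_eq_zero]
    · simp
    · intro k _
      simp
  · refine Finset.sum_congr rfl fun k _ => ?_
    simp
    ring

/-- Grönwall's inequality in integral form. -/
theorem gronwall_integral {M κ : ℝ → ℝ} (hM : Continuous M) (hκ : Continuous κ)
    (hκ0 : ∀ t, 0 ≤ κ t) {a L T : ℝ} (hT : 0 < T)
    (h : ∀ t, 0 < t → t ≤ T → M t ≤ a + ∫ s in (0 : ℝ)..t, κ s * M s)
    (hL : ∫ s in (0 : ℝ)..T, κ s ≤ L) (ha : 0 ≤ a) : M T ≤ a * Real.exp L := by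
  have hy : ∀ t, HasDerivAt (fun t => ∫ s in (0 : ℝ)..t, κ s * M s) (κ t * M t) t := fun t =>
    intervalIntegral.integral_hasDerivAt_right ((hκ.mul hM).intervalIntegrable _ _)
      ((hκ.mul hM).stronglyMeasurableAtFilter _ _) (hκ.mul hM).continuousAt
  have hΦ : ∀ t, HasDerivAt (fun t => ∫ s in (0 : ℝ)..t, κ s) (κ t) t := fun t =>
    intervalIntegral.integral_hasDerivAt_right (hκ.intervalIntegrable _ _)
      (hκ.stronglyMeasurableAtFilter _ _) hκ.continuousAt
  set y := fun t => ∫ s in (0 : ℝ)..t, κ s * M s with hydef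
  set Φ := fun t => ∫ s in (0 : ℝ)..t, κ s with hΦdef
  have hz : ∀ t, HasDerivAt (fun t => (a + y t) * Real.exp (-Φ t))
      (κ t * M t * Real.exp (-Φ t) + (a + y t) * (Real.exp (-Φ t) * -κ t)) t := fun t =>
    ((hy t).const_add a).mul ((hΦ t).neg.exp)
  -- Integrating factor: the hypothesis reads y' ≤ κ (a + y).
  have hanti : AntitoneOn (fun t => (a + y t) * Real.exp (-Φ t)) (Icc 0 T) := by
    refine antitoneOn_of_deriv_nonpos (convex_Icc 0 T)
      (fun t _ => (hz t).continuousAt.continuousWithinAt)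
      (fun t _ => (hz t).differentiableAt.differentiableWithinAt) fun t ht => ?_
    rw [interior_Icc] at ht
    rw [(hz t).deriv]
    have h1 := h t ht.1 ht.2.le
    have h2 : κ t * (M t - (a + y t)) ≤ 0 := mul_nonpos_of_nonneg_of_nonpos (hκ0 t) (by linarith)
    have h3 := mul_nonpos_of_nonpos_of_nonneg h2 (Real.exp_pos (-Φ t)).le
    linarith
  have h1 := hanti (left_mem_Icc.mpr hT.le) (right_mem_Icc.mpr hT.le) hT.le
  have h0 : (a + y 0) * Real.exp (-Φ 0) = a := by simp [hydef, hΦdef]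
  simp only [h0] at h1
  calc M T ≤ a + y T := h T hT le_rfl
    _ = (a + y T) * Real.exp (-Φ T) * Real.exp (Φ T) := by
      rw [mul_assoc, ← Real.exp_add]; simp
    _ ≤ a * Real.exp (Φ T) := by gcongr
    _ ≤ a * Real.exp L := by gcongr

/-- Interpolation between `L¹` and `L^∞`. -/
theorem eLpNorm_interpolation {α : Type*} [MeasurableSpace α] {μ : Measure α} {g : α → ℂ}
    {R τ : ℝ} (hR : 0 < R) (hτ : 0 < τ) (h1 : eLpNorm g 1 μ ≤ ENNReal.ofReal R)
    (h2 : eLpNorm g ∞ μ ≤ ENNReal.ofReal (R * τ)) {q : ℝ≥0∞} (hq : 1 ≤ q) :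
    eLpNorm g q μ ≤ ENNReal.ofReal (R * τ ^ (1 - (q⁻¹).toReal)) := by
  by_cases hqt : q = ∞
  · subst hqt
    simpa using h2
  have hr1 : 1 ≤ q.toReal := by
    have := ENNReal.toReal_mono hqt hq
    simpa using this
  have hr0 : 0 < q.toReal := by linarith
  have hq0 : q ≠ 0 := (lt_of_lt_of_le zero_lt_one hq).ne'
  rw [eLpNorm_eq_lintegral_rpow_enorm_toReal hq0 hqt, ENNReal.toReal_inv]
  set r := q.toReal with hr
  have hae : ∀ᵐ x ∂μ, ‖g x‖ₑ ≤ ENNReal.ofReal (R * τ) := by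
    filter_upwards [ae_le_eLpNormEssSup (f := g) (μ := μ)] with x hx
    refine hx.trans ?_
    simpa using h2
  rw [eLpNorm_one_eq_lintegral_enorm] at h1
  -- Of the r factors |g|, all but one are bounded by the sup norm.
  have hI : ∫⁻ x, ‖g x‖ₑ ^ r ∂μ ≤ ENNReal.ofReal (R * τ) ^ (r - 1) * ENNReal.ofReal R := by
    calc ∫⁻ x, ‖g x‖ₑ ^ r ∂μ ≤ ∫⁻ x, ENNReal.ofReal (R * τ) ^ (r - 1) * ‖g x‖ₑ ∂μ := by
          refine lintegral_mono_ae ?_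
          filter_upwards [hae] with x hx
          calc ‖g x‖ₑ ^ r = ‖g x‖ₑ ^ (r - 1) * ‖g x‖ₑ := by
                conv_rhs => rw [← ENNReal.rpow_one ‖g x‖ₑ, ← ENNReal.rpow_mul, one_mul]
                rw [← ENNReal.rpow_add_of_nonneg _ _ (by linarith) zero_le_one]
                simp
            _ ≤ _ := by gcongr
      _ = ENNReal.ofReal (R * τ) ^ (r - 1) * ∫⁻ x, ‖g x‖ₑ ∂μ :=
          lintegral_const_mul' _ _ (ENNReal.rpow_ne_top_of_nonneg (by linarith)
            ENNReal.ofReal_ne_top)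
      _ ≤ _ := by gcongr
  calc (∫⁻ x, ‖g x‖ₑ ^ r ∂μ) ^ (1 / r)
      ≤ (ENNReal.ofReal (R * τ) ^ (r - 1) * ENNReal.ofReal R) ^ (1 / r) := by gcongr
    _ = ENNReal.ofReal (((R * τ) ^ (r - 1) * R) ^ (1 / r)) := by
      rw [ENNReal.ofReal_rpow_of_nonneg (by positivity) (by linarith),
        ← ENNReal.ofReal_mul (by positivity),
        ENNReal.ofReal_rpow_of_nonneg (by positivity) (by positivity)]
    _ = ENNReal.ofReal (R * τ ^ (1 - r⁻¹)) := by
      congr 1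
      rw [Real.mul_rpow hR.le hτ.le]
      have : R ^ (r - 1) * τ ^ (r - 1) * R = R ^ r * τ ^ (r - 1) := by
        rw [mul_right_comm, ← Real.rpow_add_one hR.ne']; simp
      rw [this, Real.mul_rpow (by positivity) (by positivity), ← Real.rpow_mul hR.le,
        ← Real.rpow_mul hτ.le, mul_one_div_cancel hr0.ne', Real.rpow_one]
      congr 2
      field_simp

/-! ### Multi-indices -/

theorem len_add {n : ℕ} (α β : MIdx n) : len (α + β) = len α + len β := by
  simp [len, Finset.sum_add_distrib]

theorem len_single {n : ℕ} (i : Fin n) (k : ℕ) : len (Pi.single i k : MIdx n) = k := by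
  simp [len]

theorem len_smul {n : ℕ} (k : ℕ) (α : MIdx n) : len (k • α) = k * len α := by
  simp [len, Finset.mul_sum]

theorem fact_pos {n : ℕ} (α : MIdx n) : 0 < fact α :=
  Finset.prod_pos fun _ _ => Nat.factorial_pos _

theorem fact_add_single {n : ℕ} (α : MIdx n) (i : Fin n) :
    fact (α + Pi.single i 1) = (α i + 1) * fact α := by
  unfold fact
  rw [← Finset.mul_prod_erase _ _ (Finset.mem_univ i),
    ← Finset.mul_prod_erase _ (fun j => (α j).factorial) (Finset.mem_univ i)]
  have : ∀ j ∈ Finset.univ.erase i, ((α + Pi.single i 1 : MIdx n) j).factorial = (α j).factorial := by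
    intro j hj
    rw [Finset.mem_erase] at hj
    simp [Pi.single_eq_of_ne hj.1]
  rw [Finset.prod_congr rfl this]
  simp [Nat.factorial_succ, mul_assoc]

theorem monom_add {n : ℕ} (α β : MIdx n) (x : Sp n) :
    monom (α + β) x = monom α x * monom β x := by
  simp [monom, pow_add, Finset.prod_mul_distrib]

theorem monom_single {n : ℕ} (i : Fin n) (k : ℕ) (x : Sp n) :
    monom (Pi.single i k) x = x i ^ k := by
  unfold monom
  rw [Finset.prod_eq_single i]
  · simp
  · intro j _ hj
    simp [Pi.single_eq_of_ne hj]
  · simp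

theorem abs_monom_le {n : ℕ} (α : MIdx n) (x : Sp n) : |monom α x| ≤ ‖x‖ ^ len α := by
  unfold monom len
  rw [Finset.abs_prod, ← Finset.prod_pow_eq_pow_sum]
  refine Finset.prod_le_prod (fun _ _ => abs_nonneg _) fun i _ => ?_
  rw [abs_pow]
  gcongr
  exact PiLp.norm_apply_le x i

@[fun_prop]
theorem continuous_monom {n : ℕ} (α : MIdx n) : Continuous (monom α : Sp n → ℝ) := by
  unfold monom
  fun_prop

theorem ofLen_zero (n : ℕ) : ofLen n 0 = {0} := by
  ext α
  rw [mem_ofLen, Finset.mem_singleton, len, Finset.sum_eq_zero_iff]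
  exact ⟨fun h => funext fun i => h i (Finset.mem_univ i), fun h i _ => by simp [h]⟩

/-- The multinomial recursion. -/
theorem sum_ofLen_succ {n : ℕ} (k : ℕ) (c : MIdx n → ℂ) :
    ∑ β ∈ ofLen n k, (1 / (fact β : ℂ)) * ∑ i, c (β + Pi.single i 1) =
      (k + 1 : ℂ) * ∑ β ∈ ofLen n (k + 1), (1 / (fact β : ℂ)) * c β := by
  -- Substitute β + e_i for β, using 1/β! = (β_i + 1)/(β + e_i)!. The indices with β_i = 0 are not
  -- reached, but carry the factor β_i. Summing over i then produces |β| = k + 1.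
  have key : ∀ i : Fin n, ∑ β ∈ ofLen n k, (1 / (fact β : ℂ)) * c (β + Pi.single i 1) =
      ∑ β ∈ ofLen n (k + 1), (β i : ℂ) * ((1 / (fact β : ℂ)) * c β) := by
    intro i
    refine Finset.sum_of_injOn (fun β => β + Pi.single i 1) ?_ ?_ ?_ ?_
    · exact fun a _ b _ h => add_right_cancel h
    · intro β hβ
      simp only [Finset.mem_coe, mem_ofLen] at *
      rw [len_add, hβ, len_single]
    · intro β hβ h
      have : β i = 0 := by
        by_contra hne
        refine h ⟨β - Pi.single i 1, ?_, ?_⟩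
        · have hle : Pi.single i 1 ≤ β := by
            intro j
            by_cases hj : j = i
            · subst hj; simp; omega
            · simp [Pi.single_eq_of_ne hj]
          have h2 : β - Pi.single i 1 + Pi.single i 1 = β := tsub_add_cancel_of_le hle
          simp only [Finset.mem_coe, mem_ofLen] at *
          have := congrArg len h2
          rw [len_add, len_single, hβ] at this
          omega
        · have hle : Pi.single i 1 ≤ β := by
            intro j
            by_cases hj : j = i
            · subst hj; simp; omega
            · simp [Pi.single_eq_of_ne hj]
          exact tsub_add_cancel_of_le hle
      simp [this]
    · intro β _
      rw [fact_add_single]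
      have h1 : (fact β : ℂ) ≠ 0 := by exact_mod_cast (fact_pos β).ne'
      have h2 : ((β i : ℂ) + 1) ≠ 0 := by exact_mod_cast Nat.succ_ne_zero (β i)
      simp
      field_simp
  simp_rw [Finset.mul_sum]
  rw [Finset.sum_comm]
  simp_rw [key]
  rw [Finset.sum_comm]
  refine Finset.sum_congr rfl fun β hβ => ?_
  rw [← Finset.sum_mul]
  congr 1
  rw [mem_ofLen] at hβ
  rw [← Nat.cast_sum]
  exact_mod_cast hβ

/-! ### The norms of `L¹` and `L^∞` for functions defined everywhere -/

/-- The `L¹` norm for `q = 1`, and the supremum of the modulus otherwise. -/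
noncomputable def bnorm {n : ℕ} (q : ℝ≥0∞) (φ : Sp n → ℂ) : ℝ≥0∞ :=
  if q = 1 then ∫⁻ x, ‖φ x‖ₑ else ⨆ x, ‖φ x‖ₑ

theorem bnorm_one {n : ℕ} (φ : Sp n → ℂ) : bnorm 1 φ = ∫⁻ x, ‖φ x‖ₑ := by simp [bnorm]

theorem bnorm_top {n : ℕ} (φ : Sp n → ℂ) : bnorm ∞ φ = ⨆ x, ‖φ x‖ₑ := by simp [bnorm]

/-- Kernels are defined at every point, so the essential supremum can be replaced by a true
supremum. Minkowski's inequality for q = ∞ is then a pointwise statement with no null sets depending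
on the parameter. -/
theorem eLpNorm_le_bnorm {n : ℕ} {q : ℝ≥0∞} (hq : q = 1 ∨ q = ∞) (φ : Sp n → ℂ) :
    eLpNorm φ q volume ≤ bnorm q φ := by
  rcases hq with rfl | rfl
  · rw [bnorm_one, eLpNorm_one_eq_lintegral_enorm]
  · rw [bnorm_top, eLpNorm_exponent_top]
    exact eLpNormEssSup_le_of_ae_enorm_bound (Eventually.of_forall fun x =>
      le_iSup (fun x => ‖φ x‖ₑ) x)

theorem bnorm_mono {n : ℕ} {q : ℝ≥0∞} {φ ψ : Sp n → ℂ} (h : ∀ x, ‖φ x‖ₑ ≤ ‖ψ x‖ₑ) :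
    bnorm q φ ≤ bnorm q ψ := by
  unfold bnorm
  split_ifs
  · exact lintegral_mono h
  · exact iSup_mono h

theorem bnorm_const_mul {n : ℕ} (q : ℝ≥0∞) (c : ℂ) (φ : Sp n → ℂ) :
    bnorm q (fun x => c * φ x) = ‖c‖ₑ * bnorm q φ := by
  unfold bnorm
  simp only [enorm_mul]
  split_ifs
  · exact lintegral_const_mul' _ _ enorm_ne_top
  · rw [ENNReal.mul_iSup]

theorem bnorm_add_le {n : ℕ} {q : ℝ≥0∞} {φ : Sp n → ℂ} (hφ : AEStronglyMeasurable φ volume)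
    (ψ : Sp n → ℂ) : bnorm q (fun x => φ x + ψ x) ≤ bnorm q φ + bnorm q ψ := by
  unfold bnorm
  split_ifs
  · rw [← lintegral_add_left' hφ.enorm]
    exact lintegral_mono fun x => enorm_add_le _ _
  · refine iSup_le fun x => (enorm_add_le _ _).trans ?_
    exact add_le_add (le_iSup (fun x => ‖φ x‖ₑ) x) (le_iSup (fun x => ‖ψ x‖ₑ) x)

theorem bnorm_sum_le {n : ℕ} {ι : Type*} {q : ℝ≥0∞} (s : Finset ι) {φ : ι → Sp n → ℂ}
    (hφ : ∀ i ∈ s, AEStronglyMeasurable (φ i) volume) :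
    bnorm q (fun x => ∑ i ∈ s, φ i x) ≤ ∑ i ∈ s, bnorm q (φ i) := by
  classical
  induction s using Finset.induction_on with
  | empty => simp [bnorm]
  | insert a s ha ih =>
    simp only [Finset.sum_insert ha]
    refine (bnorm_add_le (hφ a (Finset.mem_insert_self a s)) _).trans ?_
    gcongr
    exact ih fun i hi => hφ i (Finset.mem_insert_of_mem hi)

theorem bnorm_comp_sub {n : ℕ} (q : ℝ≥0∞) (φ : Sp n → ℂ) (y : Sp n) :
    bnorm q (fun x => φ (x - y)) = bnorm q φ := by
  unfold bnorm
  split_ifs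
  · exact lintegral_sub_right_eq_self (fun x => ‖φ x‖ₑ) y
  · exact (Equiv.subRight y).iSup_comp (g := fun x => ‖φ x‖ₑ)

/-- Minkowski's inequality for integrals of functions with a parameter. -/
theorem bnorm_integral_le {n : ℕ} {Ω : Type*} [MeasurableSpace Ω] {μ : Measure Ω} [SFinite μ]
    {q : ℝ≥0∞} {H : Ω → Sp n → ℂ}
    (hH : AEStronglyMeasurable (fun z : Sp n × Ω => H z.2 z.1) (volume.prod μ)) :
    bnorm q (fun x => ∫ a, H a x ∂μ) ≤ ∫⁻ a, bnorm q (H a) ∂μ := by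
  unfold bnorm
  split_ifs
  · calc ∫⁻ x, ‖∫ a, H a x ∂μ‖ₑ ≤ ∫⁻ x, ∫⁻ a, ‖H a x‖ₑ ∂μ :=
          lintegral_mono fun x => enorm_integral_le_lintegral_enorm _
      _ = ∫⁻ a, (∫⁻ x, ‖H a x‖ₑ) ∂μ := lintegral_lintegral_swap (f := fun x a => ‖H a x‖ₑ) hH.enorm
  · refine iSup_le fun x => (enorm_integral_le_lintegral_enorm _).trans ?_
    exact lintegral_mono fun a => le_iSup (fun x : Sp n => ‖H a x‖ₑ) x

/-! ### One-dimensional Hermite functions -/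

/-- The `j`-th term of the one-dimensional Hermite polynomial of degree `k`. -/
noncomputable def hermiteTerm (ν : ℂ) (k j : ℕ) (x : ℝ) : ℂ :=
  (((-1) ^ j * (k.factorial : ℂ)) / ((j.factorial : ℂ) * ((k - 2 * j).factorial : ℂ))) *
    (ν⁻¹) ^ (k - j) * (x : ℂ) ^ (k - 2 * j)

/-- The one-dimensional Hermite polynomial. -/
noncomputable def hermite1 (ν : ℂ) (k : ℕ) (x : ℝ) : ℂ :=
  ∑ j ∈ (Finset.range (k + 1)).filter (fun j => 2 * j ≤ k), hermiteTerm ν k j x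

/-- The freedom in K lets the sums of different degrees in the recurrence share one range. -/
theorem hermite1_eq_sum (ν : ℂ) (k : ℕ) (x : ℝ) {K : ℕ} (hK : k < K) :
    hermite1 ν k x = ∑ j ∈ Finset.range K, if 2 * j ≤ k then hermiteTerm ν k j x else 0 := by
  unfold hermite1
  rw [Finset.sum_filter]
  refine Finset.sum_subset (Finset.range_mono hK) fun j _ hj => ?_
  rw [Finset.mem_range] at hj
  rw [if_neg (by omega)]

theorem hermite1_zero (ν : ℂ) (x : ℝ) : hermite1 ν 0 x = 1 := by
  simp [hermite1_eq_sum ν 0 x zero_lt_one, hermiteTerm]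

theorem hermite1_one (ν : ℂ) (x : ℝ) : hermite1 ν 1 x = ν⁻¹ * x := by
  rw [hermite1_eq_sum ν 1 x (K := 1 + 1) one_lt_two, Finset.sum_range_succ, Finset.sum_range_one]
  simp [hermiteTerm]

/-- The three-term recurrence, by comparison of coefficients. It drives both the derivative formula
and the heat equation for the kernels. -/
theorem hermite1_add_two (ν : ℂ) (k : ℕ) (x : ℝ) :
    hermite1 ν (k + 2) x =
      ν⁻¹ * x * hermite1 ν (k + 1) x - 2 * (k + 1) * ν⁻¹ * hermite1 ν k x := by
  rw [hermite1_eq_sum ν (k + 2) x (K := k + 2 + 1) (by omega),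
    hermite1_eq_sum ν (k + 1) x (K := k + 2 + 1) (by omega),
    hermite1_eq_sum ν k x (K := k + 2) (by omega),
    Finset.sum_range_succ', Finset.sum_range_succ' _ (k + 2), mul_add, Finset.mul_sum,
    Finset.mul_sum, add_sub_right_comm, ← Finset.sum_sub_distrib]
  congr 1
  · refine Finset.sum_congr rfl fun j _ => ?_
    -- Index j + 1 on the left meets index j + 1 of degree k + 1 and index j of degree k. For k < 2j
    -- all three terms are absent, for k = 2j only the one of degree k + 1 is, and for k > 2j none
    -- is.
    rcases lt_trichotomy k (2 * j) with h | h | h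
    · rw [if_neg (by omega), if_neg (by omega), if_neg (by omega)]
      simp
    · rw [if_pos (by omega), if_neg (by omega), if_pos (by omega)]
      have h0 : (j.factorial : ℂ) ≠ 0 := by exact_mod_cast j.factorial_ne_zero
      have h1 : ((j : ℂ) + 1) ≠ 0 := by exact_mod_cast Nat.succ_ne_zero j
      subst h
      have e1 : 2 * j + 2 - 2 * (j + 1) = 0 := by omega
      have e2 : 2 * j + 2 - (j + 1) = j + 1 := by omega
      have e3 : 2 * j - j = j := by omega
      simp only [hermiteTerm, e1, e2, e3, Nat.sub_self, Nat.factorial_succ, Nat.factorial_zero]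
      push_cast
      field_simp
      ring
    · rw [if_pos (by omega), if_pos (by omega), if_pos (by omega)]
      obtain ⟨l, rfl⟩ : ∃ l, k = 2 * j + l + 1 := ⟨k - 2 * j - 1, by omega⟩
      have h0 : (j.factorial : ℂ) ≠ 0 := by exact_mod_cast j.factorial_ne_zero
      have h1 : ((j : ℂ) + 1) ≠ 0 := by exact_mod_cast Nat.succ_ne_zero j
      have h2 : ((l : ℂ) + 1) ≠ 0 := by exact_mod_cast Nat.succ_ne_zero l
      have h3 : (l.factorial : ℂ) ≠ 0 := by exact_mod_cast l.factorial_ne_zero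
      have e1 : 2 * j + l + 1 + 2 - 2 * (j + 1) = l + 1 := by omega
      have e2 : 2 * j + l + 1 + 2 - (j + 1) = j + l + 2 := by omega
      have e3 : 2 * j + l + 1 + 1 - 2 * (j + 1) = l := by omega
      have e4 : 2 * j + l + 1 + 1 - (j + 1) = j + l + 1 := by omega
      have e5 : 2 * j + l + 1 - 2 * j = l + 1 := by omega
      have e6 : 2 * j + l + 1 - j = j + l + 1 := by omega
      simp only [hermiteTerm, e1, e2, e3, e4, e5, e6, Nat.factorial_succ]
      push_cast
      field_simp
      ring
  · have h0 : ((k : ℂ) + 1) ≠ 0 := by exact_mod_cast Nat.succ_ne_zero k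
    have h3 : (k.factorial : ℂ) ≠ 0 := by exact_mod_cast k.factorial_ne_zero
    have h2 : ((k : ℂ) + 1 + 1) ≠ 0 := by exact_mod_cast Nat.succ_ne_zero (k + 1)
    simp [hermiteTerm, Nat.factorial_succ]
    field_simp
    ring

theorem hasDerivAt_hermite1_succ (ν : ℂ) (k : ℕ) (x : ℝ) :
    HasDerivAt (hermite1 ν (k + 1)) ((k + 1) * ν⁻¹ * hermite1 ν k x) x := by
  have hx : HasDerivAt (fun x : ℝ => ν⁻¹ * (x : ℂ)) ν⁻¹ x := by
    simpa using (Complex.ofRealCLM.hasDerivAt (x := x)).const_mul ν⁻¹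
  -- The recurrence reaches back two degrees, so the induction carries two consecutive degrees.
  suffices H : HasDerivAt (hermite1 ν (k + 1)) ((k + 1) * ν⁻¹ * hermite1 ν k x) x ∧
      HasDerivAt (hermite1 ν (k + 2)) ((k + 2) * ν⁻¹ * hermite1 ν (k + 1) x) x from H.1
  induction k with
  | zero =>
    have h1 : HasDerivAt (hermite1 ν 1) ν⁻¹ x := by
      rwa [show hermite1 ν 1 = fun x : ℝ => ν⁻¹ * (x : ℂ) from funext (hermite1_one ν)]
    refine ⟨by simpa [hermite1_zero] using h1, ?_⟩
    rw [show hermite1 ν (0 + 2) = _ from funext (hermite1_add_two ν 0)]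
    simp only [hermite1_zero]
    refine ((hx.fun_mul h1).sub_const _).congr_deriv ?_
    simp [hermite1_one]
    ring
  | succ k ih =>
    refine ⟨by simpa [add_assoc, one_add_one_eq_two] using ih.2, ?_⟩
    rw [show hermite1 ν (k + 1 + 2) = _ from funext (hermite1_add_two ν (k + 1))]
    refine ((hx.fun_mul ih.2).fun_sub (ih.1.const_mul _)).congr_deriv ?_
    rw [show k + 1 + 1 = k + 2 from rfl, hermite1_add_two ν k x]
    push_cast
    ring

/-- In this form the first summand cancels against the logarithmic derivative -ν⁻¹x/2 of the
Gaussian, so differentiating a Hermite function only raises its degree and multiplies by -1/2. -/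
theorem hasDerivAt_hermite1 (ν : ℂ) (k : ℕ) (x : ℝ) :
    HasDerivAt (hermite1 ν k) (ν⁻¹ * x / 2 * hermite1 ν k x - hermite1 ν (k + 1) x / 2) x := by
  cases k with
  | zero =>
    rw [show hermite1 ν 0 = fun _ => 1 from funext (hermite1_zero ν)]
    refine (hasDerivAt_const x (1 : ℂ)).congr_deriv ?_
    simp [hermite1_one]
  | succ k =>
    refine (hasDerivAt_hermite1_succ ν k x).congr_deriv ?_
    rw [hermite1_add_two]
    ring

/-- The one-dimensional Gaussian at time `1`. -/
noncomputable def gauss1 (ν : ℂ) (x : ℝ) : ℂ :=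
  (4 * (Real.pi : ℂ) * ν) ^ (-(1 : ℂ) / 2) * Complex.exp (-(ν⁻¹ / 4) * (x : ℂ) ^ 2)

/-- The one-dimensional Hermite function. -/
noncomputable def hermiteFun (ν : ℂ) (k : ℕ) (x : ℝ) : ℂ := hermite1 ν k x * gauss1 ν x

theorem hasDerivAt_hermiteFun (ν : ℂ) (k : ℕ) (x : ℝ) :
    HasDerivAt (hermiteFun ν k) (-(1 / 2) * hermiteFun ν (k + 1) x) x := by
  have hx : HasDerivAt (fun x : ℝ => -(ν⁻¹ / 4) * (x : ℂ) ^ 2) (-(ν⁻¹ / 4) * (2 * x)) x := by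
    simpa using ((Complex.ofRealCLM.hasDerivAt (x := x)).fun_pow 2).const_mul (-(ν⁻¹ / 4))
  have hg : HasDerivAt (gauss1 ν) _ x :=
    hx.cexp.const_mul ((4 * (Real.pi : ℂ) * ν) ^ (-(1 : ℂ) / 2))
  refine ((hasDerivAt_hermite1 ν k x).fun_mul hg).congr_deriv ?_
  simp only [hermiteFun, gauss1]
  ring

theorem continuous_hermiteFun (ν : ℂ) (k : ℕ) : Continuous (hermiteFun ν k) :=
  continuous_iff_continuousAt.mpr fun x => (hasDerivAt_hermiteFun ν k x).continuousAt

/-- This is the heat equation in self-similar variables; `hasDerivAt_kernel1_time` translates it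
back. -/
theorem hermiteFun_recursion (ν : ℂ) (hν : ν ≠ 0) (k : ℕ) (x : ℝ) :
    ν * hermiteFun ν (k + 2) x =
      x * hermiteFun ν (k + 1) x - 2 * (k + 1) * hermiteFun ν k x := by
  simp only [hermiteFun, hermite1_add_two]
  field_simp

theorem exists_norm_hermite1_le (ν : ℂ) (k : ℕ) :
    ∃ C : ℝ, 0 < C ∧ ∀ x : ℝ, ‖hermite1 ν k x‖ ≤ C * (1 + |x|) ^ k := by
  refine ⟨∑ j ∈ (Finset.range (k + 1)).filter (fun j => 2 * j ≤ k), ‖hermiteTerm ν k j 1‖ + 1,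
    by positivity, fun x => ?_⟩
  rw [add_mul, Finset.sum_mul]
  have h0 : 0 ≤ 1 * (1 + |x|) ^ k := by positivity
  refine le_add_of_le_of_nonneg ((norm_sum_le _ _).trans (Finset.sum_le_sum fun j _ => ?_)) h0
  have : hermiteTerm ν k j x = hermiteTerm ν k j 1 * (x : ℂ) ^ (k - 2 * j) := by
    simp [hermiteTerm]
  rw [this, norm_mul, norm_pow, Complex.norm_real, Real.norm_eq_abs]
  gcongr
  calc |x| ^ (k - 2 * j) ≤ (1 + |x|) ^ (k - 2 * j) := by gcongr; linarith
    _ ≤ (1 + |x|) ^ k := pow_le_pow_right₀ (by linarith [abs_nonneg x]) (by omega)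

/-- The rate of Gaussian decay in the kernel estimates. -/
noncomputable def decayRate (ν : ℂ) : ℝ := (ν⁻¹).re / 8

theorem decayRate_pos {ν : ℂ} (hν : 0 < ν.re) : 0 < decayRate ν := by
  have : ν ≠ 0 := by rintro rfl; simp at hν
  have h := Complex.normSq_pos.mpr this
  rw [decayRate, Complex.inv_re]
  positivity

theorem exists_one_add_pow_le (k : ℕ) {c : ℝ} (hc : 0 < c) :
    ∃ C : ℝ, 0 < C ∧ ∀ y : ℝ, 0 ≤ y → (1 + y) ^ k ≤ C * Real.exp (c * y ^ 2) := by
  refine ⟨k.factorial * Real.exp (1 + 1 / (4 * c)), by positivity, fun y hy => ?_⟩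
  have h1 : (1 + y) ^ k ≤ k.factorial * Real.exp (1 + y) := by
    have := Real.pow_div_factorial_le_exp (x := 1 + y) (by linarith) k
    rw [div_le_iff₀ (by positivity)] at this
    linarith
  refine h1.trans ?_
  rw [mul_assoc, ← Real.exp_add]
  refine mul_le_mul_of_nonneg_left (Real.exp_le_exp.mpr ?_) (by positivity)
  -- Completing the square gives y ≤ c y² + 1/(4c).
  have : 0 ≤ (2 * c * y - 1) ^ 2 / (4 * c) := by positivity
  have h2 : (2 * c * y - 1) ^ 2 / (4 * c) = c * y ^ 2 - y + 1 / (4 * c) := by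
    field_simp
    ring
  linarith

theorem exists_norm_hermiteFun_le {ν : ℂ} (hν : 0 < ν.re) (k : ℕ) :
    ∃ C : ℝ, 0 < C ∧ ∀ x : ℝ,
      ‖hermiteFun ν k x‖ ≤ C * Real.exp (-decayRate ν * x ^ 2) := by
  obtain ⟨A, hA, h1⟩ := exists_norm_hermite1_le ν k
  obtain ⟨B, hB, h2⟩ := exists_one_add_pow_le k (decayRate_pos hν)
  set D := ‖(4 * (Real.pi : ℂ) * ν) ^ (-(1 : ℂ) / 2)‖ with hD
  refine ⟨A * B * (D + 1), by positivity, fun x => ?_⟩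
  -- The modulus decays at rate Re(ν⁻¹)/4, twice `decayRate ν`. The spare half absorbs the
  -- polynomial factor.
  have hg : ‖gauss1 ν x‖ = D * Real.exp (-(2 * decayRate ν) * x ^ 2) := by
    rw [gauss1, norm_mul, Complex.norm_exp, ← hD]
    congr 2
    have : (-(ν⁻¹ / 4) * (x : ℂ) ^ 2) = ((x ^ 2 / 4 : ℝ) : ℂ) * -ν⁻¹ := by
      push_cast; ring
    rw [this, Complex.re_ofReal_mul, Complex.neg_re, decayRate]
    ring
  rw [hermiteFun, norm_mul, hg]
  calc ‖hermite1 ν k x‖ * (D * Real.exp (-(2 * decayRate ν) * x ^ 2))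
      ≤ A * (B * Real.exp (decayRate ν * |x| ^ 2)) *
        ((D + 1) * Real.exp (-(2 * decayRate ν) * x ^ 2)) := by
        gcongr
        · exact (h1 x).trans (by gcongr; exact h2 _ (abs_nonneg x))
        · linarith
    _ = A * B * (D + 1) * (Real.exp (decayRate ν * |x| ^ 2) *
        Real.exp (-(2 * decayRate ν) * x ^ 2)) := by ring
    _ = _ := by
      rw [← Real.exp_add, sq_abs]
      congr 2
      ring

/-- The `k`-th derivative of the one-dimensional heat kernel at time `r⁻²`. -/
noncomputable def kernel1 (ν : ℂ) (k : ℕ) (r x : ℝ) : ℂ :=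
  ((-2 : ℂ)⁻¹) ^ k * (r : ℂ) ^ (k + 1) * hermiteFun ν k (r * x)

theorem continuous_kernel1 (ν : ℂ) (k : ℕ) :
    Continuous fun z : ℝ × ℝ => kernel1 ν k z.1 z.2 := by
  have := continuous_hermiteFun ν k
  unfold kernel1
  fun_prop

theorem hasDerivAt_kernel1_space (ν : ℂ) (k : ℕ) (r x : ℝ) :
    HasDerivAt (kernel1 ν k r) (kernel1 ν (k + 1) r x) x := by
  have h := (hasDerivAt_hermiteFun ν k (r * x)).scomp x ((hasDerivAt_id' x).const_mul r)
  refine (h.const_mul (((-2 : ℂ)⁻¹) ^ k * (r : ℂ) ^ (k + 1))).congr_deriv ?_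
  simp only [kernel1, Complex.real_smul]
  push_cast
  ring

theorem hasDerivAt_kernel1_scale (ν : ℂ) (k : ℕ) (r x : ℝ) :
    HasDerivAt (fun r => kernel1 ν k r x)
      (((-2 : ℂ)⁻¹) ^ k * ((k + 1) * (r : ℂ) ^ k * hermiteFun ν k (r * x) +
        (r : ℂ) ^ (k + 1) * (x * (-(1 / 2) * hermiteFun ν (k + 1) (r * x))))) r := by
  have h := (hasDerivAt_hermiteFun ν k (r * x)).scomp r ((hasDerivAt_id' r).mul_const x)
  have h2 := ((Complex.ofRealCLM.hasDerivAt (x := r)).fun_pow (k + 1)).fun_mul h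
  refine (h2.const_mul (((-2 : ℂ)⁻¹) ^ k)).congr_deriv ?_ |>.congr_of_eventuallyEq ?_
  · simp
  · refine Eventually.of_forall fun r => ?_
    simp [kernel1, mul_assoc]

/-- With r = t^{-1/2} one has dr/dt = -r³/2, and the scale derivative becomes ν times the second
space derivative through `hermiteFun_recursion`. -/
theorem hasDerivAt_kernel1_time {ν : ℂ} (hν : ν ≠ 0) (k : ℕ) {t : ℝ} (ht : 0 < t) (x : ℝ) :
    HasDerivAt (fun t : ℝ => kernel1 ν k (t ^ (-(1 : ℝ) / 2)) x)
      (ν * kernel1 ν (k + 2) (t ^ (-(1 : ℝ) / 2)) x) t := by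
  have hr := Real.hasDerivAt_rpow_const (x := t) (p := -(1 : ℝ) / 2) (Or.inl ht.ne')
  have h := (hasDerivAt_kernel1_scale ν k (t ^ (-(1 : ℝ) / 2)) x).scomp t hr
  refine h.congr_deriv ?_
  have e : t ^ (-(1 : ℝ) / 2 - 1) = (t ^ (-(1 : ℝ) / 2)) ^ 3 := by
    rw [← Real.rpow_natCast, ← Real.rpow_mul ht.le]
    norm_num
  rw [e]
  set r := t ^ (-(1 : ℝ) / 2)
  have hrec := hermiteFun_recursion ν hν k (r * x)
  simp only [kernel1, Complex.real_smul]
  have h4 : ((-2 : ℂ)⁻¹) ^ (k + 2) = (1 / 4) * ((-2 : ℂ)⁻¹) ^ k := by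
    rw [pow_add]; norm_num; ring
  rw [h4]
  push_cast at hrec ⊢
  linear_combination (-(1 / 4) * ((-2 : ℂ)⁻¹) ^ k * (r : ℂ) ^ (k + 3)) * hrec

/-! ### Derivatives of the heat kernel -/

/-- The derivative `∂^α G_{tν}`. -/
noncomputable def kernel {n : ℕ} (ν : ℂ) (α : MIdx n) (t : ℝ) (x : Sp n) : ℂ :=
  ∏ i, kernel1 ν (α i) (t ^ (-(1 : ℝ) / 2)) (x i)

/-- The constraint 2β ≤ α, the factorials and the powers all split over coordinates, so the sum over
β is an expanded product. This reduces the kernel calculus to one dimension. -/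
theorem hermite_eq_prod {n : ℕ} (ν : ℂ) (α : MIdx n) (x : Sp n) :
    hermite ν α x = ∏ i, hermite1 ν (α i) (x i) := by
  unfold hermite hermite1
  rw [Finset.prod_univ_sum]
  have hset : (Finset.Iic α).filter (fun β => ∀ i, 2 * β i ≤ α i) =
      Fintype.piFinset fun i => (Finset.range (α i + 1)).filter (fun j => 2 * j ≤ α i) := by
    ext β
    simp only [Finset.mem_filter, Finset.mem_Iic, Fintype.mem_piFinset, Finset.mem_range,
      Order.lt_add_one_iff, forall_and, Pi.le_def]
  rw [hset]
  refine Finset.sum_congr rfl fun β _ => ?_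
  simp only [hermiteTerm, len, fact, monom, Finset.prod_mul_distrib, Finset.prod_div_distrib,
    Finset.prod_pow_eq_pow_sum]
  push_cast
  rfl

theorem four_pi_mul_ne_zero {ν : ℂ} (hν : ν ≠ 0) : 4 * (Real.pi : ℂ) * ν ≠ 0 := by
  have : (Real.pi : ℂ) ≠ 0 := by exact_mod_cast Real.pi_ne_zero
  simp [this, hν]

theorem gauss_one_eq_prod {n : ℕ} {ν : ℂ} (x : Sp n) :
    gauss ν 1 x = ∏ i, gauss1 ν (x i) := by
  unfold gauss gauss1
  rw [Finset.prod_mul_distrib, ← Complex.exp_sum, Finset.prod_const, Finset.card_univ,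
    Fintype.card_fin, ← Complex.cpow_nat_mul]
  congr 2
  · simp
  · ring
  · rw [EuclideanSpace.norm_sq_eq]
    simp only [Real.norm_eq_abs, sq_abs]
    rw [← Finset.mul_sum]
    push_cast
    ring

theorem ofReal_prod_rpow {t : ℝ} (ht : 0 < t) (k : ℕ) :
    (((t ^ (-(1 : ℝ) / 2) : ℝ) : ℂ)) ^ k = ((t ^ (-(k : ℝ) / 2) : ℝ) : ℂ) := by
  rw [← Complex.ofReal_pow, ← Real.rpow_natCast, ← Real.rpow_mul ht.le]
  congr 2
  ring

/-- Each derivative of the self-similar Gaussian contributes t^{-1/2} by scaling and -1/2 from the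
Hermite recursion; this accounts for the normalisation in the profile. -/
theorem kernel_eq {n : ℕ} (ν : ℂ) (α : MIdx n) {t : ℝ} (ht : 0 < t) (x : Sp n) :
    ((-2 : ℂ)⁻¹) ^ len α * ((t ^ (-(len α : ℝ) / 2) : ℝ) : ℂ) *
      dilation t (fun y => hermite ν α y * gauss ν 1 y) x = kernel ν α t x := by
  simp only [kernel, kernel1, Finset.prod_mul_distrib, dilation, hermite_eq_prod,
    gauss_one_eq_prod, hermiteFun, Finset.prod_pow_eq_pow_sum, ← ofReal_prod_rpow ht]
  rw [Finset.sum_add_distrib]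
  simp only [len, Finset.sum_const, Finset.card_univ, Fintype.card_fin, smul_eq_mul, mul_one,
    pow_add, PiLp.smul_apply]
  ring

theorem gauss_eq_kernel {n : ℕ} {ν : ℂ} (hν : ν ≠ 0) {t : ℝ} (ht : 0 < t) (x : Sp n) :
    gauss ν t x = kernel ν 0 t x := by
  rw [← kernel_eq ν 0 ht]
  have h0 : ∀ y : Sp n, hermite ν 0 y = 1 := fun y => by simp [hermite_eq_prod, hermite1_zero]
  simp only [h0, one_mul, dilation, gauss]
  have hlen : len (0 : MIdx n) = 0 := by simp [len]
  have htc : (t : ℂ) ≠ 0 := by exact_mod_cast ht.ne'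
  -- A positive factor t leaves the argument unchanged, so the principal branch is multiplicative
  -- here.
  have e1 : (4 * (Real.pi : ℂ) * (t : ℂ) * ν) ^ (-(n : ℂ) / 2) =
      ((t ^ (-(n : ℝ) / 2) : ℝ) : ℂ) * (4 * (Real.pi : ℂ) * (1 : ℝ) * ν) ^ (-(n : ℂ) / 2) := by
    have hne := four_pi_mul_ne_zero hν
    have : 4 * (Real.pi : ℂ) * (t : ℂ) * ν = (t : ℂ) * (4 * (Real.pi : ℂ) * (1 : ℝ) * ν) := by
      push_cast; ring
    rw [this, Complex.cpow_def_of_ne_zero (mul_ne_zero htc (by simpa using hne)),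
      Complex.log_ofReal_mul ht (by simpa using hne), add_mul, Complex.exp_add,
      Complex.cpow_def_of_ne_zero (by simpa using hne)]
    congr 1
    rw [Complex.ofReal_cpow ht.le, Complex.cpow_def_of_ne_zero htc, Complex.ofReal_log ht.le]
    push_cast
    rfl
  have e2 : ‖t ^ (-(1 : ℝ) / 2) • x‖ ^ 2 = t⁻¹ * ‖x‖ ^ 2 := by
    rw [norm_smul, mul_pow, Real.norm_eq_abs, sq_abs, ← Real.rpow_natCast, ← Real.rpow_mul ht.le]
    norm_num [Real.rpow_neg_one]
  rw [e1, e2, hlen]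
  simp only [Complex.ofReal_one, mul_one, pow_zero, one_mul, Nat.cast_zero, neg_zero, zero_div,
    Real.rpow_zero]
  rw [mul_assoc]
  congr 3
  push_cast
  field_simp

/-- The factors (-2)^{-|α|} 2^{-k} fall short of (-2)^{-|α+β|} by the sign (-1)^k, which is the sign
in the Taylor expansion of a kernel at x - y. -/
theorem Lam_eq {n : ℕ} (ν : ℂ) (α : MIdx n) (N : ℕ) {t : ℝ} (ht : 0 < t) (φ : Sp n → ℂ)
    (x : Sp n) : Lam ν α N t φ x =
      ∑ k ∈ Finset.range (N + 1), ∑ β ∈ ofLen n k,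
        (-1) ^ k * moment β φ * kernel ν (α + β) t x := by
  unfold Lam
  rw [Finset.mul_sum]
  refine Finset.sum_congr rfl fun k _ => ?_
  rw [Finset.mul_sum, Finset.mul_sum]
  refine Finset.sum_congr rfl fun β hβ => ?_
  rw [mem_ofLen] at hβ
  rw [← kernel_eq ν (α + β) ht, len_add, hβ, ← ofReal_prod_rpow ht, ← ofReal_prod_rpow ht,
    ← ofReal_prod_rpow ht, pow_add, pow_add]
  have : ((-2 : ℂ)⁻¹) ^ k = (-1) ^ k * ((2 : ℂ)⁻¹) ^ k := by
    rw [← mul_pow]; norm_num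
  rw [this]
  have h1 : ((-1 : ℂ) ^ k) * (-1) ^ k = 1 := by rw [← mul_pow]; norm_num
  linear_combination (-((-2 : ℂ)⁻¹) ^ len α * (((t ^ (-(1 : ℝ) / 2) : ℝ) : ℂ)) ^ len α *
    ((2 : ℂ)⁻¹ ^ k * (((t ^ (-(1 : ℝ) / 2) : ℝ) : ℂ)) ^ k *
    (moment β φ * dilation t (fun y => hermite ν (α + β) y * gauss ν 1 y) x))) * h1

/-- The product rule yields one raised factor; here it is absorbed into the multi-index, with m = 1
for space derivatives and m = 2 for time derivatives. -/
theorem prod_erase_mul_eq {n : ℕ} (α : MIdx n) (i : Fin n) (m : ℕ) (g : ℕ → Fin n → ℂ) :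
    (∏ j ∈ Finset.univ.erase i, g (α j) j) * g (α i + m) i =
      ∏ j, g ((α + Pi.single i m : MIdx n) j) j := by
  rw [← Finset.prod_erase_mul _ _ (Finset.mem_univ i)]
  congr 1
  · refine Finset.prod_congr rfl fun j hj => ?_
    rw [Finset.mem_erase] at hj
    simp [Pi.single_eq_of_ne hj.1]
  · simp

theorem hasDerivAt_kernel_space {n : ℕ} (ν : ℂ) (α : MIdx n) (t : ℝ) (x y : Sp n)
    (θ : ℝ) : HasDerivAt (fun θ : ℝ => kernel ν α t (x - θ • y))
      (-∑ i, (y i : ℂ) * kernel ν (α + Pi.single i 1) t (x - θ • y)) θ := by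
  have h : ∀ i ∈ Finset.univ, HasDerivAt
      (fun θ : ℝ => kernel1 ν (α i) (t ^ (-(1 : ℝ) / 2)) ((x - θ • y) i))
      (-(y i) * kernel1 ν (α i + 1) (t ^ (-(1 : ℝ) / 2)) ((x - θ • y) i)) θ := by
    intro i _
    have h1 : HasDerivAt (fun θ : ℝ => (x - θ • y) i) (-(y i)) θ := by
      simpa using ((hasDerivAt_id' θ).mul_const (y i)).const_sub (x i)
    refine ((hasDerivAt_kernel1_space ν (α i) _ _).scomp θ h1).congr_deriv ?_
    simp
  refine (HasDerivAt.fun_finsetProd h).congr_deriv ?_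
  rw [← Finset.sum_neg_distrib]
  refine Finset.sum_congr rfl fun i _ => ?_
  unfold kernel
  rw [← prod_erase_mul_eq α i 1
    (fun k j => kernel1 ν k (t ^ (-(1 : ℝ) / 2)) ((x - θ • y) j)), smul_eq_mul]
  ring

theorem hasDerivAt_kernel_time {n : ℕ} {ν : ℂ} (hν : ν ≠ 0) (α : MIdx n) {t : ℝ} (ht : 0 < t)
    (x : Sp n) : HasDerivAt (fun t : ℝ => kernel ν α t x)
      (ν * ∑ i, kernel ν (α + Pi.single i 2) t x) t := by
  refine (HasDerivAt.fun_finsetProd fun i _ =>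
    hasDerivAt_kernel1_time hν (α i) ht (x i)).congr_deriv ?_
  rw [Finset.mul_sum]
  refine Finset.sum_congr rfl fun i _ => ?_
  unfold kernel
  rw [← prod_erase_mul_eq α i 2 (fun k j => kernel1 ν k (t ^ (-(1 : ℝ) / 2)) (x j)), smul_eq_mul]
  ring

theorem measurable_kernel {n : ℕ} (ν : ℂ) (α : MIdx n) :
    Measurable fun z : ℝ × Sp n => kernel ν α z.1 z.2 := by
  have h : ∀ i, Measurable fun z : ℝ × Sp n =>
      kernel1 ν (α i) (z.1 ^ (-(1 : ℝ) / 2)) (z.2 i) := by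
    intro i
    have h2 := (continuous_kernel1 ν (α i)).measurable
    have h3 : Measurable fun z : ℝ × Sp n => z.2 i :=
      (by fun_prop : Continuous fun z : ℝ × Sp n => z.2 i).measurable
    have h4 : Measurable fun z : ℝ × Sp n => z.1 ^ (-(1 : ℝ) / 2) := measurable_fst.pow_const _
    fun_prop
  unfold kernel
  fun_prop

theorem continuous_kernel {n : ℕ} (ν : ℂ) (α : MIdx n) (t : ℝ) :
    Continuous (kernel ν α t : Sp n → ℂ) := by
  have h := fun k => continuous_kernel1 ν k
  unfold kernel
  fun_prop

theorem exists_norm_kernel_le {n : ℕ} {ν : ℂ} (hν : 0 < ν.re) (α : MIdx n) :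
    ∃ C : ℝ, 0 < C ∧ ∀ t : ℝ, 0 < t → ∀ x : Sp n, ‖kernel ν α t x‖ ≤
      C * t ^ (-((n : ℝ) + len α) / 2) * Real.exp (-(decayRate ν / t) * ‖x‖ ^ 2) := by
  choose C hC h using fun i => exists_norm_hermiteFun_le hν (α i)
  refine ⟨∏ i, C i, Finset.prod_pos fun i _ => hC i, fun t ht x => ?_⟩
  have hrhs : (∏ i, C i) * t ^ (-((n : ℝ) + len α) / 2) *
      Real.exp (-(decayRate ν / t) * ‖x‖ ^ 2) = ∏ i, (C i * (t ^ (-(1 : ℝ) / 2)) ^ (α i + 1) *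
        Real.exp (-(decayRate ν / t) * (x i) ^ 2)) := by
    rw [Finset.prod_mul_distrib, Finset.prod_mul_distrib, ← Real.exp_sum, ← Finset.mul_sum,
      Finset.prod_pow_eq_pow_sum, Finset.sum_add_distrib, EuclideanSpace.norm_sq_eq]
    simp only [Real.norm_eq_abs, sq_abs]
    congr 2
    rw [← Real.rpow_natCast, ← Real.rpow_mul ht.le]
    congr 1
    simp [len]
    ring
  rw [hrhs, kernel, norm_prod]
  refine Finset.prod_le_prod (fun _ _ => norm_nonneg _) fun i _ => ?_
  set r := t ^ (-(1 : ℝ) / 2) with hr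
  have hr0 : 0 < r := Real.rpow_pos_of_pos ht _
  have hr2 : r ^ 2 = t⁻¹ := by
    rw [hr, ← Real.rpow_natCast, ← Real.rpow_mul ht.le]
    norm_num [Real.rpow_neg_one]
  have h1 : ‖kernel1 ν (α i) r (x i)‖ ≤ r ^ (α i + 1) * ‖hermiteFun ν (α i) (r * x i)‖ := by
    rw [kernel1, norm_mul, norm_mul, norm_pow, norm_pow, Complex.norm_real,
      Real.norm_of_nonneg hr0.le]
    gcongr
    refine mul_le_of_le_one_left (by positivity) (pow_le_one₀ (norm_nonneg _) ?_)
    rw [norm_inv, norm_neg]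
    norm_num
  refine h1.trans ?_
  calc r ^ (α i + 1) * ‖hermiteFun ν (α i) (r * x i)‖
      ≤ r ^ (α i + 1) * (C i * Real.exp (-decayRate ν * (r * x i) ^ 2)) := by
        gcongr
        exact h i _
    _ = _ := by
      rw [mul_pow, hr2, mul_left_comm, ← mul_assoc]
      congr 2
      ring

theorem lintegral_gaussian {n : ℕ} {b : ℝ} (hb : 0 < b) :
    ∫⁻ x : Sp n, ENNReal.ofReal (Real.exp (-b * ‖x‖ ^ 2)) =
      ENNReal.ofReal ((Real.pi / b) ^ ((n : ℝ) / 2)) := by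
  have hI := GaussianFourier.integral_rexp_neg_mul_sq_norm (V := Sp n) hb
  rw [finrank_euclideanSpace_fin] at hI
  rw [← hI, ofReal_integral_eq_lintegral_ofReal]
  -- The integral of a non-integrable function is 0 by convention, whereas the known value is
  -- positive.
  · by_contra hne
    rw [integral_undef hne] at hI
    have : 0 < (Real.pi / b) ^ ((n : ℝ) / 2) := by positivity
    linarith
  · exact Eventually.of_forall fun x => (Real.exp_pos _).le

/-- Weighted `L¹` bounds of the derivatives of the heat kernel. -/
theorem exists_weighted_kernel_le {n : ℕ} {ν : ℂ} (hν : 0 < ν.re) (α : MIdx n) (j : ℕ) :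
    ∃ C : ℝ, 0 < C ∧ ∀ t : ℝ, 0 < t → ∫⁻ x : Sp n, ‖x‖ₑ ^ j * ‖kernel ν α t x‖ₑ ≤
      ENNReal.ofReal (C * t ^ (((j : ℝ) - len α) / 2)) := by
  obtain ⟨A, hA, h1⟩ := exists_norm_kernel_le (n := n) hν α
  have hc := decayRate_pos hν
  obtain ⟨B, hB, h2⟩ := exists_one_add_pow_le j (c := decayRate ν / 2) (by positivity)
  refine ⟨A * B * (Real.pi / (decayRate ν / 2)) ^ ((n : ℝ) / 2), by positivity,
    fun t ht => ?_⟩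
  set c := decayRate ν with hcdef
  have hs : 0 < t ^ ((1 : ℝ) / 2) := by positivity
  have hs2 : (t ^ ((1 : ℝ) / 2)) ^ 2 = t := by
    rw [← Real.rpow_natCast, ← Real.rpow_mul ht.le]; norm_num
  have hpt : ∀ x : Sp n, ‖x‖ₑ ^ j * ‖kernel ν α t x‖ₑ ≤
      ENNReal.ofReal (A * B * t ^ (((j : ℝ) - n - len α) / 2)) *
        ENNReal.ofReal (Real.exp (-(c / 2 / t) * ‖x‖ ^ 2)) := by
    intro x
    rw [← ofReal_norm, ← ofReal_norm, ← ENNReal.ofReal_pow (norm_nonneg _),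
      ← ENNReal.ofReal_mul (by positivity), ← ENNReal.ofReal_mul (by positivity)]
    refine ENNReal.ofReal_le_ofReal ?_
    -- The weight is measured in units of t^{1/2} and paid for with half of the Gaussian.
    have hx : ‖x‖ ^ j ≤ (t ^ ((1 : ℝ) / 2)) ^ j * (B * Real.exp (c / 2 / t * ‖x‖ ^ 2)) := by
      have h3 := h2 (‖x‖ / t ^ ((1 : ℝ) / 2)) (by positivity)
      have h4 : (‖x‖ / t ^ ((1 : ℝ) / 2)) ^ j ≤ (1 + ‖x‖ / t ^ ((1 : ℝ) / 2)) ^ j := by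
        gcongr; linarith
      have h5 := h4.trans h3
      rw [div_pow, div_le_iff₀ (by positivity)] at h5
      refine h5.trans (le_of_eq ?_)
      rw [div_pow, hs2, mul_comm]
      congr 3
      ring
    calc ‖x‖ ^ j * ‖kernel ν α t x‖ ≤
        (t ^ ((1 : ℝ) / 2)) ^ j * (B * Real.exp (c / 2 / t * ‖x‖ ^ 2)) *
          (A * t ^ (-((n : ℝ) + len α) / 2) * Real.exp (-(c / t) * ‖x‖ ^ 2)) := by
          gcongr
          exact h1 t ht x
      _ = A * B * ((t ^ ((1 : ℝ) / 2)) ^ j * t ^ (-((n : ℝ) + len α) / 2)) *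
          (Real.exp (c / 2 / t * ‖x‖ ^ 2) * Real.exp (-(c / t) * ‖x‖ ^ 2)) := by ring
      _ = _ := by
        rw [← Real.exp_add, ← Real.rpow_natCast, ← Real.rpow_mul ht.le, ← Real.rpow_add ht]
        congr 3
        · ring
        · ring
  refine (lintegral_mono hpt).trans ?_
  rw [lintegral_const_mul' _ _ ENNReal.ofReal_ne_top, lintegral_gaussian (by positivity),
    ← ENNReal.ofReal_mul (by positivity)]
  refine ENNReal.ofReal_le_ofReal (le_of_eq ?_)
  have e : Real.pi / (c / 2 / t) = Real.pi / (c / 2) * t := by field_simp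
  rw [e, Real.mul_rpow (by positivity) ht.le]
  have e2 : t ^ (((j : ℝ) - len α) / 2) =
      t ^ (((j : ℝ) - n - len α) / 2) * t ^ ((n : ℝ) / 2) := by
    rw [← Real.rpow_add ht]
    congr 1
    ring
  rw [e2]
  ring

theorem decayExp_one (n : ℕ) : decayExp n 1 = 0 := by simp [decayExp]

theorem decayExp_top (n : ℕ) : decayExp n ∞ = n / 2 := by simp [decayExp]

theorem exists_bnorm_kernel_le {n : ℕ} {ν : ℂ} (hν : 0 < ν.re) {q : ℝ≥0∞} (hq : q = 1 ∨ q = ∞)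
    (α : MIdx n) : ∃ C : ℝ, 0 < C ∧ ∀ t : ℝ, 0 < t → bnorm q (kernel ν α t : Sp n → ℂ) ≤
      ENNReal.ofReal (C * t ^ (-decayExp n q - (len α : ℝ) / 2)) := by
  rcases hq with rfl | rfl
  · obtain ⟨C, hC, h⟩ := exists_weighted_kernel_le (n := n) hν α 0
    refine ⟨C, hC, fun t ht => ?_⟩
    have := h t ht
    simp only [pow_zero, one_mul] at this
    rw [bnorm_one, decayExp_one]
    refine this.trans (le_of_eq ?_)
    congr 3
    simp
    ring
  · obtain ⟨C, hC, h⟩ := exists_norm_kernel_le (n := n) hν α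
    refine ⟨C, hC, fun t ht => ?_⟩
    rw [bnorm_top, decayExp_top]
    refine iSup_le fun x => ?_
    rw [← ofReal_norm]
    refine ENNReal.ofReal_le_ofReal ((h t ht x).trans ?_)
    have h1 : Real.exp (-(decayRate ν / t) * ‖x‖ ^ 2) ≤ 1 := by
      rw [Real.exp_le_one_iff]
      have := decayRate_pos hν
      have : 0 ≤ decayRate ν / t * ‖x‖ ^ 2 := by positivity
      linarith
    calc _ ≤ C * t ^ (-((n : ℝ) + len α) / 2) * 1 := by gcongr
      _ = _ := by rw [mul_one]; congr 2; ring

/-! ### Linear estimates -/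

/-- The weighted norm `∫ |x|^j |g(x)| dx`. -/
noncomputable def wnorm {n : ℕ} (j : ℕ) (g : Sp n → ℂ) : ℝ≥0∞ := ∫⁻ x, ‖x‖ₑ ^ j * ‖g x‖ₑ

theorem wnorm_zero {n : ℕ} (g : Sp n → ℂ) : wnorm 0 g = ∫⁻ x, ‖g x‖ₑ := by simp [wnorm]

theorem wnorm_le_add {n : ℕ} {j k : ℕ} (hjk : j ≤ k) {g : Sp n → ℂ}
    (hg : AEStronglyMeasurable g volume) : wnorm j g ≤ wnorm 0 g + wnorm k g := by
  unfold wnorm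
  rw [← lintegral_add_left' (by simpa using hg.enorm)]
  refine lintegral_mono fun x => ?_
  rw [← add_mul]
  gcongr
  rcases le_total ‖x‖ₑ 1 with h | h
  · exact (pow_le_one₀ zero_le h).trans (by simp)
  · exact (pow_le_pow_right₀ h hjk).trans (by simp)

theorem enorm_monom_le {n : ℕ} (β : MIdx n) (y : Sp n) :
    ‖(monom β y : ℂ)‖ₑ ≤ ‖y‖ₑ ^ len β := by
  rw [← ofReal_norm, ← ofReal_norm, ← ENNReal.ofReal_pow (norm_nonneg _), Complex.norm_real]
  exact ENNReal.ofReal_le_ofReal (abs_monom_le β y)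

theorem lintegral_monom_mul_le {n : ℕ} (β : MIdx n) (g : Sp n → ℂ) :
    ∫⁻ y, ‖(monom β y : ℂ) * g y‖ₑ ≤ wnorm (len β) g := by
  refine lintegral_mono fun y => ?_
  rw [enorm_mul]
  gcongr
  exact enorm_monom_le β y

theorem integrable_monom_mul {n : ℕ} (β : MIdx n) {g : Sp n → ℂ}
    (hg : AEStronglyMeasurable g volume) (h : wnorm (len β) g < ∞) :
    Integrable (fun y => (monom β y : ℂ) * g y) volume := by
  refine ⟨AEStronglyMeasurable.mul ?_ hg, (lintegral_monom_mul_le β g).trans_lt h⟩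
  exact (Complex.continuous_ofReal.comp (continuous_monom β)).aestronglyMeasurable

theorem enorm_moment_le {n : ℕ} (β : MIdx n) (g : Sp n → ℂ) :
    ‖moment β g‖ₑ ≤ wnorm (len β) g := by
  unfold moment
  rw [enorm_mul]
  have h1 : ‖(1 / (fact β : ℂ))‖ₑ ≤ 1 := by
    rw [← ofReal_norm, ← ENNReal.ofReal_one]
    refine ENNReal.ofReal_le_ofReal ?_
    rw [norm_div, norm_one, Complex.norm_natCast]
    exact div_le_one_of_le₀ (by exact_mod_cast fact_pos β) (by positivity)
  calc _ ≤ 1 * ∫⁻ y, ‖(monom β y : ℂ) * g y‖ₑ := by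
        gcongr; exact enorm_integral_le_lintegral_enorm _
    _ ≤ _ := by rw [one_mul]; exact lintegral_monom_mul_le β g

theorem norm_one_div_fact_le {n : ℕ} (β : MIdx n) : ‖(1 / (fact β : ℂ))‖ₑ ≤ 1 := by
  rw [← ofReal_norm, ← ENNReal.ofReal_one]
  refine ENNReal.ofReal_le_ofReal ?_
  rw [norm_div, norm_one, Complex.norm_natCast]
  exact div_le_one_of_le₀ (by exact_mod_cast fact_pos β) (by positivity)

/-- The convolution of `∂^α G_{tν}` with `g`. -/
noncomputable def kconv {n : ℕ} (ν : ℂ) (α : MIdx n) (t : ℝ) (g : Sp n → ℂ) (x : Sp n) : ℂ :=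
  ∫ y, kernel ν α t (x - y) * g y

theorem semigroup_eq_kconv {n : ℕ} {ν : ℂ} (hν : ν ≠ 0) {t : ℝ} (ht : 0 < t) (g : Sp n → ℂ) :
    semigroup ν t g = kconv ν 0 t g := by
  unfold semigroup kconv
  rw [if_neg ht.ne']
  ext x
  rw [convolution_eq_swap]
  simp_rw [ContinuousLinearMap.mul_apply', gauss_eq_kernel hν ht]

theorem integrable_kernel_mul {n : ℕ} {ν : ℂ} (hν : 0 < ν.re) (α : MIdx n) {t : ℝ} (ht : 0 < t)
    {g : Sp n → ℂ} (hg : Integrable g volume) (x : Sp n) :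
    Integrable (fun y => kernel ν α t (x - y) * g y) volume := by
  obtain ⟨C, hC, h⟩ := exists_norm_kernel_le (n := n) hν α
  refine hg.bdd_mul (c := C * t ^ (-((n : ℝ) + len α) / 2)) ?_ ?_
  · exact ((continuous_kernel ν α t).comp (by fun_prop)).aestronglyMeasurable
  · refine Eventually.of_forall fun y => (h t ht _).trans ?_
    refine mul_le_of_le_one_right (by positivity) ?_
    rw [Real.exp_le_one_iff]
    have := decayRate_pos hν
    have : 0 ≤ decayRate ν / t * ‖x - y‖ ^ 2 := by positivity
    linarith

/-- Young's inequality for the convolution with an integrable function. -/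
theorem bnorm_conv_le {n : ℕ} {q : ℝ≥0∞} {ρ : Sp n → ℂ} (hρ : Measurable ρ) {g : Sp n → ℂ}
    (hg : AEStronglyMeasurable g volume) :
    bnorm q (fun x => ∫ y, ρ (x - y) * g y) ≤ bnorm q ρ * wnorm 0 g := by
  refine (bnorm_integral_le (H := fun y x => ρ (x - y) * g y) ?_).trans ?_
  · exact ((hρ.comp (measurable_fst.sub measurable_snd)).aestronglyMeasurable).mul hg.comp_snd
  · rw [wnorm_zero, ← lintegral_const_mul'' _ hg.enorm]
    refine lintegral_mono fun y => ?_
    simp_rw [mul_comm _ (g y)]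
    rw [bnorm_const_mul, bnorm_comp_sub, mul_comm]

/-- The Taylor polynomial in space of `∂^α G_{tν}(x - y)`, as a function of `x`. -/
noncomputable def spaceTaylor {n : ℕ} (ν : ℂ) (α : MIdx n) (N : ℕ) (t : ℝ) (y x : Sp n) : ℂ :=
  ∑ k ∈ Finset.range (N + 1), ∑ β ∈ ofLen n k,
    (-1) ^ k * ((1 / (fact β : ℂ)) * monom β y) * kernel ν (α + β) t x

/-- Taylor's formula along the segment θ ↦ x - θy. Each θ-derivative is -y·∇, and `sum_ofLen_succ`
collects its powers into multi-index sums. -/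
theorem kernel_sub_spaceTaylor {n : ℕ} (ν : ℂ) (α : MIdx n) (N : ℕ) (t : ℝ) (y x : Sp n) :
    kernel ν α t (x - y) - spaceTaylor ν α N t y x =
      ∫ θ in (0 : ℝ)..1, (((1 - θ) ^ N / N.factorial : ℝ) : ℂ) *
        ((-1) ^ (N + 1) * ((N + 1).factorial : ℂ) * ∑ β ∈ ofLen n (N + 1), (1 / (fact β : ℂ)) *
          (monom β y * kernel ν (α + β) t (x - θ • y))) := by
  have h := taylor_zero_one (φ := fun k θ => (-1) ^ k * (k.factorial : ℂ) *
    ∑ β ∈ ofLen n k, (1 / (fact β : ℂ)) * (monom β y * kernel ν (α + β) t (x - θ • y))) N ?_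
  · rw [← h]
    congr 1
    · simp [ofLen_zero, fact, monom]
    · unfold spaceTaylor
      refine Finset.sum_congr rfl fun k _ => ?_
      have : (k.factorial : ℂ) ≠ 0 := by exact_mod_cast k.factorial_ne_zero
      rw [zero_smul, sub_zero, mul_right_comm, mul_div_assoc, div_self this, mul_one,
        Finset.mul_sum]
      refine Finset.sum_congr rfl fun β _ => ?_
      ring
  · intro k θ _
    have hd : HasDerivAt (fun θ : ℝ => (-1) ^ k * (k.factorial : ℂ) *
        ∑ β ∈ ofLen n k, (1 / (fact β : ℂ)) * (monom β y * kernel ν (α + β) t (x - θ • y)))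
        ((-1) ^ k * (k.factorial : ℂ) * ∑ β ∈ ofLen n k, (1 / (fact β : ℂ)) * (monom β y *
          (-∑ i, (y i : ℂ) * kernel ν (α + β + Pi.single i 1) t (x - θ • y)))) θ := by
      refine HasDerivAt.const_mul _ (HasDerivAt.fun_sum fun β _ => ?_)
      exact ((hasDerivAt_kernel_space ν (α + β) t x y θ).const_mul _).const_mul _
    refine hd.congr_deriv ?_
    have hm := sum_ofLen_succ k (fun β => (monom β y : ℂ) * kernel ν (α + β) t (x - θ • y))
    rw [pow_succ, Nat.factorial_succ]
    have e : ∑ β ∈ ofLen n k, (1 / (fact β : ℂ)) * (monom β y *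
          (-∑ i, (y i : ℂ) * kernel ν (α + β + Pi.single i 1) t (x - θ • y))) =
        -∑ β ∈ ofLen n k, (1 / (fact β : ℂ)) * ∑ i, (monom (β + Pi.single i 1) y : ℂ) *
          kernel ν (α + (β + Pi.single i 1)) t (x - θ • y) := by
      rw [← Finset.sum_neg_distrib]
      refine Finset.sum_congr rfl fun β _ => ?_
      rw [mul_neg, mul_neg, Finset.mul_sum]
      congr 2
      refine Finset.sum_congr rfl fun i _ => ?_
      rw [monom_add, monom_single, pow_one, add_assoc]
      push_cast
      ring
    rw [e, hm]
    push_cast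
    ring

/-- Used for the Taylor remainders: the weight (1-θ)^N/N! is at most 1, so a bound uniform in θ
passes to the integral. -/
theorem bnorm_intervalIntegral_le {n : ℕ} {q : ℝ≥0∞} {H : ℝ → Sp n → ℂ}
    (hH : Measurable fun z : Sp n × ℝ => H z.2 z.1) {B : ℝ≥0∞}
    (hB : ∀ θ ∈ Icc (0 : ℝ) 1, bnorm q (H θ) ≤ B) (N : ℕ) :
    bnorm q (fun x => ∫ θ in (0 : ℝ)..1, (((1 - θ) ^ N / N.factorial : ℝ) : ℂ) * H θ x) ≤ B := by
  simp_rw [intervalIntegral.integral_of_le zero_le_one]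
  refine (bnorm_integral_le
    (H := fun θ x => (((1 - θ) ^ N / N.factorial : ℝ) : ℂ) * H θ x) ?_).trans ?_
  · refine AEStronglyMeasurable.mul ?_ hH.aestronglyMeasurable
    exact (by fun_prop : Continuous fun z : Sp n × ℝ =>
      (((1 - z.2) ^ N / N.factorial : ℝ) : ℂ)).aestronglyMeasurable
  · calc _ ≤ ∫⁻ _ in Ioc (0 : ℝ) 1, B := by
          refine setLIntegral_mono_ae measurable_const.aemeasurable
            (Eventually.of_forall fun θ hθ => ?_)
          rw [bnorm_const_mul]
          refine (mul_le_of_le_one_left zero_le ?_).trans (hB θ ⟨hθ.1.le, hθ.2⟩)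
          rw [← ofReal_norm, ← ENNReal.ofReal_one]
          refine ENNReal.ofReal_le_ofReal ?_
          have h1 : 0 ≤ 1 - θ := by linarith [hθ.2]
          rw [Complex.norm_real, Real.norm_of_nonneg (by positivity)]
          refine div_le_one_of_le₀ ((pow_le_one₀ h1 (by linarith [hθ.1])).trans ?_) (by positivity)
          exact_mod_cast N.factorial_pos
      _ = B := by simp

/-- Both norms are translation invariant, so the shift θy in the remainder is harmless and each of
the N + 1 derivatives gains t^{-1/2} at the cost of a factor |y|. -/
theorem exists_bnorm_spaceTaylor_le {n : ℕ} {ν : ℂ} (hν : 0 < ν.re) {q : ℝ≥0∞}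
    (hq : q = 1 ∨ q = ∞) (α : MIdx n) (N : ℕ) : ∃ C : ℝ, 0 < C ∧ ∀ t : ℝ, 0 < t → ∀ y : Sp n,
      bnorm q (fun x => kernel ν α t (x - y) - spaceTaylor ν α N t y x) ≤
        ENNReal.ofReal (C * t ^ (-decayExp n q - ((len α : ℝ) + N + 1) / 2)) *
          ‖y‖ₑ ^ (N + 1) := by
  choose C hC h using fun α => exists_bnorm_kernel_le (n := n) hν hq α
  refine ⟨(N + 1).factorial * ∑ β ∈ ofLen n (N + 1), C (α + β) + 1, ?_, fun t ht y => ?_⟩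
  · have : 0 ≤ ∑ β ∈ ofLen n (N + 1), C (α + β) := Finset.sum_nonneg fun β _ => (hC _).le
    positivity
  simp_rw [kernel_sub_spaceTaylor]
  set τ := t ^ (-decayExp n q - ((len α : ℝ) + N + 1) / 2) with hτ
  have hτ0 : 0 < τ := Real.rpow_pos_of_pos ht _
  refine bnorm_intervalIntegral_le
    (H := fun θ x => (-1) ^ (N + 1) * ((N + 1).factorial : ℂ) * ∑ β ∈ ofLen n (N + 1),
      (1 / (fact β : ℂ)) * (monom β y * kernel ν (α + β) t (x - θ • y))) ?_ (fun θ _ => ?_) N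
  · have := fun β => (continuous_kernel ν (α + β) t : Continuous (kernel ν (α + β) t : Sp n → ℂ))
    exact (by fun_prop : Continuous fun z : Sp n × ℝ => _).measurable
  · rw [bnorm_const_mul]
    have hsum : bnorm q (fun x => ∑ β ∈ ofLen n (N + 1),
        (1 / (fact β : ℂ)) * (monom β y * kernel ν (α + β) t (x - θ • y))) ≤
        ∑ β ∈ ofLen n (N + 1), ENNReal.ofReal (C (α + β) * τ) * ‖y‖ₑ ^ (N + 1) := by
      refine (bnorm_sum_le _ fun β _ => ?_).trans (Finset.sum_le_sum fun β hβ => ?_)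
      · have := (continuous_kernel ν (α + β) t : Continuous (kernel ν (α + β) t : Sp n → ℂ))
        exact (by fun_prop : Continuous fun x : Sp n => _).aestronglyMeasurable
      · rw [mem_ofLen] at hβ
        rw [bnorm_const_mul, bnorm_const_mul, bnorm_comp_sub q (kernel ν (α + β) t)]
        refine (mul_le_of_le_one_left zero_le (norm_one_div_fact_le β)).trans ?_
        rw [mul_comm]
        refine mul_le_mul' ?_ (hβ ▸ enorm_monom_le β y)
        refine (h (α + β) t ht).trans (le_of_eq ?_)
        rw [len_add, hβ, hτ]
        congr 3
        push_cast
        ring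
    have hn : ‖(-1 : ℂ) ^ (N + 1) * ((N + 1).factorial : ℂ)‖ₑ =
        ENNReal.ofReal ((N + 1).factorial : ℝ) := by
      rw [← ofReal_norm, norm_mul, norm_pow, norm_neg, norm_one, one_pow, one_mul,
        Complex.norm_natCast]
    rw [hn]
    refine (mul_le_mul_right hsum _).trans ?_
    rw [← Finset.sum_mul, ← mul_assoc,
      ← ENNReal.ofReal_sum_of_nonneg (fun β _ => by have := hC (α + β); positivity),
      ← ENNReal.ofReal_mul (by positivity), ← Finset.sum_mul]
    refine mul_le_mul' (ENNReal.ofReal_le_ofReal ?_) le_rfl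
    rw [← mul_assoc, add_mul]
    linarith

/-- Moment expansion of the convolution with a derivative of the heat kernel. -/
noncomputable def momentSum {n : ℕ} (ν : ℂ) (α : MIdx n) (N : ℕ) (t : ℝ) (g : Sp n → ℂ)
    (x : Sp n) : ℂ :=
  ∑ k ∈ Finset.range (N + 1), ∑ β ∈ ofLen n k, (-1) ^ k * moment β g * kernel ν (α + β) t x

theorem continuous_momentSum {n : ℕ} (ν : ℂ) (α : MIdx n) (N : ℕ) (t : ℝ) (g : Sp n → ℂ) :
    Continuous (momentSum ν α N t g) := by
  have := fun β => (continuous_kernel ν (α + β) t : Continuous (kernel ν (α + β) t : Sp n → ℂ))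
  unfold momentSum
  fun_prop

/-- Integrating the Taylor polynomial of the kernel against g produces the moments of g; the
remainder consumes one moment more. -/
theorem exists_bnorm_kconv_sub_momentSum_le {n : ℕ} {ν : ℂ} (hν : 0 < ν.re) {q : ℝ≥0∞}
    (hq : q = 1 ∨ q = ∞) (α : MIdx n) (N : ℕ) : ∃ C : ℝ, 0 < C ∧ ∀ t : ℝ, 0 < t →
      ∀ g : Sp n → ℂ, Integrable g volume → wnorm (N + 1) g < ∞ →
      bnorm q (fun x => kconv ν α t g x - momentSum ν α N t g x) ≤
        ENNReal.ofReal (C * t ^ (-decayExp n q - ((len α : ℝ) + N + 1) / 2)) *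
          wnorm (N + 1) g := by
  obtain ⟨C, hC, h⟩ := exists_bnorm_spaceTaylor_le hν hq α N
  refine ⟨C, hC, fun t ht g hg hw => ?_⟩
  have hmom : ∀ k ∈ Finset.range (N + 1), ∀ β ∈ ofLen n k,
      Integrable (fun y => (monom β y : ℂ) * g y) volume := by
    intro k hk β hβ
    rw [mem_ofLen] at hβ
    rw [Finset.mem_range] at hk
    refine integrable_monom_mul β hg.aestronglyMeasurable ?_
    refine (wnorm_le_add (k := N + 1) (by omega) hg.aestronglyMeasurable).trans_lt ?_
    rw [wnorm_zero]
    exact ENNReal.add_lt_top.mpr ⟨hg.2, hw⟩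
  have heq : (fun x => kconv ν α t g x - momentSum ν α N t g x) =
      fun x => ∫ y, (kernel ν α t (x - y) - spaceTaylor ν α N t y x) * g y := by
    ext x
    have hT : ∀ y, spaceTaylor ν α N t y x * g y = ∑ k ∈ Finset.range (N + 1), ∑ β ∈ ofLen n k,
        ((-1) ^ k * (1 / (fact β : ℂ)) * kernel ν (α + β) t x) * ((monom β y : ℂ) * g y) := by
      intro y
      simp only [spaceTaylor, Finset.sum_mul]
      exact Finset.sum_congr rfl fun k _ => Finset.sum_congr rfl fun β _ => by ring
    have hI : ∀ k ∈ Finset.range (N + 1), ∀ β ∈ ofLen n k, Integrable (fun y =>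
        ((-1) ^ k * (1 / (fact β : ℂ)) * kernel ν (α + β) t x) * ((monom β y : ℂ) * g y))
        volume := fun k hk β hβ => (hmom k hk β hβ).const_mul _
    simp_rw [sub_mul, hT]
    rw [integral_sub (integrable_kernel_mul hν α ht hg x)
      (integrable_finsetSum _ fun k hk => integrable_finsetSum _ fun β hβ => hI k hk β hβ),
      integral_finsetSum _ fun k hk => integrable_finsetSum _ fun β hβ => hI k hk β hβ]
    unfold kconv momentSum
    congr 1
    refine Finset.sum_congr rfl fun k hk => ?_
    rw [integral_finsetSum _ fun β hβ => hI k hk β hβ]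
    refine Finset.sum_congr rfl fun β _ => ?_
    rw [integral_const_mul, moment]
    ring
  rw [heq]
  refine (bnorm_integral_le
    (H := fun y x => (kernel ν α t (x - y) - spaceTaylor ν α N t y x) * g y) ?_).trans ?_
  · refine AEStronglyMeasurable.mul ?_ hg.aestronglyMeasurable.comp_snd
    have h1 := fun β => (continuous_kernel ν (α + β) t :
      Continuous (kernel ν (α + β) t : Sp n → ℂ))
    have h2 := (continuous_kernel ν α t : Continuous (kernel ν α t : Sp n → ℂ))
    unfold spaceTaylor
    exact (by fun_prop : Continuous fun z : Sp n × Sp n => _).aestronglyMeasurable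
  · unfold wnorm
    rw [← lintegral_const_mul' _ _ ENNReal.ofReal_ne_top]
    refine lintegral_mono fun y => ?_
    simp_rw [mul_comm _ (g y)]
    rw [bnorm_const_mul, mul_comm]
    calc _ ≤ _ := mul_le_mul_left (h t ht y) _
      _ = _ := by ring

/-- The Taylor polynomial in time of `G_{(t-s)ν}`. -/
noncomputable def timeTaylor {n : ℕ} (ν : ℂ) (J : ℕ) (t s : ℝ) (x : Sp n) : ℂ :=
  ∑ j ∈ Finset.range (J + 1), ∑ γ ∈ ofLen n j,
    ((-ν) ^ j * (s : ℂ) ^ j / (fact γ : ℂ)) * kernel ν (2 • γ) t x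

/-- Along θ ↦ t - θs each derivative is -sνΔ by the heat equation, and the multinomial expansion of
Δ^k = k! ∑ ∂^{2γ}/γ! gives the sum over γ. -/
theorem kernel_sub_timeTaylor {n : ℕ} {ν : ℂ} (hν : ν ≠ 0) (J : ℕ) {t s : ℝ} (ht : 0 < t)
    (hst : s ≤ t / 2) (x : Sp n) :
    kernel ν 0 (t - s) x - timeTaylor ν J t s x =
      ∫ θ in (0 : ℝ)..1, (((1 - θ) ^ J / J.factorial : ℝ) : ℂ) *
        (((J + 1).factorial : ℂ) * (-ν * s) ^ (J + 1) * ∑ γ ∈ ofLen n (J + 1),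
          (1 / (fact γ : ℂ)) * kernel ν (2 • γ) (t - θ * s) x) := by
  have h := taylor_zero_one (φ := fun k θ => (k.factorial : ℂ) * (-ν * s) ^ k *
    ∑ γ ∈ ofLen n k, (1 / (fact γ : ℂ)) * kernel ν (2 • γ) (t - θ * s) x) J ?_
  · rw [← h]
    congr 1
    · simp [ofLen_zero, fact]
    · unfold timeTaylor
      refine Finset.sum_congr rfl fun k _ => ?_
      have : (k.factorial : ℂ) ≠ 0 := by exact_mod_cast k.factorial_ne_zero
      rw [zero_mul, sub_zero, mul_assoc, mul_div_assoc, mul_div_cancel₀ _ this, Finset.mul_sum]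
      refine Finset.sum_congr rfl fun β _ => ?_
      rw [mul_pow]
      ring
  · intro k θ hθ
    -- The path stays at positive times for θ ≤ 1: trivially if s ≤ 0, otherwise because s ≤ t/2.
    have hpos : 0 < t - θ * s := by
      rcases le_total s 0 with h | h
      · nlinarith [hθ.1, hθ.2]
      · nlinarith [hθ.1, hθ.2]
    have hd : HasDerivAt (fun θ : ℝ => (k.factorial : ℂ) * (-ν * s) ^ k *
        ∑ γ ∈ ofLen n k, (1 / (fact γ : ℂ)) * kernel ν (2 • γ) (t - θ * s) x)
        ((k.factorial : ℂ) * (-ν * s) ^ k * ∑ γ ∈ ofLen n k, (1 / (fact γ : ℂ)) *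
          (-(s : ℂ) * (ν * ∑ i, kernel ν (2 • γ + Pi.single i 2) (t - θ * s) x))) θ := by
      refine HasDerivAt.const_mul _ (HasDerivAt.fun_sum fun γ _ => HasDerivAt.const_mul _ ?_)
      have h1 : HasDerivAt (fun θ : ℝ => t - θ * s) (-s) θ := by
        simpa using ((hasDerivAt_id' θ).mul_const s).const_sub t
      refine ((hasDerivAt_kernel_time hν (2 • γ) hpos x).scomp θ h1).congr_deriv ?_
      simp
    refine hd.congr_deriv ?_
    have hm := sum_ofLen_succ k (fun γ => kernel ν (2 • γ) (t - θ * s) x)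
    have e : ∑ γ ∈ ofLen n k, (1 / (fact γ : ℂ)) *
          (-(s : ℂ) * (ν * ∑ i, kernel ν (2 • γ + Pi.single i 2) (t - θ * s) x)) =
        (-ν * s) * ∑ γ ∈ ofLen n k, (1 / (fact γ : ℂ)) *
          ∑ i, kernel ν (2 • (γ + Pi.single i 1)) (t - θ * s) x := by
      rw [Finset.mul_sum]
      refine Finset.sum_congr rfl fun γ _ => ?_
      have e2 : ∀ i : Fin n, 2 • (γ + Pi.single i 1) = 2 • γ + Pi.single i 2 := by
        intro i
        rw [smul_add, ← Pi.single_smul]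
        rfl
      simp_rw [e2]
      ring
    rw [e, hm, pow_succ, Nat.factorial_succ]
    push_cast
    ring

theorem exists_bnorm_timeTaylor_le {n : ℕ} {ν : ℂ} (hν : 0 < ν.re) {q : ℝ≥0∞}
    (hq : q = 1 ∨ q = ∞) (J : ℕ) : ∃ C : ℝ, 0 < C ∧ ∀ t s : ℝ, 0 < t → 0 ≤ s → s ≤ t / 2 →
      bnorm q (fun x : Sp n => kernel ν 0 (t - s) x - timeTaylor ν J t s x) ≤
        ENNReal.ofReal (C * t ^ (-decayExp n q) * (s / t) ^ (J + 1)) := by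
  have hν0 : ν ≠ 0 := by rintro rfl; simp at hν
  choose C hC h using fun α => exists_bnorm_kernel_le (n := n) hν hq α
  have hS : 0 ≤ ∑ γ ∈ ofLen n (J + 1), C (2 • γ) := Finset.sum_nonneg fun β _ => (hC _).le
  -- The cost of replacing the intermediate time t - θs ≥ t/2 by t in the kernel bound.
  set P : ℝ := (1 / 2 : ℝ) ^ (-decayExp n q - (J + 1)) with hP
  have hP0 : 0 < P := Real.rpow_pos_of_pos (by norm_num) _
  have hD : 0 ≤ decayExp n q := by
    rcases hq with rfl | rfl
    · simp [decayExp_one]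
    · rw [decayExp_top]; positivity
  refine ⟨(J + 1).factorial * ‖ν‖ ^ (J + 1) * (∑ γ ∈ ofLen n (J + 1), C (2 • γ)) * P + 1,
    by positivity, fun t s ht hs hst => ?_⟩
  simp_rw [kernel_sub_timeTaylor hν0 J ht hst]
  refine bnorm_intervalIntegral_le
    (H := fun θ x => ((J + 1).factorial : ℂ) * (-ν * s) ^ (J + 1) * ∑ γ ∈ ofLen n (J + 1),
          (1 / (fact γ : ℂ)) * kernel ν (2 • γ) (t - θ * s) x) ?_ (fun θ hθ => ?_) J
  · refine Measurable.const_mul (Finset.measurable_fun_sum _ fun γ _ => Measurable.const_mul ?_ _) _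
    have h2 := measurable_kernel (n := n) ν (2 • γ)
    have h3 : Measurable fun z : Sp n × ℝ => t - z.2 * s :=
      measurable_const.sub (measurable_snd.mul_const s)
    fun_prop
  · rw [bnorm_const_mul]
    have hτ : t / 2 ≤ t - θ * s := by nlinarith [hθ.1, hθ.2]
    have hsum : bnorm q (fun x : Sp n => ∑ γ ∈ ofLen n (J + 1),
        (1 / (fact γ : ℂ)) * kernel ν (2 • γ) (t - θ * s) x) ≤
        ∑ γ ∈ ofLen n (J + 1), ENNReal.ofReal (C (2 • γ) *
          (P * t ^ (-decayExp n q - (J + 1)))) := by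
      refine (bnorm_sum_le _ fun γ _ => ?_).trans (Finset.sum_le_sum fun γ hγ => ?_)
      · exact ((continuous_kernel ν (2 • γ) _).const_mul _).aestronglyMeasurable
      · rw [mem_ofLen] at hγ
        rw [bnorm_const_mul]
        refine (mul_le_of_le_one_left zero_le (norm_one_div_fact_le γ)).trans ?_
        refine (h (2 • γ) (t - θ * s) (by linarith)).trans (ENNReal.ofReal_le_ofReal ?_)
        have := hC (2 • γ)
        rw [len_smul, hγ, hP, ← Real.mul_rpow (by norm_num) ht.le]
        gcongr
        have e : -decayExp n q - ((2 * (J + 1) : ℕ) : ℝ) / 2 = -decayExp n q - (J + 1) := by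
          push_cast; ring
        rw [e]
        refine Real.rpow_le_rpow_of_nonpos (by positivity) (by linarith) ?_
        have : (0 : ℝ) ≤ J := by positivity
        linarith
    refine (mul_le_mul_right hsum _).trans ?_
    rw [← ENNReal.ofReal_sum_of_nonneg
        (fun γ _ => by have := hC (2 • γ); positivity), ← ofReal_norm,
      ← ENNReal.ofReal_mul (by positivity), ← Finset.sum_mul]
    refine ENNReal.ofReal_le_ofReal ?_
    rw [norm_mul, norm_pow, norm_mul, norm_neg, Complex.norm_natCast, Complex.norm_real,
      Real.norm_of_nonneg hs]
    have e : t ^ (-decayExp n q - (J + 1)) = t ^ (-decayExp n q) * (t ^ (J + 1))⁻¹ := by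
      rw [Real.rpow_sub ht, div_eq_mul_inv]
      congr 2
      exact_mod_cast Real.rpow_natCast t (J + 1)
    rw [e, div_pow]
    have : 0 ≤ t ^ (-decayExp n q) * (s ^ (J + 1) / t ^ (J + 1)) := by positivity
    calc _ = (J + 1).factorial * ‖ν‖ ^ (J + 1) * (∑ γ ∈ ofLen n (J + 1), C (2 • γ)) * P *
          (t ^ (-decayExp n q) * (s ^ (J + 1) / t ^ (J + 1))) := by
          rw [mul_pow]; ring
      _ ≤ _ := by rw [mul_assoc _ (t ^ (-decayExp n q)), add_mul]; linarith

/-- The contribution of `e^{(t-s)νΔ} g` to the asymptotic profile at time `t`. -/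
noncomputable def delayedProfile {n : ℕ} (ν : ℂ) (m : ℕ) (t s : ℝ) (g : Sp n → ℂ) (x : Sp n) :
    ℂ :=
  ∑ k ∈ Finset.range (m / 2 + 1), ∑ γ ∈ ofLen n k,
    ((-ν) ^ k * (s : ℂ) ^ k / (fact γ : ℂ)) * momentSum ν (2 • γ) (m - 2 * k) t g x

/-- The expansion is made in time first, then in space term by term. A term with |γ| = k already
carries 2k derivatives, so its space expansion stops at m - 2k. -/
theorem kconv_sub_delayedProfile {n : ℕ} {ν : ℂ} (hν : 0 < ν.re) (m : ℕ) {t s : ℝ}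
    (ht : 0 < t) (hst : s < t) {g : Sp n → ℂ} (hg : Integrable g volume) (x : Sp n) :
    kconv ν 0 (t - s) g x - delayedProfile ν m t s g x =
      (∫ y, (kernel ν 0 (t - s) (x - y) - timeTaylor ν (m / 2) t s (x - y)) * g y) +
      ∑ k ∈ Finset.range (m / 2 + 1), ∑ γ ∈ ofLen n k,
        ((-ν) ^ k * (s : ℂ) ^ k / (fact γ : ℂ)) *
          (kconv ν (2 • γ) t g x - momentSum ν (2 • γ) (m - 2 * k) t g x) := by
  have hT : ∀ y, timeTaylor ν (m / 2) t s (x - y) * g y =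
      ∑ k ∈ Finset.range (m / 2 + 1), ∑ γ ∈ ofLen n k,
        ((-ν) ^ k * (s : ℂ) ^ k / (fact γ : ℂ)) * (kernel ν (2 • γ) t (x - y) * g y) := by
    intro y
    simp only [timeTaylor, Finset.sum_mul, mul_assoc]
  have hI : ∀ k ∈ Finset.range (m / 2 + 1), ∀ γ ∈ ofLen n k, Integrable (fun y =>
      ((-ν) ^ k * (s : ℂ) ^ k / (fact γ : ℂ)) * (kernel ν (2 • γ) t (x - y) * g y)) volume :=
    fun k _ γ _ => (integrable_kernel_mul hν (2 • γ) ht hg x).const_mul _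
  simp_rw [sub_mul, hT]
  rw [integral_sub (integrable_kernel_mul hν 0 (by linarith) hg x)
      (integrable_finsetSum _ fun k hk => integrable_finsetSum _ fun γ hγ => hI k hk γ hγ),
    integral_finsetSum _ fun k hk => integrable_finsetSum _ fun γ hγ => hI k hk γ hγ]
  have e : ∑ k ∈ Finset.range (m / 2 + 1), ∫ y, ∑ γ ∈ ofLen n k,
      ((-ν) ^ k * (s : ℂ) ^ k / (fact γ : ℂ)) * (kernel ν (2 • γ) t (x - y) * g y) =
      ∑ k ∈ Finset.range (m / 2 + 1), ∑ γ ∈ ofLen n k,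
      ((-ν) ^ k * (s : ℂ) ^ k / (fact γ : ℂ)) * kconv ν (2 • γ) t g x := by
    refine Finset.sum_congr rfl fun k hk => ?_
    rw [integral_finsetSum _ fun γ hγ => hI k hk γ hγ]
    refine Finset.sum_congr rfl fun γ _ => ?_
    rw [integral_const_mul, kconv]
  rw [e]
  simp only [mul_sub, Finset.sum_sub_distrib, delayedProfile, kconv]
  ring

theorem continuous_timeTaylor {n : ℕ} (ν : ℂ) (J : ℕ) (t s : ℝ) :
    Continuous (timeTaylor ν J t s : Sp n → ℂ) := by
  have := fun β => (continuous_kernel ν β t : Continuous (kernel ν β t : Sp n → ℂ))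
  unfold timeTaylor
  fun_prop

theorem aestronglyMeasurable_kconv {n : ℕ} (ν : ℂ) (α : MIdx n) (t : ℝ) {g : Sp n → ℂ}
    (hg : AEStronglyMeasurable g volume) : AEStronglyMeasurable (kconv ν α t g) volume := by
  have h : AEStronglyMeasurable (fun z : Sp n × Sp n => kernel ν α t (z.1 - z.2) * g z.2)
      (volume.prod volume) := by
    refine AEStronglyMeasurable.mul ?_ hg.comp_snd
    exact ((continuous_kernel ν α t).comp
      (continuous_fst.sub continuous_snd)).aestronglyMeasurable
  exact h.integral_prod_right'

/-- The error of the delayed profile, for data with moment bounds at the parabolic scale. -/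
theorem exists_bnorm_sub_delayedProfile_le {n : ℕ} {ν : ℂ} (hν : 0 < ν.re) {q : ℝ≥0∞}
    (hq : q = 1 ∨ q = ∞) (m : ℕ) : ∃ C : ℝ, 0 < C ∧ ∀ (t s A : ℝ) (g : Sp n → ℂ),
      0 < t → 0 ≤ s → s ≤ t / 2 → 0 ≤ A → Integrable g volume →
      (∀ j ≤ m + 1, wnorm j g ≤ ENNReal.ofReal (A * (1 + s) ^ ((j : ℝ) / 2))) →
      bnorm q (fun x => kconv ν 0 (t - s) g x - delayedProfile ν m t s g x) ≤
        ENNReal.ofReal (C * (A * t ^ (-decayExp n q - ((m : ℝ) + 1) / 2) *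
          (1 + s) ^ (((m : ℝ) + 1) / 2))) := by
  obtain ⟨C₁, hC₁, h₁⟩ := exists_bnorm_timeTaylor_le (n := n) hν hq (m / 2)
  choose C₂ hC₂ h₂ using fun (α : MIdx n) N => exists_bnorm_kconv_sub_momentSum_le hν hq α N
  have hS : 0 ≤ ∑ k ∈ Finset.range (m / 2 + 1), ∑ γ ∈ ofLen n k,
      ‖ν‖ ^ k * C₂ (2 • γ) (m - 2 * k) := Finset.sum_nonneg fun k _ =>
    Finset.sum_nonneg fun γ _ => mul_nonneg (by positivity) (hC₂ _ _).le
  refine ⟨C₁ + ∑ k ∈ Finset.range (m / 2 + 1), ∑ γ ∈ ofLen n k,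
      ‖ν‖ ^ k * C₂ (2 • γ) (m - 2 * k), by linarith, fun t s A g ht hs hst hA hg hw => ?_⟩
  simp_rw [kconv_sub_delayedProfile hν m ht (by linarith : s < t) hg]
  set Q := A * t ^ (-decayExp n q - ((m : ℝ) + 1) / 2) * (1 + s) ^ (((m : ℝ) + 1) / 2) with hQ
  have hQ0 : 0 ≤ Q := by positivity
  have hm1 : Measurable fun x : Sp n => kernel ν 0 (t - s) x - timeTaylor ν (m / 2) t s x :=
    ((continuous_kernel ν 0 _).sub (continuous_timeTaylor ν _ t s)).measurable
  have hm2 : AEStronglyMeasurable (fun x : Sp n => ∫ y, (kernel ν 0 (t - s) (x - y) -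
      timeTaylor ν (m / 2) t s (x - y)) * g y) volume := by
    have h : AEStronglyMeasurable (fun z : Sp n × Sp n => (kernel ν 0 (t - s) (z.1 - z.2) -
        timeTaylor ν (m / 2) t s (z.1 - z.2)) * g z.2) (volume.prod volume) := by
      refine AEStronglyMeasurable.mul ?_ hg.aestronglyMeasurable.comp_snd
      exact (hm1.comp (measurable_fst.sub measurable_snd)).aestronglyMeasurable
    exact h.integral_prod_right'
  refine (bnorm_add_le hm2 _).trans ?_
  rw [add_mul, ENNReal.ofReal_add (by positivity) (by positivity)]
  refine add_le_add ?_ ?_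
  · refine (bnorm_conv_le hm1 hg.aestronglyMeasurable).trans ?_
    calc _ ≤ ENNReal.ofReal (C₁ * t ^ (-decayExp n q) * (s / t) ^ (m / 2 + 1)) *
          ENNReal.ofReal (A * (1 + s) ^ (((0 : ℕ) : ℝ) / 2)) :=
          mul_le_mul' (h₁ t s ht hs hst) (hw 0 (by omega))
      _ ≤ _ := by
        rw [← ENNReal.ofReal_mul (by positivity)]
        refine ENNReal.ofReal_le_ofReal ?_
        have h1 : s / t ≤ 1 := by rw [div_le_one ht]; linarith
        -- For both parities ⌊m/2⌋ + 1 ≥ (m+1)/2, and s/t ≤ 1, so the time remainder is at least as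
        -- good as parabolic order m + 1.
        have h2 : (s / t) ^ (m / 2 + 1) ≤ (s / t) ^ (((m : ℝ) + 1) / 2) := by
          rw [← Real.rpow_natCast]
          rcases hs.eq_or_lt with h | h
          · rw [← h, zero_div, Real.zero_rpow (by positivity), Real.zero_rpow (by positivity)]
          · refine Real.rpow_le_rpow_of_exponent_ge (by positivity) h1 ?_
            have : m + 1 ≤ 2 * (m / 2 + 1) := by omega
            have : ((m + 1 : ℕ) : ℝ) ≤ ((2 * (m / 2 + 1) : ℕ) : ℝ) := by exact_mod_cast this
            push_cast at this ⊢
            linarith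
        have h3 : (s / t) ^ (((m : ℝ) + 1) / 2) ≤
            (1 + s) ^ (((m : ℝ) + 1) / 2) * t ^ (-(((m : ℝ) + 1) / 2)) := by
          rw [Real.div_rpow hs ht.le, Real.rpow_neg ht.le, div_eq_mul_inv]
          gcongr
          linarith
        have e : t ^ (-decayExp n q - ((m : ℝ) + 1) / 2) =
            t ^ (-decayExp n q) * t ^ (-(((m : ℝ) + 1) / 2)) := by
          rw [← Real.rpow_add ht]; congr 1
        calc C₁ * t ^ (-decayExp n q) * (s / t) ^ (m / 2 + 1) *
              (A * (1 + s) ^ (((0 : ℕ) : ℝ) / 2)) ≤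
            C₁ * t ^ (-decayExp n q) * ((1 + s) ^ (((m : ℝ) + 1) / 2) *
              t ^ (-(((m : ℝ) + 1) / 2))) * (A * (1 + s) ^ (((0 : ℕ) : ℝ) / 2)) := by
              gcongr
              exact h2.trans h3
          _ = C₁ * Q := by
              rw [hQ, e]
              simp
              ring
  · have hmk : ∀ γ : MIdx n, ∀ N, AEStronglyMeasurable
        (fun x => kconv ν γ t g x - momentSum ν γ N t g x) volume := fun γ N =>
      (aestronglyMeasurable_kconv ν γ t hg.aestronglyMeasurable).sub
        (continuous_momentSum ν γ N t g).aestronglyMeasurable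
    refine (bnorm_sum_le _ fun k _ => ?_).trans ?_
    · exact Finset.aestronglyMeasurable_fun_sum _ fun γ _ => (hmk _ _).const_mul _
    rw [Finset.sum_mul, ENNReal.ofReal_sum_of_nonneg fun k _ => mul_nonneg
      (Finset.sum_nonneg fun γ _ => mul_nonneg (by positivity) (hC₂ _ _).le) hQ0]
    refine Finset.sum_le_sum fun k hk => ?_
    refine (bnorm_sum_le _ fun γ _ => (hmk _ _).const_mul _).trans ?_
    rw [Finset.sum_mul, ENNReal.ofReal_sum_of_nonneg fun γ _ => mul_nonneg
      (mul_nonneg (by positivity) (hC₂ _ _).le) hQ0]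
    refine Finset.sum_le_sum fun γ hγ => ?_
    rw [mem_ofLen] at hγ
    have hk' : 2 * k ≤ m := by rw [Finset.mem_range] at hk; omega
    rw [bnorm_const_mul]
    have hwk := hw (m - 2 * k + 1) (by omega)
    have hb := h₂ (2 • γ) (m - 2 * k) t ht g hg (hwk.trans_lt ENNReal.ofReal_lt_top)
    have hC := hC₂ (2 • γ) (m - 2 * k)
    set C := C₂ (2 • γ) (m - 2 * k)
    have hc : ‖(-ν) ^ k * (s : ℂ) ^ k / (fact γ : ℂ)‖ₑ ≤ ENNReal.ofReal (‖ν‖ ^ k * s ^ k) := by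
      rw [← ofReal_norm]
      refine ENNReal.ofReal_le_ofReal ?_
      rw [norm_div, norm_mul, norm_pow, norm_pow, norm_neg, Complex.norm_natCast,
        Complex.norm_real, Real.norm_of_nonneg hs]
      exact div_le_self (by positivity) (by exact_mod_cast fact_pos γ)
    refine (mul_le_mul' hc (hb.trans (mul_le_mul' le_rfl hwk))).trans ?_
    rw [← ENNReal.ofReal_mul (by positivity), ← ENNReal.ofReal_mul (by positivity)]
    refine ENNReal.ofReal_le_ofReal ?_
    -- Parabolic homogeneity: 2k derivatives from time and m - 2k + 1 from space make m + 1 for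
    -- every k.
    have e1 : -decayExp n q - ((len (2 • γ) : ℝ) + (m - 2 * k : ℕ) + 1) / 2 =
        -decayExp n q - ((m : ℝ) + 1) / 2 := by
      rw [len_smul, hγ, Nat.cast_sub hk']
      push_cast
      ring
    have e2 : s ^ k * (1 + s) ^ (((m - 2 * k + 1 : ℕ) : ℝ) / 2) ≤
        (1 + s) ^ (((m : ℝ) + 1) / 2) := by
      calc _ ≤ (1 + s) ^ k * (1 + s) ^ (((m - 2 * k + 1 : ℕ) : ℝ) / 2) := by
            gcongr; linarith
        _ = _ := by
          rw [← Real.rpow_natCast, ← Real.rpow_add (by linarith)]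
          congr 1
          push_cast [Nat.cast_sub hk']
          ring
    rw [e1, hQ]
    calc _ = ‖ν‖ ^ k * C * (A * t ^ (-decayExp n q - ((m : ℝ) + 1) / 2) *
          (s ^ k * (1 + s) ^ (((m - 2 * k + 1 : ℕ) : ℝ) / 2))) := by ring
      _ ≤ _ := by gcongr

/-! ### Bounds for the semigroup -/

theorem eLpNorm_one_eq_wnorm {n : ℕ} (g : Sp n → ℂ) : eLpNorm g 1 volume = wnorm 0 g := by
  rw [wnorm_zero, eLpNorm_one_eq_lintegral_enorm]

theorem exists_bnorm_one_kernel_le {n : ℕ} {ν : ℂ} (hν : 0 < ν.re) :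
    ∃ C : ℝ, 0 < C ∧ ∀ t : ℝ, 0 < t →
      ∫⁻ x : Sp n, ‖kernel ν 0 t x‖ₑ ≤ ENNReal.ofReal C := by
  obtain ⟨C, hC, h⟩ := exists_weighted_kernel_le (n := n) hν 0 0
  refine ⟨C, hC, fun t ht => ?_⟩
  simpa [len] using h t ht

/-- Young's inequality with the kernel in L¹, whose norm is bounded uniformly in t. For q = ∞ the
data are only classes, so the essential supremum is used in place of `bnorm`. -/
theorem exists_eLpNorm_kconv_le {n : ℕ} {ν : ℂ} (hν : 0 < ν.re) {q : ℝ≥0∞}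
    (hq : q = 1 ∨ q = ∞) : ∃ C : ℝ, 0 < C ∧ ∀ t : ℝ, 0 < t → ∀ g : Sp n → ℂ,
      AEStronglyMeasurable g volume →
      eLpNorm (kconv ν 0 t g) q volume ≤ ENNReal.ofReal C * eLpNorm g q volume := by
  obtain ⟨C, hC, h⟩ := exists_bnorm_one_kernel_le (n := n) hν
  refine ⟨C, hC, fun t ht g hg => ?_⟩
  rcases hq with rfl | rfl
  · refine (eLpNorm_le_bnorm (Or.inl rfl) _).trans ?_
    refine (bnorm_conv_le (continuous_kernel ν 0 t).measurable hg).trans ?_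
    rw [eLpNorm_one_eq_wnorm, bnorm_one]
    exact mul_le_mul' (h t ht) le_rfl
  · rw [eLpNorm_exponent_top, eLpNorm_exponent_top]
    refine eLpNormEssSup_le_of_ae_enorm_bound (Eventually.of_forall fun x => ?_)
    calc ‖kconv ν 0 t g x‖ₑ ≤ ∫⁻ y, ‖kernel ν 0 t (x - y) * g y‖ₑ :=
          enorm_integral_le_lintegral_enorm _
      _ ≤ ∫⁻ y, ‖kernel ν 0 t (x - y)‖ₑ * eLpNormEssSup g volume := by
          refine lintegral_mono_ae ?_
          filter_upwards [ae_le_eLpNormEssSup (f := g) (μ := volume)] with y hy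
          rw [enorm_mul]
          gcongr
      _ = (∫⁻ y, ‖kernel ν 0 t (x - y)‖ₑ) * eLpNormEssSup g volume :=
          lintegral_mul_const'' _
            ((continuous_kernel ν 0 t).comp (by fun_prop)).measurable.enorm.aemeasurable
      _ ≤ _ := by
          rw [lintegral_sub_left_eq_self (fun y => ‖kernel ν 0 t y‖ₑ) x]
          gcongr
          exact h t ht

/-! ### Truncated weights and the heat kernel. -/

theorem add_pow_le_two_pow_mul (a b : ℝ≥0∞) (j : ℕ) : (a + b) ^ j ≤ 2 ^ j * (a ^ j + b ^ j) := by
  rcases le_total a b with h | h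
  · calc (a + b) ^ j ≤ (b + b) ^ j := by gcongr
      _ = 2 ^ j * b ^ j := by rw [← two_mul, mul_pow]
      _ ≤ _ := by gcongr; exact le_add_self
  · calc (a + b) ^ j ≤ (a + a) ^ j := by gcongr
      _ = 2 ^ j * a ^ j := by rw [← two_mul, mul_pow]
      _ ≤ _ := by gcongr; exact le_self_add

/-- The truncated weight `min(|x|^j, R)`. -/
noncomputable def weight {n : ℕ} (j : ℕ) (R : ℝ≥0∞) (x : Sp n) : ℝ≥0∞ := min (‖x‖ₑ ^ j) R

@[fun_prop]
theorem measurable_weight {n : ℕ} (j : ℕ) (R : ℝ≥0∞) : Measurable (weight j R : Sp n → ℝ≥0∞) := by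
  unfold weight
  exact (measurable_enorm.pow_const j).min measurable_const

/-- The truncation is kept on y alone, the variable of the data, and the constant does not depend on
R. -/
theorem weight_add_le {n : ℕ} (j : ℕ) (R : ℝ≥0∞) (x y : Sp n) :
    weight j R (x + y) ≤ 2 ^ j * (‖x‖ₑ ^ j + weight j R y) := by
  unfold weight
  have h1 : ‖x + y‖ₑ ^ j ≤ 2 ^ j * (‖x‖ₑ ^ j + ‖y‖ₑ ^ j) :=
    (pow_le_pow_left' (enorm_add_le x y) j).trans (add_pow_le_two_pow_mul _ _ j)
  rcases le_total (‖y‖ₑ ^ j) R with h | h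
  · rw [min_eq_left h]
    exact (min_le_left _ _).trans h1
  · rw [min_eq_right h]
    refine (min_le_right _ _).trans ?_
    calc R = 1 * R := (one_mul R).symm
      _ ≤ 2 ^ j * (‖x‖ₑ ^ j + R) :=
        mul_le_mul' (one_le_pow_of_one_le' (by norm_num) j) le_add_self

/-- The weight at x is split between the kernel at x - y, which pays t^{j/2}, and the data at y.
Uniformity in R allows the truncation to be removed after Grönwall's inequality. -/
theorem exists_weighted_kconv_le {n : ℕ} {ν : ℂ} (hν : 0 < ν.re) (j : ℕ) :
    ∃ C : ℝ, 0 < C ∧ ∀ t : ℝ, 0 < t → ∀ (R : ℝ≥0∞) (g : Sp n → ℂ),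
      AEStronglyMeasurable g volume →
      ∫⁻ x, weight j R x * ‖kconv ν 0 t g x‖ₑ ≤ ENNReal.ofReal C *
        (ENNReal.ofReal (t ^ ((j : ℝ) / 2)) * wnorm 0 g + ∫⁻ x, weight j R x * ‖g x‖ₑ) := by
  obtain ⟨A, hA, h1⟩ := exists_bnorm_one_kernel_le (n := n) hν
  obtain ⟨B, hB, h2⟩ := exists_weighted_kernel_le (n := n) hν 0 j
  refine ⟨2 ^ j * max A B, by positivity, fun t ht R g hg => ?_⟩
  have hkm : Measurable (kernel ν 0 t : Sp n → ℂ) := (continuous_kernel ν 0 t).measurable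
  have hinner : ∀ y : Sp n, ∫⁻ x, weight j R x * ‖kernel ν 0 t (x - y)‖ₑ ≤
      ENNReal.ofReal (2 ^ j * max A B) * (ENNReal.ofReal (t ^ ((j : ℝ) / 2)) + weight j R y) := by
    intro y
    rw [← lintegral_add_right_eq_self _ y]
    calc ∫⁻ x, weight j R (x + y) * ‖kernel ν 0 t (x + y - y)‖ₑ
        ≤ ∫⁻ x, 2 ^ j * (‖x‖ₑ ^ j * ‖kernel ν 0 t x‖ₑ +
            weight j R y * ‖kernel ν 0 t x‖ₑ) := by
          refine lintegral_mono fun x => ?_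
          rw [add_sub_cancel_right, ← add_mul, ← mul_assoc]
          gcongr
          exact weight_add_le j R x y
      _ = 2 ^ j * ((∫⁻ x : Sp n, ‖x‖ₑ ^ j * ‖kernel ν 0 t x‖ₑ) +
            weight j R y * ∫⁻ x : Sp n, ‖kernel ν 0 t x‖ₑ) := by
          rw [lintegral_const_mul' _ _ (by simp), lintegral_add_left (by fun_prop),
            lintegral_const_mul _ hkm.enorm]
      _ ≤ 2 ^ j * (ENNReal.ofReal (max A B) * ENNReal.ofReal (t ^ ((j : ℝ) / 2)) +
            weight j R y * ENNReal.ofReal (max A B)) := by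
          gcongr
          · refine (h2 t ht).trans ?_
            rw [← ENNReal.ofReal_mul (by positivity)]
            refine ENNReal.ofReal_le_ofReal ?_
            simp only [len, Pi.zero_apply, Finset.sum_const_zero, Nat.cast_zero, sub_zero]
            gcongr
            exact le_max_right _ _
          · exact (h1 t ht).trans (ENNReal.ofReal_le_ofReal (le_max_left _ _))
      _ = _ := by
          rw [ENNReal.ofReal_mul (by positivity), ENNReal.ofReal_pow (by norm_num),
            ENNReal.ofReal_ofNat]
          ring
  have hjm : AEMeasurable (fun z : Sp n × Sp n =>
      weight j R z.1 * (‖kernel ν 0 t (z.1 - z.2)‖ₑ * ‖g z.2‖ₑ)) (volume.prod volume) := by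
    refine (measurable_weight j R |>.comp measurable_fst).aemeasurable.mul
      (AEMeasurable.mul ?_ hg.comp_snd.enorm)
    exact (hkm.comp (measurable_fst.sub measurable_snd)).enorm.aemeasurable
  calc ∫⁻ x, weight j R x * ‖kconv ν 0 t g x‖ₑ
      ≤ ∫⁻ x, ∫⁻ y, weight j R x * (‖kernel ν 0 t (x - y)‖ₑ * ‖g y‖ₑ) := by
        refine lintegral_mono fun x => ?_
        rw [lintegral_const_mul'']
        · gcongr
          refine (enorm_integral_le_lintegral_enorm _).trans ?_
          simp_rw [enorm_mul]
          exact le_rfl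
        · exact ((hkm.comp (by fun_prop)).enorm.aemeasurable).mul hg.enorm
    _ = ∫⁻ y, (∫⁻ x, weight j R x * (‖kernel ν 0 t (x - y)‖ₑ * ‖g y‖ₑ)) :=
        lintegral_lintegral_swap
          (f := fun x y => weight j R x * (‖kernel ν 0 t (x - y)‖ₑ * ‖g y‖ₑ)) hjm
    _ ≤ ∫⁻ y, ENNReal.ofReal (2 ^ j * max A B) *
          (ENNReal.ofReal (t ^ ((j : ℝ) / 2)) * ‖g y‖ₑ + weight j R y * ‖g y‖ₑ) := by
        refine lintegral_mono fun y => ?_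
        simp_rw [← mul_assoc]
        rw [lintegral_mul_const' _ _ enorm_ne_top]
        calc _ ≤ _ := mul_le_mul_left (hinner y) _
          _ = _ := by ring
    _ = _ := by
        rw [lintegral_const_mul' _ _ ENNReal.ofReal_ne_top, lintegral_add_left' (by fun_prop),
          lintegral_const_mul' _ _ ENNReal.ofReal_ne_top, wnorm_zero]

/-! ### Continuity of the semigroup in `L¹` -/

theorem coeFn_toL1 {n : ℕ} {g : Sp n → ℂ} (hg : MemLp g 1 volume) :
    (toL1 g : Sp n → ℂ) =ᵐ[volume] g := by
  unfold toL1
  rw [dif_pos hg]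
  exact hg.coeFn_toLp

theorem norm_toL1_le {n : ℕ} {g : Sp n → ℂ} {b : ℝ} (hb : 0 ≤ b)
    (h : eLpNorm g 1 volume ≤ ENNReal.ofReal b) : ‖toL1 g‖ ≤ b := by
  unfold toL1
  split_ifs with hg
  · rw [Lp.norm_toLp]
    exact ENNReal.toReal_le_of_le_ofReal hb h
  · simpa using hb

theorem toL1_sub {n : ℕ} {g h : Sp n → ℂ} (hg : MemLp g 1 volume) (hh : MemLp h 1 volume) :
    toL1 g - toL1 h = toL1 (fun x => g x - h x) := by
  have hsub : MemLp (fun x => g x - h x) 1 volume := hg.sub hh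
  unfold toL1
  rw [dif_pos hg, dif_pos hh, dif_pos hsub]
  exact (MemLp.toLp_sub hg hh).symm

theorem wnorm_coe {n : ℕ} (g : Lp ℂ 1 (volume : Measure (Sp n))) :
    wnorm 0 g = ENNReal.ofReal ‖g‖ := by
  rw [← eLpNorm_one_eq_wnorm, ofReal_norm, Lp.enorm_def]

theorem integrable_coe {n : ℕ} (g : Lp ℂ 1 (volume : Measure (Sp n))) :
    Integrable g volume := memLp_one_iff_integrable.mp (Lp.memLp g)

/-- The time Taylor estimate of order zero. It looks backwards from the later time, so the two
orderings of t and t' use different base points. -/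
theorem exists_kernel_sub_kernel_le {n : ℕ} {ν : ℂ} (hν : 0 < ν.re) :
    ∃ C : ℝ, 0 < C ∧ ∀ t t' : ℝ, 0 < t → 0 < t' → |t' - t| ≤ t / 2 →
      bnorm 1 (fun x : Sp n => kernel ν 0 t' x - kernel ν 0 t x) ≤
        ENNReal.ofReal (C * (|t' - t| / t)) := by
  obtain ⟨C, hC, h⟩ := exists_bnorm_timeTaylor_le (n := n) hν (Or.inl rfl) 0
  have hT : ∀ (t s : ℝ) (x : Sp n), timeTaylor ν 0 t s x = kernel ν 0 t x := by
    intro t s x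
    simp [timeTaylor, ofLen_zero, fact]
  refine ⟨C, hC, fun t t' ht ht' htt => ?_⟩
  rcases le_total t' t with hle | hle
  · rw [abs_sub_comm, abs_of_nonneg (by linarith)] at htt ⊢
    have := h t (t - t') ht (by linarith) htt
    simpa [hT, decayExp_one] using this
  · rw [abs_of_nonneg (by linarith)] at htt ⊢
    have h1 := h t' (t' - t) ht' (by linarith) (by linarith)
    simp only [hT, sub_sub_cancel, decayExp_one, neg_zero, Real.rpow_zero, mul_one, zero_add,
      pow_one] at h1
    have h2 : bnorm 1 (fun x : Sp n => kernel ν 0 t' x - kernel ν 0 t x) ≤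
        bnorm 1 (fun x : Sp n => kernel ν 0 t x - kernel ν 0 t' x) :=
      bnorm_mono fun x => by rw [enorm_sub_rev]
    refine h2.trans (h1.trans (ENNReal.ofReal_le_ofReal ?_))
    gcongr

/-- The difference is split as e^{t'νΔ}(g' - g) + (e^{t'νΔ} - e^{tνΔ})g. -/
theorem exists_semigroup_sub_le {n : ℕ} {ν : ℂ} (hν : 0 < ν.re) :
    ∃ C : ℝ, 0 < C ∧ ∀ (t t' : ℝ) (g g' : Lp ℂ 1 (volume : Measure (Sp n))), 0 < t → 0 < t' →
      |t' - t| ≤ t / 2 →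
      ‖toL1 (semigroup ν t' g') - toL1 (semigroup ν t g)‖ ≤
        C * ‖g' - g‖ + C * (|t' - t| / t) * ‖g‖ := by
  have hν0 : ν ≠ 0 := by rintro rfl; simp at hν
  obtain ⟨A, hA, h1⟩ := exists_bnorm_one_kernel_le (n := n) hν
  obtain ⟨B, hB, h2⟩ := exists_kernel_sub_kernel_le (n := n) hν
  refine ⟨max A B, lt_max_of_lt_left hA, fun t t' g g' ht ht' htt => ?_⟩
  rw [toL1_sub (memLp_semigroup hν ht'.le (Lp.memLp g')) (memLp_semigroup hν ht.le (Lp.memLp g))]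
  refine norm_toL1_le (by positivity) ?_
  rw [semigroup_eq_kconv hν0 ht, semigroup_eq_kconv hν0 ht']
  have hg := integrable_coe g
  have hg' := integrable_coe g'
  have heq : (fun x => kconv ν 0 t' g' x - kconv ν 0 t g x) = fun x =>
      (∫ y, kernel ν 0 t' (x - y) * (g' y - g y)) +
      ∫ y, (kernel ν 0 t' (x - y) - kernel ν 0 t (x - y)) * g y := by
    ext x
    simp_rw [mul_sub, sub_mul]
    rw [integral_sub (integrable_kernel_mul hν 0 ht' hg' x)
      (integrable_kernel_mul hν 0 ht' hg x),
      integral_sub (integrable_kernel_mul hν 0 ht' hg x) (integrable_kernel_mul hν 0 ht hg x)]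
    unfold kconv
    ring
  rw [heq]
  refine (eLpNorm_le_bnorm (Or.inl rfl) _).trans ?_
  have hsub : AEStronglyMeasurable (fun y => g' y - g y) volume :=
    hg'.aestronglyMeasurable.sub hg.aestronglyMeasurable
  refine (bnorm_add_le (aestronglyMeasurable_kconv ν 0 t' hsub) _).trans ?_
  rw [ENNReal.ofReal_add (by positivity) (by positivity)]
  have hw : wnorm 0 (fun y => g' y - g y) = ENNReal.ofReal ‖g' - g‖ := by
    rw [← wnorm_coe, wnorm_zero, wnorm_zero]
    refine lintegral_congr_ae ?_
    filter_upwards [Lp.coeFn_sub g' g] with y hy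
    rw [hy, Pi.sub_apply]
  refine add_le_add ?_ ?_
  · refine (bnorm_conv_le (continuous_kernel ν 0 t').measurable hsub).trans ?_
    rw [hw, bnorm_one, ENNReal.ofReal_mul (by positivity)]
    exact mul_le_mul' ((h1 t' ht').trans (ENNReal.ofReal_le_ofReal (le_max_left _ _))) le_rfl
  · refine (bnorm_conv_le (ρ := fun x => kernel ν 0 t' x - kernel ν 0 t x)
      ((continuous_kernel ν 0 t').sub (continuous_kernel ν 0 t)).measurable
      hg.aestronglyMeasurable).trans ?_
    rw [wnorm_coe, ENNReal.ofReal_mul (by positivity)]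
    refine mul_le_mul' ((h2 t t' ht ht' htt).trans (ENNReal.ofReal_le_ofReal ?_)) le_rfl
    gcongr
    exact le_max_right _ _

/-- This supplies strong measurability of Duhamel's integrand. The endpoint s = t is left out
because the continuity estimate degenerates as t - s tends to 0. -/
theorem continuousOn_semigroup {n : ℕ} {ν : ℂ} (hν : 0 < ν.re) {t : ℝ}
    {F : ℝ → Lp ℂ 1 (volume : Measure (Sp n))} (hF : ContinuousOn F (Ioo 0 t)) :
    ContinuousOn (fun s => toL1 (semigroup ν (t - s) (F s))) (Ioo 0 t) := by
  obtain ⟨C, hC, h⟩ := exists_semigroup_sub_le (n := n) hν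
  intro s₀ hs₀
  have hpos : 0 < t - s₀ := by linarith [hs₀.2]
  rw [ContinuousWithinAt, tendsto_iff_norm_sub_tendsto_zero]
  have hlim : Tendsto (fun s => C * ‖F s - F s₀‖ +
      C * (|t - s - (t - s₀)| / (t - s₀)) * ‖F s₀‖) (𝓝[Ioo 0 t] s₀) (𝓝 0) := by
    have h1 := tendsto_iff_norm_sub_tendsto_zero.mp (hF s₀ hs₀)
    have h2 : Tendsto (fun s => C * (|t - s - (t - s₀)| / (t - s₀)) * ‖F s₀‖)
        (𝓝[Ioo 0 t] s₀) (𝓝 0) := by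
      have : Continuous fun s => C * (|t - s - (t - s₀)| / (t - s₀)) * ‖F s₀‖ := by fun_prop
      have := (this.tendsto s₀).mono_left (nhdsWithin_le_nhds (s := Ioo 0 t))
      simpa using this
    simpa using (h1.const_mul C).add h2
  refine squeeze_zero' (Eventually.of_forall fun _ => norm_nonneg _) ?_ hlim
  have hball : ∀ᶠ s in 𝓝[Ioo 0 t] s₀, |s - s₀| < (t - s₀) / 2 := by
    refine mem_nhdsWithin_of_mem_nhds ?_
    exact Metric.ball_mem_nhds s₀ (by linarith)
  filter_upwards [hball, self_mem_nhdsWithin] with s hs hs'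
  refine h (t - s₀) (t - s) (F s₀) (F s) hpos (by linarith [hs'.2]) ?_
  rw [show t - s - (t - s₀) = -(s - s₀) by ring, abs_neg]
  exact hs.le

/-! ### Estimates for decaying solutions -/

theorem integrableOn_one_add_rpow {a : ℝ} (ha : 0 < a) :
    IntegrableOn (fun s : ℝ => (1 + s) ^ (-(a + 1))) (Ioi 0) volume := by
  have := integrableOn_add_rpow_Ioi_of_lt (a := -(a + 1)) (c := 0) (m := 1) (by linarith)
    (by norm_num)
  simpa only [add_comm] using this

theorem integral_Ioi_one_add_rpow {a c : ℝ} (ha : 0 < a) (hc : 0 ≤ c) :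
    ∫ s in Ioi c, (1 + s) ^ (-(a + 1)) = (1 + c) ^ (-a) / a := by
  have hderiv : ∀ x ∈ Ici c, HasDerivAt (fun s : ℝ => -((1 + s) ^ (-a) / a))
      ((1 + x) ^ (-(a + 1))) x := by
    intro x hx
    have hx' : 0 < 1 + x := by linarith [mem_Ici.mp hx]
    have h1 := (((hasDerivAt_id' x).const_add 1).rpow_const (p := -a) (Or.inl hx'.ne')).div_const a
    refine h1.neg.congr_deriv ?_
    rw [show -a - 1 = -(a + 1) by ring]
    field_simp
  have hint := (integrableOn_one_add_rpow ha).mono_set (Ioi_subset_Ioi hc)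
  have hlim : Tendsto (fun s : ℝ => -((1 + s) ^ (-a) / a)) atTop (𝓝 0) := by
    have h1 : Tendsto (fun s : ℝ => (1 + s) ^ (-a)) atTop (𝓝 0) :=
      (tendsto_rpow_neg_atTop ha).comp (tendsto_atTop_add_const_left _ _ tendsto_id)
    simpa using (h1.div_const a).neg
  rw [integral_Ioi_of_hasDerivAt_of_tendsto' hderiv hint hlim]
  ring

/-- A mild solution `u` with source term `F`, decaying like the free evolution, where the source
term is dominated by a time-decaying multiple of `u`. -/
structure DecayingSolution {n : ℕ} (ν : ℂ) (u₀ : Sp n → ℂ)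
    (u F : ℝ → Lp ℂ 1 (volume : Measure (Sp n))) (σ κ D : ℝ) : Prop where
  σ_pos : 0 < σ
  κ_pos : 0 < κ
  D_pos : 0 < D
  continuousOn_u : ContinuousOn u (Ici 0)
  continuousOn_F : ContinuousOn F (Ioi 0)
  memLp_init : MemLp u₀ 1 volume
  duhamel : ∀ t : ℝ, 0 < t →
    u t = toL1 (semigroup ν t u₀) + ∫ s in (0 : ℝ)..t, toL1 (semigroup ν (t - s) (F s))
  decay : ∀ q : ℝ≥0∞, q = 1 ∨ q = ∞ → ∀ t : ℝ, 0 < t →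
    eLpNorm (u t) q volume ≤ ENNReal.ofReal (D * (1 + t) ^ (-decayExp n q))
  source : ∀ s : ℝ, 0 < s → ∀ᵐ x, ‖F s x‖ₑ ≤
    ENNReal.ofReal (κ * (1 + s) ^ (-(σ + 1))) * ‖u s x‖ₑ

namespace DecayingSolution

variable {n : ℕ} {ν : ℂ} {u₀ : Sp n → ℂ} {u F : ℝ → Lp ℂ 1 (volume : Measure (Sp n))}
  {σ κ D : ℝ}

theorem eLpNorm_source_le (h : DecayingSolution ν u₀ u F σ κ D) {q : ℝ≥0∞} (hq : q = 1 ∨ q = ∞)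
    {s : ℝ} (hs : 0 < s) : eLpNorm (F s) q volume ≤
      ENNReal.ofReal (κ * D * (1 + s) ^ (-(σ + 1) - decayExp n q)) := by
  have hκ := h.κ_pos
  have hD := h.D_pos
  set k := κ * (1 + s) ^ (-(σ + 1)) with hk
  have hk0 : 0 ≤ k := by positivity
  have h1 : eLpNorm (F s) q volume ≤ eLpNorm (fun x => (k : ℂ) * u s x) q volume := by
    refine eLpNorm_mono_enorm_ae ?_
    filter_upwards [h.source s hs] with x hx
    rw [enorm_mul, ← ofReal_norm (k : ℂ), Complex.norm_real, Real.norm_of_nonneg hk0]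
    exact hx
  have h2 : eLpNorm (fun x => (k : ℂ) * u s x) q volume =
      ENNReal.ofReal k * eLpNorm (u s) q volume := by
    have := eLpNorm_const_smul (k : ℂ) (u s : Sp n → ℂ) q volume
    rw [← ofReal_norm (k : ℂ), Complex.norm_real, Real.norm_of_nonneg hk0] at this
    exact this
  rw [h2] at h1
  refine h1.trans ((mul_le_mul_right (h.decay q hq s hs) _).trans ?_)
  rw [← ENNReal.ofReal_mul hk0]
  refine ENNReal.ofReal_le_ofReal (le_of_eq ?_)
  rw [hk, sub_eq_add_neg, Real.rpow_add (by linarith)]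
  ring

theorem norm_source_le (h : DecayingSolution ν u₀ u F σ κ D) {s : ℝ} (hs : 0 < s) :
    ‖F s‖ ≤ κ * D * (1 + s) ^ (-(σ + 1)) := by
  have hκ := h.κ_pos
  have hD := h.D_pos
  have := h.eLpNorm_source_le (Or.inl rfl) hs
  rw [decayExp_one, sub_zero] at this
  rw [Lp.norm_def]
  exact ENNReal.toReal_le_of_le_ofReal (by positivity) this

/-- Since the domination of F by u is pointwise, every weighted bound for u passes to F with the
same gain in time. -/
theorem lintegral_weight_source_le (h : DecayingSolution ν u₀ u F σ κ D) (w : Sp n → ℝ≥0∞)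
    {s : ℝ} (hs : 0 < s) : ∫⁻ x, w x * ‖F s x‖ₑ ≤
      ENNReal.ofReal (κ * (1 + s) ^ (-(σ + 1))) * ∫⁻ x, w x * ‖u s x‖ₑ := by
  rw [← lintegral_const_mul' _ _ ENNReal.ofReal_ne_top]
  refine lintegral_mono_ae ?_
  filter_upwards [h.source s hs] with x hx
  rw [mul_left_comm]
  gcongr

/-- The integrand is continuous and bounded on a bounded interval. This guarantees that Duhamel's
integral is not the default value 0 and may be cut at t/2. -/
theorem integrableOn_semigroup (h : DecayingSolution ν u₀ u F σ κ D) (hν : 0 < ν.re) {t : ℝ} :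
    IntegrableOn (fun s => toL1 (semigroup ν (t - s) (F s))) (Ioo 0 t) volume := by
  have hν0 : ν ≠ 0 := by rintro rfl; simp at hν
  obtain ⟨C, hC, h1⟩ := exists_eLpNorm_kconv_le (n := n) hν (Or.inl rfl)
  have hκ := h.κ_pos
  have hD := h.D_pos
  refine Integrable.of_bound (C := C * (κ * D)) ?_ ?_
  · exact (continuousOn_semigroup hν (h.continuousOn_F.mono
      fun s hs => hs.1)).aestronglyMeasurable measurableSet_Ioo
  · refine (ae_restrict_iff' measurableSet_Ioo).mpr (Eventually.of_forall fun s hs => ?_)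
    refine norm_toL1_le (by positivity) ?_
    rw [semigroup_eq_kconv hν0 (by linarith [hs.2] : 0 < t - s)]
    refine (h1 _ (by linarith [hs.2]) _ (Lp.aestronglyMeasurable _)).trans ?_
    rw [ENNReal.ofReal_mul hC.le]
    gcongr
    refine (h.eLpNorm_source_le (Or.inl rfl) hs.1).trans (ENNReal.ofReal_le_ofReal ?_)
    refine mul_le_of_le_one_right (by positivity) ?_
    rw [decayExp_one]
    refine Real.rpow_le_one_of_one_le_of_nonpos (by linarith [hs.1]) ?_
    have := h.σ_pos
    linarith

theorem toL1_semigroup_ae_eq {n : ℕ} {ν : ℂ} (hν : 0 < ν.re) {t : ℝ} (ht : 0 < t)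
    {g : Sp n → ℂ} (hg : MemLp g 1 volume) :
    (toL1 (semigroup ν t g) : Sp n → ℂ) =ᵐ[volume] kconv ν 0 t g := by
  have hν0 : ν ≠ 0 := by rintro rfl; simp at hν
  have := coeFn_toL1 (memLp_semigroup hν ht.le hg)
  rwa [semigroup_eq_kconv hν0 ht] at this ⊢

end DecayingSolution

/-! ### Truncated moments of L¹ classes and removal of the truncation. -/

theorem lintegral_weight_lt_top {n : ℕ} (j R : ℕ) (g : Lp ℂ 1 (volume : Measure (Sp n))) :
    ∫⁻ x, weight j R x * ‖g x‖ₑ < ∞ := by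
  calc ∫⁻ x, weight j R x * ‖g x‖ₑ ≤ ∫⁻ x, (R : ℝ≥0∞) * ‖g x‖ₑ :=
        lintegral_mono fun x => mul_le_mul_left (min_le_right _ _) _
    _ = R * ∫⁻ x, ‖g x‖ₑ := lintegral_const_mul' _ _ (by simp)
    _ < ∞ := ENNReal.mul_lt_top (by simp) (integrable_coe g).2

/-- The truncated moment is Lipschitz on L¹ with constant R. Hence it is finite and continuous along
the solution, as Grönwall's inequality requires, before the full moment is known to be finite. -/
theorem continuous_lintegral_weight {n : ℕ} (j R : ℕ) :
    Continuous fun g : Lp ℂ 1 (volume : Measure (Sp n)) =>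
      (∫⁻ x, weight j R x * ‖g x‖ₑ).toReal := by
  refine LipschitzWith.continuous (K := (R : NNReal)) (LipschitzWith.of_le_add_mul _ fun g h => ?_)
  have h1 : ∫⁻ x, weight j R x * ‖g x‖ₑ ≤
      (∫⁻ x, weight j R x * ‖h x‖ₑ) + R * ENNReal.ofReal (dist g h) := by
    rw [dist_eq_norm, ← wnorm_coe, wnorm_zero, ← lintegral_const_mul' _ _ (by simp),
      ← lintegral_add_left' (by
        exact (measurable_weight j R).aemeasurable.mul (Lp.aestronglyMeasurable h).enorm)]
    refine lintegral_mono_ae ?_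
    filter_upwards [Lp.coeFn_sub g h] with x hx
    rw [hx, Pi.sub_apply]
    calc weight j R x * ‖g x‖ₑ ≤ weight j R x * (‖h x‖ₑ + ‖g x - h x‖ₑ) := by
          gcongr
          calc ‖g x‖ₑ = ‖h x + (g x - h x)‖ₑ := by congr 1; ring
            _ ≤ _ := enorm_add_le _ _
      _ ≤ _ := by
          rw [mul_add]
          gcongr
          exact min_le_right _ _
  have h2 := ENNReal.toReal_mono (ENNReal.add_lt_top.mpr ⟨lintegral_weight_lt_top j R h,
    ENNReal.mul_lt_top (by simp) ENNReal.ofReal_lt_top⟩).ne h1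
  rw [ENNReal.toReal_add (lintegral_weight_lt_top j R h).ne
    (ENNReal.mul_lt_top (by simp) ENNReal.ofReal_lt_top).ne, ENNReal.toReal_mul,
    ENNReal.toReal_ofReal dist_nonneg] at h2
  simpa using h2

theorem wnorm_le_of_forall_weight_le {n j : ℕ} {g : Sp n → ℂ} (hg : AEStronglyMeasurable g volume)
    {B : ℝ≥0∞} (h : ∀ R : ℕ, ∫⁻ x, weight j R x * ‖g x‖ₑ ≤ B) : wnorm j g ≤ B := by
  calc wnorm j g ≤ ∫⁻ x, liminf (fun R : ℕ => weight j R x * ‖g x‖ₑ) atTop := by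
        refine lintegral_mono fun x => ?_
        have hlt : ‖x‖ₑ ^ j < ∞ := ENNReal.pow_lt_top enorm_lt_top
        obtain ⟨N, hN⟩ := ENNReal.exists_nat_gt hlt.ne
        have : Tendsto (fun R : ℕ => weight j R x * ‖g x‖ₑ) atTop (𝓝 (‖x‖ₑ ^ j * ‖g x‖ₑ)) := by
          refine tendsto_const_nhds.congr' ?_
          filter_upwards [eventually_ge_atTop N] with R hR
          rw [weight, min_eq_left (hN.le.trans (by exact_mod_cast hR))]
        exact this.liminf_eq.ge
    _ ≤ liminf (fun R : ℕ => ∫⁻ x, weight j R x * ‖g x‖ₑ) atTop :=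
        lintegral_liminf_le' fun R => (measurable_weight j R).aemeasurable.mul hg.enorm
    _ ≤ B := (liminf_le_liminf (Eventually.of_forall h)).trans (by simp)

namespace DecayingSolution

variable {n : ℕ} {ν : ℂ} {u₀ : Sp n → ℂ} {u F : ℝ → Lp ℂ 1 (volume : Measure (Sp n))}
  {σ κ D : ℝ}

/-- Moments of the solution grow at most at the parabolic rate. -/
theorem exists_wnorm_le (h : DecayingSolution ν u₀ u F σ κ D) (hν : 0 < ν.re) (j : ℕ)
    (hw : wnorm j u₀ < ∞) : ∃ A : ℝ, 0 < A ∧ ∀ t : ℝ, 0 < t →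
      wnorm j (u t) ≤ ENNReal.ofReal (A * (1 + t) ^ ((j : ℝ) / 2)) := by
  obtain ⟨C, hC, hker⟩ := exists_weighted_kconv_le (n := n) hν j
  have hκ := h.κ_pos
  have hD := h.D_pos
  have hσ := h.σ_pos
  have hw0 : wnorm 0 u₀ < ∞ := by
    rw [← eLpNorm_one_eq_wnorm]; exact h.memLp_init.2
  set D₀ := (wnorm 0 u₀).toReal with hD₀
  set W₀ := (wnorm j u₀).toReal with hW₀
  have hD₀' : wnorm 0 u₀ = ENNReal.ofReal D₀ := (ENNReal.ofReal_toReal hw0.ne).symm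
  have hW₀' : wnorm j u₀ = ENNReal.ofReal W₀ := (ENNReal.ofReal_toReal hw.ne).symm
  have hD₀0 : 0 ≤ D₀ := ENNReal.toReal_nonneg
  have hW₀0 : 0 ≤ W₀ := ENNReal.toReal_nonneg
  -- The absolute value makes the factor positive and continuous on the whole line; only s > 0
  -- matters. Its integral over (0, ∞) is κ/σ.
  set k : ℝ → ℝ := fun s => κ * (1 + |s|) ^ (-(σ + 1)) with hk
  have hkpos : ∀ s, 0 < k s := fun s => by
    have : 0 < 1 + |s| := by positivity
    positivity
  have hkc : Continuous k := by
    refine continuous_const.mul (Continuous.rpow_const (by fun_prop) fun s => Or.inl ?_)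
    positivity
  set L := κ / σ with hL
  have hL0 : 0 < L := by positivity
  have hkint : ∀ T : ℝ, 0 < T → ∫ s in (0 : ℝ)..T, k s ≤ L := by
    intro T hT
    have h1 : IntegrableOn (fun s : ℝ => κ * (1 + s) ^ (-(σ + 1))) (Ioi 0) volume :=
      (integrableOn_one_add_rpow hσ).const_mul κ
    have h2 : ∫ s in Ioi (0 : ℝ), κ * (1 + s) ^ (-(σ + 1)) = L := by
      rw [integral_const_mul, integral_Ioi_one_add_rpow hσ le_rfl]
      simp [hL, div_eq_mul_inv]
    rw [intervalIntegral.integral_of_le hT.le, ← h2]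
    calc ∫ s in Ioc 0 T, k s = ∫ s in Ioc 0 T, κ * (1 + s) ^ (-(σ + 1)) := by
          refine setIntegral_congr_fun measurableSet_Ioc fun s hs => ?_
          simp only [hk, abs_of_pos hs.1]
      _ ≤ _ := by
          refine setIntegral_mono_set h1 ?_ (Eventually.of_forall fun s hs => hs.1)
          refine (ae_restrict_iff' measurableSet_Ioi).mpr (Eventually.of_forall fun s hs => ?_)
          have : 0 < 1 + s := by linarith [mem_Ioi.mp hs]
          simp only [Pi.zero_apply]
          positivity
  refine ⟨C * (D₀ + W₀ + D * L) * Real.exp (C * L) + 1, by positivity, fun T hT => ?_⟩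
  refine wnorm_le_of_forall_weight_le (Lp.aestronglyMeasurable _) fun R => ?_
  set M : ℝ → ℝ := fun s => (∫⁻ x, weight j R x * ‖u (max s 0) x‖ₑ).toReal with hM
  have hMc : Continuous M := by
    have h1 : Continuous fun s : ℝ => u (max s 0) :=
      h.continuousOn_u.comp_continuous (by fun_prop) fun s => mem_Ici.mpr (le_max_right _ _)
    exact (continuous_lintegral_weight j R).comp h1
  have hM0 : ∀ s, 0 ≤ M s := fun s => ENNReal.toReal_nonneg
  have hMeq : ∀ s, 0 < s → ∫⁻ x, weight j R x * ‖u s x‖ₑ = ENNReal.ofReal (M s) := by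
    intro s hs
    rw [hM]
    simp only
    rw [max_eq_left hs.le, ENNReal.ofReal_toReal (lintegral_weight_lt_top j R _).ne]
  -- With the final time T fixed, t^{j/2} ≤ T^{j/2} turns the inhomogeneous term into a constant:
  -- the free evolution plus the spreading of the source by the kernel.
  set a := C * (T ^ ((j : ℝ) / 2) * D₀ + W₀) + C * (T ^ ((j : ℝ) / 2) * D * L) with ha
  have ha0 : 0 ≤ a := by positivity
  have hineq : ∀ t, 0 < t → t ≤ T → M t ≤ a + ∫ s in (0 : ℝ)..t, C * k s * M s := by
    intro t ht htT
    have hTt : t ^ ((j : ℝ) / 2) ≤ T ^ ((j : ℝ) / 2) := by gcongr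
    set b : ℝ → ℝ := fun s => C * (T ^ ((j : ℝ) / 2) * (k s * D) + k s * M s) with hb
    have hbc : Continuous b := by fun_prop
    have hb0 : ∀ s, 0 < b s := fun s => by
      have := hkpos s
      have := hM0 s
      have : 0 < T ^ ((j : ℝ) / 2) := Real.rpow_pos_of_pos hT _
      positivity
    have hI : Integrable (fun s => toL1 (semigroup ν (t - s) (F s)))
        (volume.restrict (Ioo 0 t)) := h.integrableOn_semigroup hν
    have h1 : ∫⁻ x, weight j R x * ‖(toL1 (semigroup ν t u₀) : Sp n → ℂ) x‖ₑ ≤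
        ENNReal.ofReal (C * (T ^ ((j : ℝ) / 2) * D₀ + W₀)) := by
      have he : ∫⁻ x, weight j R x * ‖(toL1 (semigroup ν t u₀) : Sp n → ℂ) x‖ₑ =
          ∫⁻ x, weight j R x * ‖kconv ν 0 t u₀ x‖ₑ := by
        refine lintegral_congr_ae ?_
        filter_upwards [toL1_semigroup_ae_eq hν ht h.memLp_init] with x hx
        rw [hx]
      rw [he]
      refine (hker t ht R u₀ h.memLp_init.1).trans ?_
      rw [ENNReal.ofReal_mul hC.le, ENNReal.ofReal_add (by positivity) hW₀0,
        ENNReal.ofReal_mul (by positivity), hD₀', ← hW₀']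
      gcongr
      exact lintegral_mono fun x => mul_le_mul_left (min_le_left _ _) _
    have h2 : ∫⁻ x, weight j R x *
        ‖(∫ s in Ioo 0 t, toL1 (semigroup ν (t - s) (F s)) : Lp ℂ 1 volume) x‖ₑ ≤
        ENNReal.ofReal (∫ s in Ioo 0 t, b s) := by
      refine weighted_integral_L1_le (measurable_weight j R)
        (fun x => ((min_le_right _ _).trans_lt (by simp)).ne) hI
        ((hbc.integrableOn_Icc (a := 0) (b := t)).mono_set Ioo_subset_Icc_self)
        (Eventually.of_forall hb0) ?_
      refine (ae_restrict_iff' measurableSet_Ioo).mpr (Eventually.of_forall fun s hs => ?_)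
      have hts : 0 < t - s := by linarith [hs.2]
      have he : ∫⁻ x, weight j R x * ‖(toL1 (semigroup ν (t - s) (F s)) : Sp n → ℂ) x‖ₑ =
          ∫⁻ x, weight j R x * ‖kconv ν 0 (t - s) (F s) x‖ₑ := by
        refine lintegral_congr_ae ?_
        filter_upwards [toL1_semigroup_ae_eq hν hts (Lp.memLp (F s))] with x hx
        rw [hx]
      rw [he]
      refine (hker (t - s) hts R (F s) (Lp.aestronglyMeasurable _)).trans ?_
      have hks := hkpos s
      have hMs := hM0 s
      rw [hb, ENNReal.ofReal_mul hC.le, ENNReal.ofReal_add (by positivity) (by positivity),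
        ENNReal.ofReal_mul (by positivity), ENNReal.ofReal_mul (q := M s) hks.le]
      have hks' : κ * (1 + s) ^ (-(σ + 1)) = k s := by simp only [hk, abs_of_pos hs.1]
      gcongr
      · linarith [hs.1, hs.2]
      · rw [wnorm_coe]
        refine ENNReal.ofReal_le_ofReal ((h.norm_source_le hs.1).trans (le_of_eq ?_))
        rw [← hks']
        ring
      · refine (h.lintegral_weight_source_le (weight j R) hs.1).trans ?_
        rw [hks', hMeq s hs.1]
    have h3 : ∫⁻ x, weight j R x * ‖u t x‖ₑ ≤
        ENNReal.ofReal (C * (T ^ ((j : ℝ) / 2) * D₀ + W₀)) +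
          ENNReal.ofReal (∫ s in Ioo 0 t, b s) := by
      rw [h.duhamel t ht, intervalIntegral.integral_of_le ht.le, integral_Ioc_eq_integral_Ioo]
      refine le_trans ?_ (add_le_add h1 h2)
      have hmeas : AEMeasurable (fun x => weight j R x *
          ‖(toL1 (semigroup ν t u₀) : Sp n → ℂ) x‖ₑ) volume :=
        (measurable_weight j R).aemeasurable.mul (Lp.aestronglyMeasurable _).enorm
      rw [← lintegral_add_left' hmeas]
      refine lintegral_mono_ae ?_
      filter_upwards [Lp.coeFn_add (toL1 (semigroup ν t u₀))
        (∫ s in Ioo 0 t, toL1 (semigroup ν (t - s) (F s)))] with x hx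
      rw [hx, ← mul_add]
      gcongr
      exact enorm_add_le _ _
    rw [hMeq t ht, ← ENNReal.ofReal_add (by positivity)
      (setIntegral_nonneg measurableSet_Ioo fun s _ => (hb0 s).le)] at h3
    have h4 := (ENNReal.ofReal_le_ofReal_iff (add_nonneg (by positivity)
      (setIntegral_nonneg measurableSet_Ioo fun s _ => (hb0 s).le))).mp h3
    have h5 : ∫ s in Ioo 0 t, b s = C * (T ^ ((j : ℝ) / 2) * D) * (∫ s in (0 : ℝ)..t, k s) +
        ∫ s in (0 : ℝ)..t, C * k s * M s := by
      rw [← integral_Ioc_eq_integral_Ioo, ← intervalIntegral.integral_of_le ht.le,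
        ← intervalIntegral.integral_const_mul, ← intervalIntegral.integral_add]
      · refine intervalIntegral.integral_congr fun s _ => ?_
        simp only [hb]
        ring
      · exact (continuous_const.mul hkc).intervalIntegrable _ _
      · exact ((continuous_const.mul hkc).mul hMc).intervalIntegrable _ _
    have h6 : C * (T ^ ((j : ℝ) / 2) * D) * (∫ s in (0 : ℝ)..t, k s) ≤
        C * (T ^ ((j : ℝ) / 2) * D) * L := by
      gcongr
      exact hkint t ht
    rw [h5] at h4
    rw [ha]
    linarith
  have hL' : ∫ s in (0 : ℝ)..T, C * k s ≤ C * L := by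
    rw [intervalIntegral.integral_const_mul]
    gcongr
    exact hkint T hT
  -- The exponential factor exp(CL) depends on neither T nor R, so the growth in T is that of a.
  have hfin := gronwall_integral (M := M) (κ := fun s => C * k s) hMc (continuous_const.mul hkc)
    (fun s => mul_nonneg hC.le (hkpos s).le) hT hineq hL' ha0
  rw [hMeq T hT]
  refine ENNReal.ofReal_le_ofReal (hfin.trans ?_)
  have hP : 1 ≤ (1 + T) ^ ((j : ℝ) / 2) := Real.one_le_rpow (by linarith) (by positivity)
  have hTP : T ^ ((j : ℝ) / 2) ≤ (1 + T) ^ ((j : ℝ) / 2) := by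
    gcongr
    linarith
  set P := (1 + T) ^ ((j : ℝ) / 2)
  have haP : a ≤ C * (D₀ + W₀ + D * L) * P := by
    calc a ≤ C * (P * D₀ + P * W₀) + C * (P * D * L) := by
          rw [ha]
          gcongr
          exact le_mul_of_one_le_left hW₀0 hP
      _ = _ := by ring
  calc a * Real.exp (C * L) ≤ C * (D₀ + W₀ + D * L) * P * Real.exp (C * L) := by gcongr
    _ ≤ _ := by nlinarith

theorem exists_wnorm_source_le (h : DecayingSolution ν u₀ u F σ κ D) (hν : 0 < ν.re) (j : ℕ)
    (hw : wnorm j u₀ < ∞) : ∃ A : ℝ, 0 < A ∧ ∀ s : ℝ, 0 < s →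
      wnorm j (F s) ≤ ENNReal.ofReal (A * (1 + s) ^ ((j : ℝ) / 2 - (σ + 1))) := by
  obtain ⟨A, hA, h1⟩ := h.exists_wnorm_le hν j hw
  have hκ := h.κ_pos
  refine ⟨κ * A, by positivity, fun s hs => ?_⟩
  refine (h.lintegral_weight_source_le _ hs).trans ((mul_le_mul_right (h1 s hs) _).trans ?_)
  rw [← ENNReal.ofReal_mul (by positivity)]
  refine ENNReal.ofReal_le_ofReal (le_of_eq ?_)
  rw [sub_eq_add_neg, Real.rpow_add (by linarith)]
  ring

theorem exists_forall_wnorm_source_le (h : DecayingSolution ν u₀ u F σ κ D) (hν : 0 < ν.re)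
    (m : ℕ) (hw : ∀ j ≤ m, wnorm j u₀ < ∞) : ∃ A : ℝ, 0 < A ∧ ∀ j ≤ m, ∀ s : ℝ, 0 < s →
      wnorm j (F s) ≤ ENNReal.ofReal (A * (1 + s) ^ ((j : ℝ) / 2 - (σ + 1))) := by
  choose! A hA h1 using fun j (hj : j ≤ m) => h.exists_wnorm_source_le hν j (hw j hj)
  have hnn : ∀ j ∈ Finset.range (m + 1), 0 ≤ A j := fun j hj =>
    (hA j (by rw [Finset.mem_range] at hj; omega)).le
  refine ⟨∑ j ∈ Finset.range (m + 1), A j,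
    Finset.sum_pos (fun j hj => hA j (by rw [Finset.mem_range] at hj; omega)) (by simp),
    fun j hj s hs => (h1 j hj s hs).trans (ENNReal.ofReal_le_ofReal ?_)⟩
  have : A j ≤ ∑ j ∈ Finset.range (m + 1), A j :=
    Finset.single_le_sum hnn (by rw [Finset.mem_range]; omega)
  gcongr

end DecayingSolution

/-! ### Moments of Bochner integrals -/

theorem norm_indicator_monom_le {n : ℕ} (β : MIdx n) (R : ℕ) (y : Sp n) :
    ‖(Metric.closedBall (0 : Sp n) R).indicator (fun y => (monom β y : ℂ)) y‖ ≤
      (R : ℝ) ^ len β := by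
  by_cases hy : y ∈ Metric.closedBall (0 : Sp n) R
  · rw [indicator_of_mem hy, Complex.norm_real]
    refine (abs_monom_le β y).trans ?_
    gcongr
    simpa using hy
  · rw [indicator_of_notMem hy, norm_zero]
    positivity

theorem measurable_monom_ofReal {n : ℕ} (β : MIdx n) :
    Measurable fun y : Sp n => (monom β y : ℂ) :=
  (Complex.continuous_ofReal.comp (continuous_monom β)).measurable

theorem integrable_indicator_monom_mul {n : ℕ} (β : MIdx n) (R : ℕ) {g : Sp n → ℂ}
    (hg : Integrable g volume) : Integrable (fun y =>
      (Metric.closedBall (0 : Sp n) R).indicator (fun y => (monom β y : ℂ)) y * g y) volume :=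
  hg.bdd_mul (c := (R : ℝ) ^ len β)
    ((measurable_monom_ofReal β).indicator Metric.isClosed_closedBall.measurableSet
      |>.aestronglyMeasurable)
    (Eventually.of_forall fun y => norm_indicator_monom_le β R y)

/-- The truncated moment, as a continuous linear functional on `L¹`. -/
noncomputable def truncatedMoment {n : ℕ} (β : MIdx n) (R : ℕ) :
    Lp ℂ 1 (volume : Measure (Sp n)) →L[ℝ] ℂ :=
  LinearMap.mkContinuous
    { toFun := fun g => ∫ y,
        (Metric.closedBall (0 : Sp n) R).indicator (fun y => (monom β y : ℂ)) y * g y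
      map_add' := fun g h => by
        rw [← integral_add (integrable_indicator_monom_mul β R (integrable_coe g))
          (integrable_indicator_monom_mul β R (integrable_coe h))]
        refine integral_congr_ae ?_
        filter_upwards [Lp.coeFn_add g h] with y hy
        rw [hy, Pi.add_apply, mul_add]
      map_smul' := fun c g => by
        rw [RingHom.id_apply, ← integral_smul]
        refine integral_congr_ae ?_
        filter_upwards [Lp.coeFn_smul c g] with y hy
        rw [hy, Pi.smul_apply, mul_smul_comm] }
    ((R : ℝ) ^ len β) fun g => by
      have h1 : ‖∫ y, (Metric.closedBall (0 : Sp n) R).indicator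
          (fun y => (monom β y : ℂ)) y * g y‖ ≤ ∫ y, (R : ℝ) ^ len β * ‖g y‖ := by
        refine norm_integral_le_of_norm_le ((integrable_coe g).norm.const_mul _)
          (Eventually.of_forall fun y => ?_)
        rw [norm_mul]
        gcongr
        exact norm_indicator_monom_le β R y
      rw [integral_const_mul, ← L1.norm_eq_integral_norm] at h1
      exact h1

theorem truncatedMoment_apply {n : ℕ} (β : MIdx n) (R : ℕ)
    (g : Lp ℂ 1 (volume : Measure (Sp n))) : truncatedMoment β R g = ∫ y,
      (Metric.closedBall (0 : Sp n) R).indicator (fun y => (monom β y : ℂ)) y * g y := rfl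

theorem enorm_indicator_monom_mul_le {n : ℕ} (β : MIdx n) (R : ℕ) (g : Sp n → ℂ) (y : Sp n) :
    ‖(Metric.closedBall (0 : Sp n) R).indicator (fun y => (monom β y : ℂ)) y * g y‖ ≤
      ‖(monom β y : ℂ) * g y‖ := by
  rw [norm_mul, norm_mul]
  gcongr
  exact norm_indicator_le_norm_self (fun y => (monom β y : ℂ)) y

theorem tendsto_truncatedMoment {n : ℕ} (β : MIdx n) (g : Lp ℂ 1 (volume : Measure (Sp n)))
    (hg : Integrable (fun y => (monom β y : ℂ) * g y) volume) :
    Tendsto (fun R => truncatedMoment β R g) atTop (𝓝 (∫ y, (monom β y : ℂ) * g y)) := by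
  simp_rw [truncatedMoment_apply]
  refine tendsto_integral_of_dominated_convergence (fun y => ‖(monom β y : ℂ) * g y‖)
    (fun R => (integrable_indicator_monom_mul β R (integrable_coe g)).aestronglyMeasurable)
    hg.norm (fun R => Eventually.of_forall fun y => enorm_indicator_monom_mul_le β R g y)
    (Eventually.of_forall fun y => ?_)
  obtain ⟨N, hN⟩ := exists_nat_ge ‖y‖
  refine tendsto_const_nhds.congr' ?_
  filter_upwards [eventually_ge_atTop N] with R hR
  rw [indicator_of_mem]
  simpa using hN.trans (by exact_mod_cast hR)

/-- Moments commute with Bochner integrals in `L¹`. -/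
theorem integral_monom_mul_integral {n : ℕ} {Ω : Type*} [MeasurableSpace Ω] {μ : Measure Ω}
    (β : MIdx n) {F : Ω → Lp ℂ 1 (volume : Measure (Sp n))} (hF : Integrable F μ) {b : Ω → ℝ}
    (hb : Integrable b μ) (hpos : ∀ᵐ s ∂μ, 0 < b s)
    (hN : ∀ᵐ s ∂μ, wnorm (len β) (F s) ≤ ENNReal.ofReal (b s)) :
    Integrable (fun y => (monom β y : ℂ) *
        (∫ s, F s ∂μ : Lp ℂ 1 (volume : Measure (Sp n))) y) volume ∧
      Integrable (fun s => moment β (F s)) μ ∧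
      moment β (∫ s, F s ∂μ : Lp ℂ 1 (volume : Measure (Sp n))) = ∫ s, moment β (F s) ∂μ := by
  set G : Lp ℂ 1 (volume : Measure (Sp n)) := ∫ s, F s ∂μ with hG
  have h1 : wnorm (len β) G ≤ ENNReal.ofReal (∫ s, b s ∂μ) :=
    weighted_integral_L1_le (w := fun x => ‖x‖ₑ ^ len β) (by fun_prop)
      (fun x => ENNReal.pow_ne_top enorm_ne_top) hF hb hpos hN
  have hGint : Integrable (fun y => (monom β y : ℂ) * G y) volume :=
    integrable_monom_mul β (Lp.aestronglyMeasurable G) (h1.trans_lt ENNReal.ofReal_lt_top)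
  have hFint : ∀ᵐ s ∂μ, Integrable (fun y => (monom β y : ℂ) * F s y) volume := by
    filter_upwards [hN] with s hs
    exact integrable_monom_mul β (Lp.aestronglyMeasurable _) (hs.trans_lt ENNReal.ofReal_lt_top)
  have hmeas : ∀ R, AEStronglyMeasurable (fun s => truncatedMoment β R (F s)) μ := fun R =>
    (truncatedMoment β R).continuous.comp_aestronglyMeasurable hF.aestronglyMeasurable
  have hlim : ∀ᵐ s ∂μ, Tendsto (fun R => truncatedMoment β R (F s)) atTop
      (𝓝 (∫ y, (monom β y : ℂ) * F s y)) := by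
    filter_upwards [hFint] with s hs
    exact tendsto_truncatedMoment β (F s) hs
  have hbound : ∀ᵐ s ∂μ, ∫ y, ‖(monom β y : ℂ) * F s y‖ ≤ b s := by
    filter_upwards [hN, hpos, hFint] with s hs hs' hi
    rw [integral_norm_eq_lintegral_enorm hi.aestronglyMeasurable]
    exact ENNReal.toReal_le_of_le_ofReal hs'.le ((lintegral_monom_mul_le β (F s)).trans hs)
  have hbound' : ∀ R, ∀ᵐ s ∂μ, ‖truncatedMoment β R (F s)‖ ≤ b s := by
    intro R
    filter_upwards [hbound, hFint] with s hs hi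
    refine (norm_integral_le_of_norm_le hi.norm (Eventually.of_forall fun y => ?_)).trans hs
    exact enorm_indicator_monom_mul_le β R (F s) y
  have hIm : Integrable (fun s => ∫ y, (monom β y : ℂ) * F s y) μ := by
    refine hb.mono' (aestronglyMeasurable_of_tendsto_ae atTop hmeas hlim) ?_
    filter_upwards [hbound] with s hs
    exact (norm_integral_le_integral_norm _).trans hs
  refine ⟨hGint, hIm.const_mul _, ?_⟩
  -- A moment is not continuous on L¹, but its truncations are, and they commute with the Bochner
  -- integral. Dominated convergence with majorant b removes the truncation on this side.
  have hL : Tendsto (fun R => ∫ s, truncatedMoment β R (F s) ∂μ) atTop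
      (𝓝 (∫ s, (∫ y, (monom β y : ℂ) * F s y) ∂μ)) :=
    tendsto_integral_of_dominated_convergence b hmeas hb hbound' hlim
  have hR := tendsto_truncatedMoment β G hGint
  have heq : ∀ R, truncatedMoment β R G = ∫ s, truncatedMoment β R (F s) ∂μ := fun R =>
    ((truncatedMoment β R).integral_comp_comm hF).symm
  simp_rw [heq] at hR
  unfold moment
  rw [integral_const_mul, tendsto_nhds_unique hR hL]

theorem moment_smul {n : ℕ} (β : MIdx n) (c : ℝ) (g : Lp ℂ 1 (volume : Measure (Sp n))) :
    moment β (c • g : Lp ℂ 1 (volume : Measure (Sp n))) = c * moment β g := by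
  unfold moment
  have : ∫ y, (monom β y : ℂ) * (c • g : Lp ℂ 1 (volume : Measure (Sp n))) y =
      ∫ y, (c : ℂ) * ((monom β y : ℂ) * g y) := by
    refine integral_congr_ae ?_
    filter_upwards [Lp.coeFn_smul c g] with y hy
    rw [hy, Pi.smul_apply, Complex.real_smul]
    ring
  rw [this, integral_const_mul]
  ring

/-! ### Linear combinations of derivatives of the heat kernel -/

/-- The linear combination of derivatives of the heat kernel in the asymptotic profile, with
general coefficients in place of the moments. -/
noncomputable def coefSum {n : ℕ} (ν : ℂ) (m : ℕ) (t : ℝ) (c : ℕ → MIdx n → ℂ) (x : Sp n) : ℂ :=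
  ∑ k ∈ Finset.range (m / 2 + 1), ∑ γ ∈ ofLen n k, ((-ν) ^ k / (fact γ : ℂ)) *
    ∑ l ∈ Finset.range (m - 2 * k + 1), ∑ β ∈ ofLen n l,
      ((-1) ^ l * c k β) * kernel ν (2 • γ + β) t x

/-- All dependence on s and g sits in the scalar coefficients, so integrating in s amounts to
integrating s^k M_β(F(s)). -/
theorem delayedProfile_eq_coefSum {n : ℕ} (ν : ℂ) (m : ℕ) (t s : ℝ) (g : Sp n → ℂ) :
    delayedProfile ν m t s g = coefSum ν m t fun k β => (s : ℂ) ^ k * moment β g := by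
  ext x
  unfold delayedProfile coefSum momentSum
  refine Finset.sum_congr rfl fun k _ => Finset.sum_congr rfl fun γ _ => ?_
  simp only [Finset.mul_sum]
  refine Finset.sum_congr rfl fun l _ => Finset.sum_congr rfl fun β _ => ?_
  ring

theorem momentSum_eq_coefSum {n : ℕ} (ν : ℂ) (m : ℕ) (t : ℝ) (g : Sp n → ℂ) :
    momentSum ν 0 m t g = coefSum ν m t fun k β => if k = 0 then moment β g else 0 := by
  ext x
  unfold coefSum momentSum
  symm
  rw [Finset.sum_eq_single_of_mem 0 (by simp)]
  · simp [ofLen_zero, fact]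
  · intro k _ hk
    simp [hk]

theorem coefSum_congr {n : ℕ} (ν : ℂ) (m : ℕ) (t : ℝ) {c c' : ℕ → MIdx n → ℂ}
    (h : ∀ k β, 2 * k + len β ≤ m → c k β = c' k β) (x : Sp n) :
    coefSum ν m t c x = coefSum ν m t c' x := by
  unfold coefSum
  refine Finset.sum_congr rfl fun k hk => Finset.sum_congr rfl fun γ _ => ?_
  congr 1
  refine Finset.sum_congr rfl fun l hl => Finset.sum_congr rfl fun β hβ => ?_
  rw [Finset.mem_range] at hk hl
  rw [mem_ofLen] at hβ
  rw [h k β (by omega)]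

theorem coefSum_add {n : ℕ} (ν : ℂ) (m : ℕ) (t : ℝ) (c c' : ℕ → MIdx n → ℂ) (x : Sp n) :
    coefSum ν m t (fun k β => c k β + c' k β) x = coefSum ν m t c x + coefSum ν m t c' x := by
  unfold coefSum
  simp only [mul_add, add_mul, Finset.sum_add_distrib]

theorem continuous_coefSum {n : ℕ} (ν : ℂ) (m : ℕ) (t : ℝ) (c : ℕ → MIdx n → ℂ) :
    Continuous (coefSum ν m t c) := by
  have := fun β => (continuous_kernel ν β t : Continuous (kernel ν β t : Sp n → ℂ))
  unfold coefSum
  fun_prop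

theorem memLp_kernel {n : ℕ} {ν : ℂ} (hν : 0 < ν.re) (α : MIdx n) {t : ℝ} (ht : 0 < t) :
    MemLp (kernel ν α t : Sp n → ℂ) 1 volume := by
  obtain ⟨C, -, h⟩ := exists_bnorm_kernel_le (n := n) hν (Or.inl rfl) α
  exact ⟨(continuous_kernel ν α t).aestronglyMeasurable,
    ((eLpNorm_le_bnorm (Or.inl rfl) _).trans (h t ht)).trans_lt ENNReal.ofReal_lt_top⟩

theorem toL1_const_mul {n : ℕ} (c : ℂ) {g : Sp n → ℂ} (hg : MemLp g 1 volume) :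
    toL1 (fun x => c * g x) = c • toL1 g := by
  have h : MemLp (fun x => c * g x) 1 volume := hg.const_mul c
  unfold toL1
  rw [dif_pos hg, dif_pos h]
  exact MemLp.toLp_const_smul c hg

theorem toL1_sum {n : ℕ} {ι : Type*} (s : Finset ι) {g : ι → Sp n → ℂ}
    (hg : ∀ i ∈ s, MemLp (g i) 1 volume) :
    toL1 (fun x => ∑ i ∈ s, g i x) = ∑ i ∈ s, toL1 (g i) := by
  have h : MemLp (fun x => ∑ i ∈ s, g i x) 1 volume := memLp_finsetSum s hg
  refine Lp.ext ?_
  have h2 := Lp.coeFn_finsetSum s (fun i => toL1 (g i))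
  have h3 : ∀ᵐ x, ∀ i ∈ s, (toL1 (g i) : Sp n → ℂ) x = g i x :=
    (Finset.eventually_all s).mpr fun i hi => coeFn_toL1 (hg i hi)
  filter_upwards [coeFn_toL1 h, h2, h3] with x hx1 hx2 hx3
  rw [hx1, hx2, Finset.sum_apply]
  exact Finset.sum_congr rfl fun i hi => (hx3 i hi).symm

/-- A finite combination of fixed vectors of L¹: its Bochner integral reduces to scalar integrals of
the coefficients. -/
theorem toL1_coefSum {n : ℕ} {ν : ℂ} (hν : 0 < ν.re) (m : ℕ) {t : ℝ} (ht : 0 < t)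
    (c : ℕ → MIdx n → ℂ) : toL1 (coefSum ν m t c) =
      ∑ k ∈ Finset.range (m / 2 + 1), ∑ γ ∈ ofLen n k, ((-ν) ^ k / (fact γ : ℂ)) •
        ∑ l ∈ Finset.range (m - 2 * k + 1), ∑ β ∈ ofLen n l,
          ((-1) ^ l * c k β) • toL1 (kernel ν (2 • γ + β) t) := by
  have h1 : ∀ (k : ℕ) (γ : MIdx n) (l : ℕ), ∀ β ∈ ofLen n l,
      MemLp (fun x => ((-1) ^ l * c k β) * kernel ν (2 • γ + β) t x) 1 volume :=
    fun k γ l β _ => (memLp_kernel hν _ ht).const_mul _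
  have h2 : ∀ (k : ℕ) (γ : MIdx n), ∀ l ∈ Finset.range (m - 2 * k + 1),
      MemLp (fun x => ∑ β ∈ ofLen n l, ((-1) ^ l * c k β) * kernel ν (2 • γ + β) t x) 1 volume :=
    fun k γ l _ => memLp_finsetSum _ (h1 k γ l)
  have h3 : ∀ k : ℕ, ∀ γ ∈ ofLen n k, MemLp (fun x => ((-ν) ^ k / (fact γ : ℂ)) *
      ∑ l ∈ Finset.range (m - 2 * k + 1), ∑ β ∈ ofLen n l,
        ((-1) ^ l * c k β) * kernel ν (2 • γ + β) t x) 1 volume :=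
    fun k γ _ => (memLp_finsetSum _ (h2 k γ)).const_mul _
  have e : coefSum ν m t c = fun x => ∑ k ∈ Finset.range (m / 2 + 1), ∑ γ ∈ ofLen n k,
      ((-ν) ^ k / (fact γ : ℂ)) * ∑ l ∈ Finset.range (m - 2 * k + 1), ∑ β ∈ ofLen n l,
        ((-1) ^ l * c k β) * kernel ν (2 • γ + β) t x := rfl
  rw [e, toL1_sum _ fun k _ => memLp_finsetSum _ (h3 k)]
  refine Finset.sum_congr rfl fun k _ => ?_
  rw [toL1_sum _ (h3 k)]
  refine Finset.sum_congr rfl fun γ _ => ?_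
  rw [toL1_const_mul _ (memLp_finsetSum _ (h2 k γ)), toL1_sum _ (h2 k γ)]
  congr 1
  refine Finset.sum_congr rfl fun l _ => ?_
  rw [toL1_sum _ (h1 k γ l)]
  exact Finset.sum_congr rfl fun β _ => toL1_const_mul _ (memLp_kernel hν _ ht)

theorem memLp_coefSum {n : ℕ} {ν : ℂ} (hν : 0 < ν.re) (m : ℕ) {t : ℝ} (ht : 0 < t)
    (c : ℕ → MIdx n → ℂ) : MemLp (coefSum ν m t c) 1 volume := by
  have h1 : ∀ (k : ℕ) (γ : MIdx n) (l : ℕ), ∀ β ∈ ofLen n l,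
      MemLp (fun x => ((-1) ^ l * c k β) * kernel ν (2 • γ + β) t x) 1 volume :=
    fun k γ l β _ => (memLp_kernel hν _ ht).const_mul _
  have h2 : ∀ (k : ℕ) (γ : MIdx n), ∀ l ∈ Finset.range (m - 2 * k + 1),
      MemLp (fun x => ∑ β ∈ ofLen n l, ((-1) ^ l * c k β) * kernel ν (2 • γ + β) t x) 1 volume :=
    fun k γ l _ => memLp_finsetSum _ (h1 k γ l)
  have h3 : ∀ k : ℕ, ∀ γ ∈ ofLen n k, MemLp (fun x => ((-ν) ^ k / (fact γ : ℂ)) *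
      ∑ l ∈ Finset.range (m - 2 * k + 1), ∑ β ∈ ofLen n l,
        ((-1) ^ l * c k β) * kernel ν (2 • γ + β) t x) 1 volume :=
    fun k γ _ => (memLp_finsetSum _ (h2 k γ)).const_mul _
  exact memLp_finsetSum _ fun k _ => memLp_finsetSum _ (h3 k)

theorem integral_toL1_coefSum {n : ℕ} {ν : ℂ} (hν : 0 < ν.re) (m : ℕ) {t : ℝ} (ht : 0 < t)
    {Ω : Type*} [MeasurableSpace Ω] {μ : Measure Ω} {c : Ω → ℕ → MIdx n → ℂ}
    (hc : ∀ k β, 2 * k + len β ≤ m → Integrable (fun s => c s k β) μ) :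
    Integrable (fun s => toL1 (coefSum ν m t (c s))) μ ∧
      ∫ s, toL1 (coefSum ν m t (c s)) ∂μ =
        toL1 (coefSum ν m t fun k β => ∫ s, c s k β ∂μ) := by
  simp_rw [toL1_coefSum hν m ht]
  have h1 : ∀ k ∈ Finset.range (m / 2 + 1), ∀ γ : MIdx n,
      ∀ l ∈ Finset.range (m - 2 * k + 1), ∀ β ∈ ofLen n l, Integrable (fun s =>
        ((-1) ^ l * c s k β) • (toL1 (kernel ν (2 • γ + β) t) : Lp ℂ 1 volume)) μ := by
    intro k hk γ l hl β hβ
    rw [Finset.mem_range] at hk hl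
    rw [mem_ofLen] at hβ
    exact ((hc k β (by omega)).const_mul _).smul_const _
  have h2 : ∀ k ∈ Finset.range (m / 2 + 1), ∀ γ : MIdx n, Integrable (fun s =>
      ∑ l ∈ Finset.range (m - 2 * k + 1), ∑ β ∈ ofLen n l, ((-1) ^ l * c s k β) •
        (toL1 (kernel ν (2 • γ + β) t) : Lp ℂ 1 volume)) μ := fun k hk γ =>
    integrable_finsetSum _ fun l hl => integrable_finsetSum _ fun β hβ => h1 k hk γ l hl β hβ
  have h3 : ∀ k ∈ Finset.range (m / 2 + 1), ∀ γ ∈ ofLen n k, Integrable (fun s =>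
      ((-ν) ^ k / (fact γ : ℂ)) • ∑ l ∈ Finset.range (m - 2 * k + 1), ∑ β ∈ ofLen n l,
        ((-1) ^ l * c s k β) • (toL1 (kernel ν (2 • γ + β) t) : Lp ℂ 1 volume)) μ :=
    fun k hk γ _ => (h2 k hk γ).fun_smul _
  refine ⟨integrable_finsetSum _ fun k hk => integrable_finsetSum _ (h3 k hk), ?_⟩
  rw [integral_finsetSum _ fun k hk => integrable_finsetSum _ (h3 k hk)]
  refine Finset.sum_congr rfl fun k hk => ?_
  rw [integral_finsetSum _ (h3 k hk)]
  refine Finset.sum_congr rfl fun γ _ => ?_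
  rw [integral_smul, integral_finsetSum _ fun l hl =>
    integrable_finsetSum _ fun β hβ => h1 k hk γ l hl β hβ]
  congr 1
  refine Finset.sum_congr rfl fun l hl => ?_
  rw [integral_finsetSum _ fun β hβ => h1 k hk γ l hl β hβ]
  refine Finset.sum_congr rfl fun β _ => ?_
  rw [integral_smul_const, integral_const_mul]

/-- The allowed growth t^{k + |β|/2} of a coefficient offsets exactly the decay gained from the 2k +
|β| derivatives on its kernel. -/
theorem exists_bnorm_coefSum_le {n : ℕ} {ν : ℂ} (hν : 0 < ν.re) {q : ℝ≥0∞}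
    (hq : q = 1 ∨ q = ∞) (m : ℕ) : ∃ C : ℝ, 0 < C ∧ ∀ (t B : ℝ) (c : ℕ → MIdx n → ℂ),
      0 < t → 0 ≤ B →
      (∀ k β, 2 * k + len β ≤ m → ‖c k β‖ ≤ B * t ^ ((k : ℝ) + (len β : ℝ) / 2)) →
      bnorm q (coefSum ν m t c) ≤ ENNReal.ofReal (C * (B * t ^ (-decayExp n q))) := by
  choose C hC h using fun α => exists_bnorm_kernel_le (n := n) hν hq α
  have hS0 : ∀ k : ℕ, ∀ γ : MIdx n, 0 ≤ ‖ν‖ ^ k *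
      ∑ l ∈ Finset.range (m - 2 * k + 1), ∑ β ∈ ofLen n l, C (2 • γ + β) := fun k γ =>
    mul_nonneg (by positivity) (Finset.sum_nonneg fun _ _ => Finset.sum_nonneg
      fun _ _ => (hC _).le)
  have hS : 0 ≤ ∑ k ∈ Finset.range (m / 2 + 1), ∑ γ ∈ ofLen n k, ‖ν‖ ^ k *
      ∑ l ∈ Finset.range (m - 2 * k + 1), ∑ β ∈ ofLen n l, C (2 • γ + β) :=
    Finset.sum_nonneg fun k _ => Finset.sum_nonneg fun γ _ => hS0 k γ
  refine ⟨∑ k ∈ Finset.range (m / 2 + 1), ∑ γ ∈ ofLen n k, ‖ν‖ ^ k *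
      ∑ l ∈ Finset.range (m - 2 * k + 1), ∑ β ∈ ofLen n l, C (2 • γ + β) + 1,
    by linarith, fun t B c ht hB hc => ?_⟩
  set Q := B * t ^ (-decayExp n q) with hQ
  have hQ0 : 0 ≤ Q := by positivity
  have hmk : ∀ (k l : ℕ) (γ β : MIdx n), AEStronglyMeasurable
      (fun x => ((-1) ^ l * c k β) * kernel ν (2 • γ + β) t x) volume := fun k l γ β =>
    ((continuous_kernel ν _ t).const_mul _).aestronglyMeasurable
  have hml : ∀ (k l : ℕ) (γ : MIdx n), AEStronglyMeasurable
      (fun x => ∑ β ∈ ofLen n l, ((-1) ^ l * c k β) * kernel ν (2 • γ + β) t x) volume :=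
    fun k l γ => Finset.aestronglyMeasurable_fun_sum _ fun β _ => hmk k l γ β
  have hmγ : ∀ (k : ℕ) (γ : MIdx n), AEStronglyMeasurable
      (fun x => ((-ν) ^ k / (fact γ : ℂ)) * ∑ l ∈ Finset.range (m - 2 * k + 1), ∑ β ∈ ofLen n l,
        ((-1) ^ l * c k β) * kernel ν (2 • γ + β) t x) volume :=
    fun k γ => (Finset.aestronglyMeasurable_fun_sum _ fun l _ => hml k l γ).const_mul _
  have hmain : bnorm q (coefSum ν m t c) ≤ ENNReal.ofReal
      ((∑ k ∈ Finset.range (m / 2 + 1), ∑ γ ∈ ofLen n k, ‖ν‖ ^ k *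
      ∑ l ∈ Finset.range (m - 2 * k + 1), ∑ β ∈ ofLen n l, C (2 • γ + β)) * Q) := by
    refine (bnorm_sum_le _ fun k _ =>
      Finset.aestronglyMeasurable_fun_sum _ fun γ _ => hmγ k γ).trans ?_
    rw [Finset.sum_mul, ENNReal.ofReal_sum_of_nonneg fun k _ => mul_nonneg
      (Finset.sum_nonneg fun γ _ => hS0 k γ) hQ0]
    refine Finset.sum_le_sum fun k hk => (bnorm_sum_le _ fun γ _ => hmγ k γ).trans ?_
    rw [Finset.sum_mul, ENNReal.ofReal_sum_of_nonneg fun γ _ => mul_nonneg (hS0 k γ) hQ0]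
    refine Finset.sum_le_sum fun γ hγ => ?_
    rw [bnorm_const_mul, mul_assoc, ENNReal.ofReal_mul (by positivity)]
    refine mul_le_mul' ?_ ?_
    · rw [← ofReal_norm]
      refine ENNReal.ofReal_le_ofReal ?_
      rw [norm_div, norm_pow, norm_neg, Complex.norm_natCast]
      exact div_le_self (by positivity) (by exact_mod_cast fact_pos γ)
    refine (bnorm_sum_le _ fun l _ => hml k l γ).trans ?_
    rw [Finset.sum_mul, ENNReal.ofReal_sum_of_nonneg fun l _ => mul_nonneg
      (Finset.sum_nonneg fun _ _ => (hC _).le) hQ0]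
    refine Finset.sum_le_sum fun l hl => (bnorm_sum_le _ fun β _ => hmk k l γ β).trans ?_
    rw [Finset.sum_mul, ENNReal.ofReal_sum_of_nonneg fun β _ => mul_nonneg (hC _).le hQ0]
    refine Finset.sum_le_sum fun β hβ => ?_
    rw [Finset.mem_range] at hk hl
    rw [mem_ofLen] at hγ hβ
    rw [bnorm_const_mul]
    have hc1 : ‖(-1) ^ l * c k β‖ₑ ≤ ENNReal.ofReal (B * t ^ ((k : ℝ) + (len β : ℝ) / 2)) := by
      rw [← ofReal_norm, norm_mul, norm_pow, norm_neg, norm_one, one_pow, one_mul]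
      exact ENNReal.ofReal_le_ofReal (hc k β (by omega))
    refine (mul_le_mul' hc1 (h _ t ht)).trans ?_
    rw [← ENNReal.ofReal_mul (by positivity)]
    refine ENNReal.ofReal_le_ofReal (le_of_eq ?_)
    have e : t ^ (-decayExp n q) = t ^ ((k : ℝ) + (len β : ℝ) / 2) *
        t ^ (-decayExp n q - (len (2 • γ + β) : ℝ) / 2) := by
      rw [← Real.rpow_add ht, len_add, len_smul, hγ]
      congr 1
      push_cast
      ring
    rw [hQ, e]
    ring
  refine hmain.trans (ENNReal.ofReal_le_ofReal ?_)
  gcongr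
  linarith

theorem wnorm_smul {n : ℕ} (j : ℕ) {c : ℝ} (hc : 0 ≤ c) (g : Lp ℂ 1 (volume : Measure (Sp n))) :
    wnorm j (c • g : Lp ℂ 1 (volume : Measure (Sp n))) = ENNReal.ofReal c * wnorm j g := by
  unfold wnorm
  rw [← lintegral_const_mul' _ _ ENNReal.ofReal_ne_top]
  refine lintegral_congr_ae ?_
  filter_upwards [Lp.coeFn_smul c g] with x hx
  rw [hx, Pi.smul_apply, enorm_smul, Real.enorm_of_nonneg hc, mul_left_comm]

namespace DecayingSolution

variable {n : ℕ} {ν : ℂ} {u₀ : Sp n → ℂ} {u F : ℝ → Lp ℂ 1 (volume : Measure (Sp n))}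
  {σ κ D : ℝ}

theorem integrableOn_pow_smul (h : DecayingSolution ν u₀ u F σ κ D) {k : ℕ} (hk : (k : ℝ) < σ) :
    IntegrableOn (fun s : ℝ => s ^ k • F s) (Ioi 0) volume := by
  have hb : IntegrableOn (fun s : ℝ => κ * D * (1 + s) ^ (-(σ - k + 1))) (Ioi 0) volume :=
    (integrableOn_one_add_rpow (by linarith)).const_mul _
  have hD := h.D_pos
  have hκ := h.κ_pos
  refine Integrable.mono' hb ?_ ?_
  · exact ((by fun_prop : Continuous fun s : ℝ => s ^ k).continuousOn.smul
      h.continuousOn_F).aestronglyMeasurable measurableSet_Ioi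
  · refine (ae_restrict_iff' measurableSet_Ioi).mpr (Eventually.of_forall fun s hs => ?_)
    have hs : 0 < s := hs
    rw [norm_smul, Real.norm_of_nonneg (by positivity)]
    calc s ^ k * ‖F s‖ ≤ (1 + s) ^ k * (κ * D * (1 + s) ^ (-(σ + 1))) := by
          gcongr
          · linarith
          · exact h.norm_source_le hs
      _ = κ * D * ((1 + s) ^ (k : ℝ) * (1 + s) ^ (-(σ + 1))) := by
          rw [Real.rpow_natCast]; ring
      _ = _ := by
          rw [← Real.rpow_add (by linarith)]
          congr 2
          ring

theorem norm_pow_mul_moment_le {A : ℝ} (hA : 0 < A) {m : ℕ}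
    (hwF : ∀ j ≤ m, ∀ s : ℝ, 0 < s →
      wnorm j (F s) ≤ ENNReal.ofReal (A * (1 + s) ^ ((j : ℝ) / 2 - (σ + 1))))
    {k : ℕ} {β : MIdx n} (hβ : len β ≤ m) {s : ℝ} (hs : 0 < s) :
    ‖(s : ℂ) ^ k * moment β (F s)‖ ≤ A * (1 + s) ^ (-(σ - k - (len β : ℝ) / 2 + 1)) := by
  have h1 : ‖moment β (F s)‖ ≤ A * (1 + s) ^ ((len β : ℝ) / 2 - (σ + 1)) := by
    have := (enorm_moment_le β (F s)).trans (hwF _ hβ s hs)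
    rw [← ofReal_norm] at this
    exact (ENNReal.ofReal_le_ofReal_iff (by positivity)).mp this
  rw [norm_mul, norm_pow, Complex.norm_real, Real.norm_of_nonneg hs.le]
  calc s ^ k * ‖moment β (F s)‖ ≤ (1 + s) ^ k * (A * (1 + s) ^ ((len β : ℝ) / 2 - (σ + 1))) := by
        gcongr
        linarith
    _ = A * ((1 + s) ^ (k : ℝ) * (1 + s) ^ ((len β : ℝ) / 2 - (σ + 1))) := by
        rw [Real.rpow_natCast]; ring
    _ = _ := by
        rw [← Real.rpow_add (by linarith)]
        congr 2
        ring

/-- The moments of the time-weighted integrals of the source term. -/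
theorem moment_integral_source (h : DecayingSolution ν u₀ u F σ κ D) {A : ℝ} (hA : 0 < A) {m : ℕ}
    (hwF : ∀ j ≤ m, ∀ s : ℝ, 0 < s →
      wnorm j (F s) ≤ ENNReal.ofReal (A * (1 + s) ^ ((j : ℝ) / 2 - (σ + 1))))
    {k : ℕ} {β : MIdx n} (hβ : len β ≤ m) (hk : (k : ℝ) + (len β : ℝ) / 2 < σ) :
    Integrable (fun y => (monom β y : ℂ) *
        (∫ s in Ioi (0 : ℝ), s ^ k • F s : Lp ℂ 1 (volume : Measure (Sp n))) y) volume ∧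
      IntegrableOn (fun s : ℝ => (s : ℂ) ^ k * moment β (F s)) (Ioi 0) volume ∧
      moment β (∫ s in Ioi (0 : ℝ), s ^ k • F s : Lp ℂ 1 (volume : Measure (Sp n))) =
        ∫ s in Ioi (0 : ℝ), (s : ℂ) ^ k * moment β (F s) := by
  have hl : (0 : ℝ) ≤ (len β : ℝ) / 2 := by positivity
  have hb : IntegrableOn (fun s : ℝ => A * (1 + s) ^ (-(σ - k - (len β : ℝ) / 2 + 1)))
      (Ioi 0) volume := (integrableOn_one_add_rpow (by linarith)).const_mul _
  have hmain := integral_monom_mul_integral β (h.integrableOn_pow_smul (k := k) (by linarith)) hb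
    ?_ ?_
  · have e : ∀ s : ℝ, moment β (s ^ k • F s : Lp ℂ 1 (volume : Measure (Sp n))) =
        (s : ℂ) ^ k * moment β (F s) := fun s => by
      rw [moment_smul]
      push_cast
      rfl
    simp_rw [e] at hmain
    exact hmain
  · refine (ae_restrict_iff' measurableSet_Ioi).mpr (Eventually.of_forall fun s hs => ?_)
    have hs : 0 < s := hs
    positivity
  · refine (ae_restrict_iff' measurableSet_Ioi).mpr (Eventually.of_forall fun s hs => ?_)
    have hs : 0 < s := hs
    rw [wnorm_smul _ (by positivity)]
    refine (mul_le_mul_right (hwF _ hβ s hs) _).trans ?_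
    rw [← ENNReal.ofReal_mul (by positivity)]
    refine ENNReal.ofReal_le_ofReal ?_
    calc s ^ k * (A * (1 + s) ^ ((len β : ℝ) / 2 - (σ + 1))) ≤
          (1 + s) ^ k * (A * (1 + s) ^ ((len β : ℝ) / 2 - (σ + 1))) := by
          gcongr
          linarith
      _ = A * ((1 + s) ^ (k : ℝ) * (1 + s) ^ ((len β : ℝ) / 2 - (σ + 1))) := by
          rw [Real.rpow_natCast]; ring
      _ = _ := by
          rw [← Real.rpow_add (by linarith)]
          congr 2
          ring

/-- The contribution of late times to the moments. -/
theorem norm_integral_Ioi_moment_le {A : ℝ} (hA : 0 < A) {m : ℕ}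
    (hwF : ∀ j ≤ m, ∀ s : ℝ, 0 < s →
      wnorm j (F s) ≤ ENNReal.ofReal (A * (1 + s) ^ ((j : ℝ) / 2 - (σ + 1))))
    (hσ : (m : ℝ) / 2 < σ) {k : ℕ} {β : MIdx n} (hk : 2 * k + len β ≤ m) {t : ℝ} (ht : 0 < t) :
    ‖∫ s in Ioi (t / 2), (s : ℂ) ^ k * moment β (F s)‖ ≤
      A * 2 ^ σ / (σ - (m : ℝ) / 2) * t ^ (-σ) * t ^ ((k : ℝ) + (len β : ℝ) / 2) := by
  have hkR : (k : ℝ) + (len β : ℝ) / 2 ≤ (m : ℝ) / 2 := by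
    have : ((2 * k + len β : ℕ) : ℝ) ≤ m := by exact_mod_cast hk
    push_cast at this
    linarith
  set a := σ - k - (len β : ℝ) / 2 with ha
  have ha0 : 0 < a := by linarith
  have hb : IntegrableOn (fun s : ℝ => A * (1 + s) ^ (-(a + 1))) (Ioi (t / 2)) volume :=
    ((integrableOn_one_add_rpow ha0).mono_set (Ioi_subset_Ioi (by linarith))).const_mul _
  have h1 : ‖∫ s in Ioi (t / 2), (s : ℂ) ^ k * moment β (F s)‖ ≤
      ∫ s in Ioi (t / 2), A * (1 + s) ^ (-(a + 1)) := by
    refine norm_integral_le_of_norm_le hb ?_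
    refine (ae_restrict_iff' measurableSet_Ioi).mpr (Eventually.of_forall fun s hs => ?_)
    have hs' : t / 2 < s := hs
    exact norm_pow_mul_moment_le hA hwF (by omega) (by linarith)
  refine h1.trans ?_
  rw [integral_const_mul, integral_Ioi_one_add_rpow ha0 (by linarith)]
  -- Using σ - m/2 ≤ a ≤ σ, here and in the denominator, makes the constant independent of k and β.
  have h2 : (1 + t / 2) ^ (-a) ≤ 2 ^ σ * t ^ (-a) := by
    calc (1 + t / 2) ^ (-a) ≤ (t / 2) ^ (-a) :=
          Real.rpow_le_rpow_of_nonpos (by positivity) (by linarith) (by linarith)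
      _ = 2 ^ a * t ^ (-a) := by
          rw [Real.div_rpow ht.le (by norm_num), Real.rpow_neg (by norm_num : (0 : ℝ) ≤ 2)]
          field_simp
      _ ≤ _ := by
          gcongr
          · norm_num
          · have : (0 : ℝ) ≤ k := by positivity
            have : (0 : ℝ) ≤ (len β : ℝ) / 2 := by positivity
            linarith
  have e : t ^ (-a) = t ^ (-σ) * t ^ ((k : ℝ) + (len β : ℝ) / 2) := by
    rw [← Real.rpow_add ht]
    congr 1
    rw [ha]
    ring
  have hm : 0 < σ - (m : ℝ) / 2 := by linarith
  calc A * ((1 + t / 2) ^ (-a) / a) ≤ A * (2 ^ σ * t ^ (-a) / (σ - (m : ℝ) / 2)) := by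
        gcongr
        linarith
    _ = _ := by rw [e]; ring

set_option maxHeartbeats 1000000 in
/-- The quantitative remainder estimate. -/
theorem exists_eLpNorm_sub_profile_le (h : DecayingSolution ν u₀ u F σ κ D) (hν : 0 < ν.re)
    {q : ℝ≥0∞} (hq : q = 1 ∨ q = ∞) {m : ℕ} (hσ : (m : ℝ) / 2 < σ)
    (hw : ∀ j ≤ m + 1, wnorm j u₀ < ∞) : ∃ C : ℝ, 0 < C ∧ ∀ t : ℝ, 0 < t →
      eLpNorm (fun x => u t x - (momentSum ν 0 m t u₀ x + coefSum ν m t (fun k β =>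
        moment β (∫ s in Ioi (0 : ℝ), s ^ k • F s : Lp ℂ 1 (volume : Measure (Sp n)))) x))
        q volume ≤
      ENNReal.ofReal (C * (t ^ (-decayExp n q) * (t ^ (-(((m : ℝ) + 1) / 2)) *
        (1 + ∫ s in Ioo 0 (t / 2), (1 + s) ^ (((m : ℝ) + 1) / 2 - (σ + 1))) + t ^ (-σ)))) := by
  have hν0 : ν ≠ 0 := by rintro rfl; simp at hν
  have hq1 : 1 ≤ q := by rcases hq with rfl | rfl <;> simp
  have hd0 : 0 ≤ decayExp n q := by
    rcases hq with rfl | rfl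
    · simp [decayExp_one]
    · rw [decayExp_top]; positivity
  have hκ := h.κ_pos
  have hD := h.D_pos
  have hσ0 := h.σ_pos
  have hu₀ : Integrable u₀ volume := memLp_one_iff_integrable.mp h.memLp_init
  obtain ⟨A, hA, hwF⟩ := h.exists_forall_wnorm_source_le hν (m + 1) hw
  have hwF' : ∀ j ≤ m, ∀ s : ℝ, 0 < s →
      wnorm j (F s) ≤ ENNReal.ofReal (A * (1 + s) ^ ((j : ℝ) / 2 - (σ + 1))) :=
    fun j hj => hwF j (by omega)
  obtain ⟨C₀, hC₀, h₀⟩ := exists_bnorm_kconv_sub_momentSum_le (n := n) hν hq 0 m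
  obtain ⟨C₁, hC₁, h₁⟩ := exists_bnorm_sub_delayedProfile_le (n := n) hν hq m
  obtain ⟨C₂, hC₂, h₂⟩ := exists_eLpNorm_kconv_le (n := n) hν hq
  obtain ⟨C₃, hC₃, h₃⟩ := exists_bnorm_coefSum_le (n := n) hν hq m
  set W := (wnorm (m + 1) u₀).toReal with hW
  have hW0 : 0 ≤ W := ENNReal.toReal_nonneg
  have hWeq : wnorm (m + 1) u₀ = ENNReal.ofReal W :=
    (ENNReal.ofReal_toReal (hw (m + 1) le_rfl).ne).symm
  -- `K₂` belongs to the sources on (t/2, t), where powers of t/2 are rewritten as powers of t; `K₃`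
  -- belongs to the tails of the coefficients.
  set K₂ := C₂ * (κ * D) * 2 ^ (σ + decayExp n q) with hK₂
  set K₃ := C₃ * (A * 2 ^ σ / (σ - (m : ℝ) / 2)) with hK₃
  have hK₂0 : 0 < K₂ := by positivity
  have hσm : 0 < σ - (m : ℝ) / 2 := by linarith
  have hK₃0 : 0 < K₃ := by positivity
  clear_value W K₂ K₃
  refine ⟨C₀ * W + C₁ * A + K₂ + K₃, by positivity, fun t ht => ?_⟩
  set d := decayExp n q with hd
  set Ψ : ℕ → Lp ℂ 1 (volume : Measure (Sp n)) := fun k => ∫ s in Ioi (0 : ℝ), s ^ k • F s with hΨ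
  set mom : ℝ → ℕ → MIdx n → ℂ := fun s k β => (s : ℂ) ^ k * moment β (F s) with hmom
  -- The coefficients of the profile are cut at the same time t/2 as Duhamel's integral: `c₁` is
  -- matched with the early sources, `c₂` is pure error.
  set c₁ : ℕ → MIdx n → ℂ := fun k β => ∫ s in Ioo 0 (t / 2), mom s k β with hc₁
  set c₂ : ℕ → MIdx n → ℂ := fun k β => ∫ s in Ioi (t / 2), mom s k β with hc₂
  have hle : ∀ (k : ℕ) (β : MIdx n), 2 * k + len β ≤ m → (k : ℝ) + (len β : ℝ) / 2 < σ := by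
    intro k β hkβ
    have : ((2 * k + len β : ℕ) : ℝ) ≤ m := by exact_mod_cast hkβ
    push_cast at this
    linarith
  have hmomI : ∀ k β, 2 * k + len β ≤ m → IntegrableOn (fun s => mom s k β) (Ioi 0) volume :=
    fun k β hkβ => (h.moment_integral_source hA hwF' (by omega) (hle k β hkβ)).2.1
  have hsplit : ∀ k β, 2 * k + len β ≤ m → moment β (Ψ k) = c₁ k β + c₂ k β := by
    intro k β hkβ
    rw [(h.moment_integral_source hA hwF' (by omega) (hle k β hkβ)).2.2, hc₁, hc₂]
    simp only
    rw [← integral_Ioc_eq_integral_Ioo, ← setIntegral_union Ioc_disjoint_Ioi_same measurableSet_Ioi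
      ((hmomI k β hkβ).mono_set Ioc_subset_Ioi_self)
      ((hmomI k β hkβ).mono_set (Ioi_subset_Ioi (by linarith))),
      Ioc_union_Ioi_eq_Ioi (by linarith)]
  set S : ℝ → Lp ℂ 1 (volume : Measure (Sp n)) :=
    fun s => toL1 (semigroup ν (t - s) (F s)) with hS
  have hSint : IntegrableOn S (Ioo 0 t) volume := h.integrableOn_semigroup hν
  have hS1 : IntegrableOn S (Ioo 0 (t / 2)) volume :=
    hSint.mono_set (Ioo_subset_Ioo le_rfl (by linarith))
  have hS2 : IntegrableOn S (Ioo (t / 2) t) volume :=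
    hSint.mono_set (Ioo_subset_Ioo (by linarith) le_rfl)
  set P : ℝ → Lp ℂ 1 (volume : Measure (Sp n)) := fun s => toL1 (coefSum ν m t (mom s)) with hP
  obtain ⟨hPint, hPeq⟩ := integral_toL1_coefSum hν m ht (μ := volume.restrict (Ioo 0 (t / 2)))
    (c := mom) fun k β hkβ => (hmomI k β hkβ).mono_set Ioo_subset_Ioi_self
  set R₁ : Lp ℂ 1 (volume : Measure (Sp n)) := ∫ s in Ioo 0 (t / 2), (S s - P s) with hR₁
  set R₂ : Lp ℂ 1 (volume : Measure (Sp n)) := ∫ s in Ioo (t / 2) t, S s with hR₂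
  have hR₁eq : R₁ = (∫ s in Ioo 0 (t / 2), S s) - toL1 (coefSum ν m t c₁) := by
    rw [hR₁, integral_sub hS1 hPint, hPeq]
  have hIeq : ∫ s in (0 : ℝ)..t, S s = (∫ s in Ioo 0 (t / 2), S s) + R₂ := by
    have i1 : IntervalIntegrable S volume 0 (t / 2) := by
      rw [intervalIntegrable_iff_integrableOn_Ioo_of_le (by linarith)]
      exact hS1
    have i2 : IntervalIntegrable S volume (t / 2) t := by
      rw [intervalIntegrable_iff_integrableOn_Ioo_of_le (by linarith)]
      exact hS2
    rw [← intervalIntegral.integral_add_adjacent_intervals i1 i2,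
      intervalIntegral.integral_of_le (by linarith), intervalIntegral.integral_of_le (by linarith),
      integral_Ioc_eq_integral_Ioo, integral_Ioc_eq_integral_Ioo]
  have hueq : u t = toL1 (semigroup ν t u₀) + R₁ + toL1 (coefSum ν m t c₁) + R₂ := by
    rw [h.duhamel t ht]
    change _ + ∫ s in (0 : ℝ)..t, S s = _
    rw [hIeq, hR₁eq]
    abel
  -- Four errors remain: the moment expansion of the free evolution, the delayed profiles of the
  -- early sources, the late sources, and the tails of the coefficients.
  have hae : (fun x => u t x - (momentSum ν 0 m t u₀ x +
      coefSum ν m t (fun k β => moment β (Ψ k)) x)) =ᵐ[volume]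
      fun x => (kconv ν 0 t u₀ x - momentSum ν 0 m t u₀ x) +
        (R₁ x + (R₂ x + (-1) * coefSum ν m t c₂ x)) := by
    rw [hueq]
    filter_upwards [Lp.coeFn_add (toL1 (semigroup ν t u₀) + R₁ + toL1 (coefSum ν m t c₁)) R₂,
      Lp.coeFn_add (toL1 (semigroup ν t u₀) + R₁) (toL1 (coefSum ν m t c₁)),
      Lp.coeFn_add (toL1 (semigroup ν t u₀)) R₁, toL1_semigroup_ae_eq hν ht h.memLp_init,
      coeFn_toL1 (memLp_coefSum hν m ht c₁)] with x e1 e2 e3 e4 e5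
    rw [e1, Pi.add_apply, e2, Pi.add_apply, e3, Pi.add_apply, e4, e5,
      coefSum_congr ν m t hsplit x, coefSum_add]
    ring
  rw [eLpNorm_congr_ae hae]
  set J := ∫ s in Ioo 0 (t / 2), (1 + s) ^ (((m : ℝ) + 1) / 2 - (σ + 1)) with hJ
  -- `X` is the size of the first omitted order, `Y` that of everything coming from times beyond
  -- t/2.
  set X := t ^ (-d) * t ^ (-(((m : ℝ) + 1) / 2)) with hX
  set Y := t ^ (-d) * t ^ (-σ) with hY
  have hJ0 : 0 ≤ J := setIntegral_nonneg measurableSet_Ioo fun s hs => by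
    have : 0 < 1 + s := by linarith [hs.1]
    positivity
  have hX0 : 0 ≤ X := by positivity
  have hY0 : 0 ≤ Y := by positivity
  clear_value J
  have hXe : t ^ (-d - ((m : ℝ) + 1) / 2) = X := by
    rw [hX, ← Real.rpow_add ht]
    congr 1
  have b₀ : eLpNorm (fun x => kconv ν 0 t u₀ x - momentSum ν 0 m t u₀ x) q volume ≤
      ENNReal.ofReal (C₀ * W * X) := by
    refine (eLpNorm_le_bnorm hq _).trans ((h₀ t ht u₀ hu₀ (hw (m + 1) le_rfl)).trans ?_)
    rw [hWeq, ← ENNReal.ofReal_mul (by positivity)]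
    refine ENNReal.ofReal_le_ofReal (le_of_eq ?_)
    have : (len (0 : MIdx n) : ℝ) = 0 := by simp [len]
    rw [this, zero_add, hXe]
    ring
  have b₁ : eLpNorm R₁ q volume ≤ ENNReal.ofReal (C₁ * A * (X * J)) := by
    have hcont : ContinuousOn (fun s : ℝ => (1 + s) ^ (((m : ℝ) + 1) / 2 - (σ + 1)))
        (Icc 0 (t / 2)) := by
      refine ContinuousOn.rpow_const (by fun_prop) fun s hs => Or.inl ?_
      have := hs.1
      positivity
    have hbI : IntegrableOn (fun s : ℝ => C₁ * A * X *
        (1 + s) ^ (((m : ℝ) + 1) / 2 - (σ + 1))) (Ioo 0 (t / 2)) volume :=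
      ((hcont.integrableOn_compact isCompact_Icc).mono_set Ioo_subset_Icc_self).const_mul _
    have hXpos : 0 < X := by positivity
    have := eLpNorm_integral_L1_le hq1 (hS1.sub hPint) hbI ?_ ?_
    · rw [integral_const_mul, ← hJ] at this
      rw [← mul_assoc (C₁ * A)]
      exact this
    · refine (ae_restrict_iff' measurableSet_Ioo).mpr (Eventually.of_forall fun s hs => ?_)
      have := hs.1
      positivity
    · refine (ae_restrict_iff' measurableSet_Ioo).mpr (Eventually.of_forall fun s hs => ?_)
      have hs1 := hs.1
      have hs2 := hs.2
      have hts : 0 < t - s := by linarith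
      have hmem := memLp_semigroup hν hts.le (Lp.memLp (F s))
      have e : S s - P s = toL1 (fun x => kconv ν 0 (t - s) (F s) x -
          delayedProfile ν m t s (F s) x) := by
        rw [hS, hP]
        simp only
        rw [toL1_sub hmem (memLp_coefSum hν m ht _), delayedProfile_eq_coefSum,
          semigroup_eq_kconv hν0 hts]
      have hmem' : MemLp (fun x => kconv ν 0 (t - s) (F s) x -
          delayedProfile ν m t s (F s) x) 1 volume := by
        rw [delayedProfile_eq_coefSum, ← semigroup_eq_kconv hν0 hts]
        exact hmem.sub (memLp_coefSum hν m ht _)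
      change eLpNorm (S s - P s : Lp ℂ 1 (volume : Measure (Sp n))) q volume ≤ _
      rw [e, eLpNorm_congr_ae (coeFn_toL1 hmem')]
      -- The moment bounds for F(s) have the parabolic form required, with amplitude
      -- A(1+s)^{-(σ+1)}.
      refine (eLpNorm_le_bnorm hq _).trans ((h₁ t s (A * (1 + s) ^ (-(σ + 1))) (F s) ht hs1.le
        hs2.le (by positivity) (integrable_coe _) fun j hj => ?_).trans ?_)
      · refine (hwF j hj s hs1).trans (ENNReal.ofReal_le_ofReal (le_of_eq ?_))
        rw [sub_eq_add_neg, Real.rpow_add (by linarith)]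
        ring
      · refine ENNReal.ofReal_le_ofReal (le_of_eq ?_)
        rw [hXe, sub_eq_add_neg, Real.rpow_add (by linarith)]
        ring
  have b₂ : eLpNorm R₂ q volume ≤ ENNReal.ofReal (K₂ * Y) := by
    -- No smoothing is needed: after t/2 the source has already decayed in L^q, and the interval has
    -- length t/2.
    set B := C₂ * (κ * D * (1 + t / 2) ^ (-(σ + 1) - d)) with hB
    have hB0 : 0 < B := by positivity
    have := eLpNorm_integral_L1_le hq1 hS2 (b := fun _ => B)
      (integrableOn_const (by simp)) (Eventually.of_forall fun _ => hB0) ?_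
    · refine this.trans (ENNReal.ofReal_le_ofReal ?_)
      rw [setIntegral_const, smul_eq_mul, Measure.real, Real.volume_Ioo,
        ENNReal.toReal_ofReal (by linarith), hB]
      have h4 : (1 + t / 2) ^ (-(σ + 1) - d) ≤ (t / 2) ^ (-(σ + 1) - d) :=
        Real.rpow_le_rpow_of_nonpos (by positivity) (by linarith) (by linarith)
      have h5 : (t / 2) * (t / 2) ^ (-(σ + 1) - d) = 2 ^ (σ + d) * Y := by
        have : (t / 2) * (t / 2) ^ (-(σ + 1) - d) = (t / 2) ^ (-(σ + d)) := by
          conv_lhs => rw [← Real.rpow_one (t / 2), ← Real.rpow_mul (by positivity),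
            ← Real.rpow_add (by positivity)]
          congr 1
          ring
        rw [this, Real.div_rpow ht.le (by norm_num), Real.rpow_neg (by norm_num : (0 : ℝ) ≤ 2),
          hY, ← Real.rpow_add ht, show -d + -σ = -(σ + d) by ring]
        field_simp
      calc (t - t / 2) * (C₂ * (κ * D * (1 + t / 2) ^ (-(σ + 1) - d))) ≤
            (t - t / 2) * (C₂ * (κ * D * (t / 2) ^ (-(σ + 1) - d))) := by
            gcongr
            linarith
        _ = C₂ * (κ * D) * ((t / 2) * (t / 2) ^ (-(σ + 1) - d)) := by ring
        _ = K₂ * Y := by rw [h5, hK₂]; ring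
    · refine (ae_restrict_iff' measurableSet_Ioo).mpr (Eventually.of_forall fun s hs => ?_)
      have hs1 : 0 < s := by linarith [hs.1]
      have hts : 0 < t - s := by linarith [hs.2]
      change eLpNorm (toL1 (semigroup ν (t - s) (F s)) : Lp ℂ 1 (volume : Measure (Sp n)))
        q volume ≤ _
      rw [eLpNorm_congr_ae (toL1_semigroup_ae_eq hν hts (Lp.memLp (F s)))]
      refine (h₂ (t - s) hts (F s) (Lp.aestronglyMeasurable _)).trans ?_
      rw [hB, ENNReal.ofReal_mul hC₂.le]
      gcongr
      refine (h.eLpNorm_source_le hq hs1).trans (ENNReal.ofReal_le_ofReal ?_)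
      have : (1 + s) ^ (-(σ + 1) - d) ≤ (1 + t / 2) ^ (-(σ + 1) - d) :=
        Real.rpow_le_rpow_of_nonpos (by positivity) (by linarith [hs.1]) (by linarith)
      exact mul_le_mul_of_nonneg_left this (by positivity)
  have b₃ : eLpNorm (fun x => (-1) * coefSum ν m t c₂ x) q volume ≤ ENNReal.ofReal (K₃ * Y) := by
    refine (eLpNorm_le_bnorm hq _).trans ?_
    rw [bnorm_const_mul, enorm_neg, enorm_one, one_mul]
    refine (h₃ t (A * 2 ^ σ / (σ - (m : ℝ) / 2) * t ^ (-σ)) c₂ ht (by positivity)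
      fun k β hkβ => norm_integral_Ioi_moment_le hA hwF' hσ hkβ ht).trans ?_
    refine ENNReal.ofReal_le_ofReal (le_of_eq ?_)
    rw [hK₃, hY]
    ring
  have m₀ : AEStronglyMeasurable (fun x => kconv ν 0 t u₀ x - momentSum ν 0 m t u₀ x) volume :=
    (aestronglyMeasurable_kconv ν 0 t hu₀.aestronglyMeasurable).sub
      (continuous_momentSum ν 0 m t u₀).aestronglyMeasurable
  have m₁ := Lp.aestronglyMeasurable R₁
  have m₂ := Lp.aestronglyMeasurable R₂
  have m₃ : AEStronglyMeasurable (fun x => (-1) * coefSum ν m t c₂ x) volume :=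
    ((continuous_coefSum ν m t c₂).const_mul _).aestronglyMeasurable
  calc _ ≤ eLpNorm (fun x => kconv ν 0 t u₀ x - momentSum ν 0 m t u₀ x) q volume +
        (eLpNorm R₁ q volume + (eLpNorm R₂ q volume +
          eLpNorm (fun x => (-1) * coefSum ν m t c₂ x) q volume)) :=
        (eLpNorm_add_le m₀ (m₁.add (m₂.add m₃)) hq1).trans (add_le_add le_rfl
          ((eLpNorm_add_le m₁ (m₂.add m₃) hq1).trans (add_le_add le_rfl
            (eLpNorm_add_le m₂ m₃ hq1))))
    _ ≤ ENNReal.ofReal (C₀ * W * X) + (ENNReal.ofReal (C₁ * A * (X * J)) +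
        (ENNReal.ofReal (K₂ * Y) + ENNReal.ofReal (K₃ * Y))) := by gcongr
    _ = ENNReal.ofReal (C₀ * W * X + (C₁ * A * (X * J) + (K₂ * Y + K₃ * Y))) := by
        rw [← ENNReal.ofReal_add (p := K₂ * Y) (q := K₃ * Y) (by positivity) (by positivity),
          ← ENNReal.ofReal_add (p := C₁ * A * (X * J)) (by positivity) (by positivity),
          ← ENNReal.ofReal_add (by positivity) (by positivity)]
    _ ≤ _ := by
        refine ENNReal.ofReal_le_ofReal ?_
        have e : t ^ (-d) * (t ^ (-(((m : ℝ) + 1) / 2)) * (1 + J) + t ^ (-σ)) =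
            X + X * J + Y := by rw [hX, hY]; ring
        rw [e]
        have := mul_nonneg hX0 hJ0
        have p1 : 0 ≤ (C₁ * A + K₂ + K₃) * X := by positivity
        have p2 : 0 ≤ (C₀ * W + K₂ + K₃) * (X * J) := by positivity
        have p3 : 0 ≤ (C₀ * W + C₁ * A) * Y := by positivity
        nlinarith

/-- The profile is of the size of its leading terms for small times. -/
theorem exists_eLpNorm_sub_profile_le_of_le_one (h : DecayingSolution ν u₀ u F σ κ D)
    (hν : 0 < ν.re) {q : ℝ≥0∞} (hq : q = 1 ∨ q = ∞) (m : ℕ) (Ψ : ℕ → Sp n → ℂ) :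
    ∃ C : ℝ, 0 < C ∧ ∀ t : ℝ, 0 < t → t ≤ 1 →
      eLpNorm (fun x => u t x - (momentSum ν 0 m t u₀ x +
        coefSum ν m t (fun k β => moment β (Ψ k)) x)) q volume ≤
      ENNReal.ofReal (C * (t ^ (-decayExp n q) * t ^ (-((m : ℝ) / 2)))) := by
  have hq1 : 1 ≤ q := by rcases hq with rfl | rfl <;> simp
  have hd0 : 0 ≤ decayExp n q := by
    rcases hq with rfl | rfl
    · simp [decayExp_one]
    · rw [decayExp_top]; positivity
  have hD := h.D_pos
  obtain ⟨C, hC, h₃⟩ := exists_bnorm_coefSum_le (n := n) hν hq m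
  set c : ℕ → MIdx n → ℂ := fun k β =>
    (if k = 0 then moment β u₀ else 0) + moment β (Ψ k) with hc
  -- A crude bound for the finitely many coefficients, whatever their values; nothing about Ψ
  -- enters.
  set B := ∑ k ∈ Finset.range (m + 1), ∑ l ∈ Finset.range (m + 1), ∑ β ∈ ofLen n l, ‖c k β‖ with hB
  have hB0 : 0 ≤ B := Finset.sum_nonneg fun _ _ => Finset.sum_nonneg fun _ _ =>
    Finset.sum_nonneg fun _ _ => norm_nonneg _
  have hcB : ∀ k β, 2 * k + len β ≤ m → ‖c k β‖ ≤ B := by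
    intro k β hkβ
    calc ‖c k β‖ ≤ ∑ β ∈ ofLen n (len β), ‖c k β‖ :=
          Finset.single_le_sum (f := fun β => ‖c k β‖) (fun _ _ => norm_nonneg _)
            ((mem_ofLen β).mpr rfl)
      _ ≤ ∑ l ∈ Finset.range (m + 1), ∑ β ∈ ofLen n l, ‖c k β‖ :=
          Finset.single_le_sum (f := fun l => ∑ β ∈ ofLen n l, ‖c k β‖)
            (fun _ _ => Finset.sum_nonneg fun _ _ => norm_nonneg _)
            (Finset.mem_range.mpr (by omega))
      _ ≤ B :=
          Finset.single_le_sum (f := fun k => ∑ l ∈ Finset.range (m + 1), ∑ β ∈ ofLen n l, ‖c k β‖)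
            (fun _ _ => Finset.sum_nonneg fun _ _ => Finset.sum_nonneg fun _ _ => norm_nonneg _)
            (Finset.mem_range.mpr (by omega))
  clear_value B
  refine ⟨D + C * B, by positivity, fun t ht ht1 => ?_⟩
  have heq : (fun x => u t x - (momentSum ν 0 m t u₀ x +
      coefSum ν m t (fun k β => moment β (Ψ k)) x)) =
      fun x => u t x + (-1) * coefSum ν m t c x := by
    ext x
    rw [momentSum_eq_coefSum, hc, coefSum_add]
    ring
  have hm1 : 1 ≤ t ^ (-((m : ℝ) / 2)) :=
    Real.one_le_rpow_of_pos_of_le_one_of_nonpos ht ht1 (by simp; positivity)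
  have b₁ : eLpNorm (u t) q volume ≤
      ENNReal.ofReal (D * (t ^ (-decayExp n q) * t ^ (-((m : ℝ) / 2)))) := by
    refine (h.decay q hq t ht).trans (ENNReal.ofReal_le_ofReal ?_)
    have h1 : (1 + t) ^ (-decayExp n q) ≤ t ^ (-decayExp n q) :=
      Real.rpow_le_rpow_of_nonpos ht (by linarith) (by linarith)
    gcongr
    exact h1.trans (le_mul_of_one_le_right (by positivity) hm1)
  have b₂ : eLpNorm (fun x => (-1) * coefSum ν m t c x) q volume ≤
      ENNReal.ofReal (C * B * (t ^ (-decayExp n q) * t ^ (-((m : ℝ) / 2)))) := by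
    refine (eLpNorm_le_bnorm hq _).trans ?_
    rw [bnorm_const_mul, enorm_neg, enorm_one, one_mul]
    -- For t ≤ 1 and k + |β|/2 ≤ m/2 the factor t^{-m/2} t^{k+|β|/2} is at least 1, so constant
    -- coefficients satisfy the growth condition.
    refine (h₃ t (B * t ^ (-((m : ℝ) / 2))) c ht (by positivity) fun k β hkβ => ?_).trans ?_
    · refine (hcB k β hkβ).trans ?_
      rw [mul_assoc, ← Real.rpow_add ht]
      refine le_mul_of_one_le_right hB0 ?_
      refine Real.one_le_rpow_of_pos_of_le_one_of_nonpos ht ht1 ?_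
      have : ((2 * k + len β : ℕ) : ℝ) ≤ m := by exact_mod_cast hkβ
      push_cast at this
      linarith
    · refine ENNReal.ofReal_le_ofReal (le_of_eq ?_)
      ring
  rw [heq]
  refine (eLpNorm_add_le (Lp.aestronglyMeasurable _)
    ((continuous_coefSum ν m t c).const_mul _).aestronglyMeasurable hq1).trans ?_
  refine (add_le_add b₁ b₂).trans ?_
  rw [← ENNReal.ofReal_add (by positivity) (by positivity), ← add_mul]

end DecayingSolution

/-! ### The hypotheses on the solution -/

theorem norm_le_sum_abs {n : ℕ} (x : Sp n) : ‖x‖ ≤ ∑ i, |x i| := by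
  conv_lhs => rw [← (EuclideanSpace.basisFun (Fin n) ℝ).sum_repr x]
  refine (norm_sum_le _ _).trans (Finset.sum_le_sum fun i _ => ?_)
  rw [norm_smul, OrthonormalBasis.norm_eq_one, mul_one]
  simp

/-- Only the pure powers of the coordinates are needed, by the power mean inequality |x|^{j+1} ≤ n^j
∑ |x_i|^{j+1}. -/
theorem wnorm_lt_top_of_memWeightedL1 {n m j : ℕ} {φ : Sp n → ℂ} (h : MemWeightedL1 m φ)
    (hj : j ≤ m) : wnorm j φ < ∞ := by
  rcases j with _ | j
  · rw [← eLpNorm_one_eq_wnorm]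
    exact h.1.2
  · have hpt : ∀ x : Sp n, ‖x‖ₑ ^ (j + 1) * ‖φ x‖ₑ ≤ (n : ℝ≥0∞) ^ j *
        ∑ i : Fin n, ‖(monom (Pi.single i (j + 1)) x : ℂ) * φ x‖ₑ := by
      intro x
      have h1 : ‖x‖ ^ (j + 1) ≤ (n : ℝ) ^ j * ∑ i : Fin n, |x i| ^ (j + 1) := by
        have h2 := pow_sum_div_card_le_sum_pow (s := Finset.univ) (f := fun i : Fin n => |x i|)
          (fun _ _ => abs_nonneg _) j
        refine (pow_le_pow_left₀ (norm_nonneg _) (norm_le_sum_abs x) _).trans ?_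
        rcases Nat.eq_zero_or_pos n with rfl | hn
        · simp
        · rw [Finset.card_univ, Fintype.card_fin, div_le_iff₀ (by positivity)] at h2
          rwa [mul_comm]
      have h3 : ‖x‖ₑ ^ (j + 1) ≤ (n : ℝ≥0∞) ^ j *
          ∑ i : Fin n, ‖(monom (Pi.single i (j + 1)) x : ℂ)‖ₑ := by
        have h4 := ENNReal.ofReal_le_ofReal h1
        rw [ENNReal.ofReal_pow (norm_nonneg _), ofReal_norm, ENNReal.ofReal_mul (by positivity),
          ENNReal.ofReal_pow (by positivity), ENNReal.ofReal_natCast,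
          ENNReal.ofReal_sum_of_nonneg (fun _ _ => by positivity)] at h4
        refine h4.trans (le_of_eq ?_)
        congr 1
        refine Finset.sum_congr rfl fun i _ => ?_
        rw [monom_single, ← ofReal_norm, Complex.norm_real, norm_pow, Real.norm_eq_abs]
      calc _ ≤ (n : ℝ≥0∞) ^ j * (∑ i : Fin n, ‖(monom (Pi.single i (j + 1)) x : ℂ)‖ₑ) *
            ‖φ x‖ₑ := by gcongr
        _ = _ := by simp only [enorm_mul, Finset.sum_mul, mul_assoc]
    have hm : ∀ i : Fin n, MemLp (fun x => (monom (Pi.single i (j + 1)) x : ℂ) * φ x) 1 volume :=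
      fun i => h.2 _ (by rwa [len_single])
    refine (lintegral_mono hpt).trans_lt ?_
    rw [lintegral_const_mul' _ _ (by simp), lintegral_finsetSum' _ fun i _ => (hm i).1.enorm]
    refine ENNReal.mul_lt_top (by simp) (ENNReal.sum_lt_top.mpr fun i _ => ?_)
    rw [← eLpNorm_one_eq_lintegral_enorm]
    exact (hm i).2

theorem HasFreeDecay.exists_eLpNorm_le {n : ℕ} {u : ℝ → Lp ℂ 1 (volume : Measure (Sp n))}
    (h : HasFreeDecay u) : ∃ M : ℝ, 0 ≤ M ∧ ∀ q : ℝ≥0∞, 1 ≤ q → ∀ t : ℝ, 0 < t →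
      eLpNorm (u t) q volume ≤ ENNReal.ofReal (M * t ^ (-decayExp n q)) := by
  refine ⟨(⨆ (q : ℝ≥0∞) (_ : 1 ≤ q) (t : ℝ) (_ : 0 < t),
    ENNReal.ofReal (t ^ decayExp n q) * eLpNorm (u t) q volume).toReal,
    ENNReal.toReal_nonneg, fun q hq t ht => ?_⟩
  have h1 := le_iSup₂_of_le (f := fun (q : ℝ≥0∞) (_ : 1 ≤ q) => ⨆ (t : ℝ) (_ : 0 < t),
    ENNReal.ofReal (t ^ decayExp n q) * eLpNorm (u t) q volume) q hq
    (le_iSup₂_of_le (f := fun (t : ℝ) (_ : 0 < t) =>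
      ENNReal.ofReal (t ^ decayExp n q) * eLpNorm (u t) q volume) t ht le_rfl)
  rw [ENNReal.ofReal_mul ENNReal.toReal_nonneg, ENNReal.ofReal_toReal h.ne,
    Real.rpow_neg ht.le, ENNReal.ofReal_inv_of_pos (by positivity), ← div_eq_mul_inv,
    ENNReal.le_div_iff_mul_le (Or.inl (ENNReal.ofReal_pos.mpr (by positivity)).ne')
      (Or.inl ENNReal.ofReal_ne_top), mul_comm]
  exact h1

/-- The free decay is singular at t = 0, and boundedness in L^∞ takes over for t ≤ 1. The factor
2^{n/2} comes from 1 + t ≤ 2 in one range and 1 + t ≤ 2t in the other. -/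
theorem exists_eLpNorm_le_one_add_rpow {n : ℕ} {u : ℝ → Lp ℂ 1 (volume : Measure (Sp n))}
    (hu : MemX u) (h : HasFreeDecay u) : ∃ D : ℝ, 0 < D ∧ ∀ q : ℝ≥0∞, q = 1 ∨ q = ∞ →
      ∀ t : ℝ, 0 < t →
        eLpNorm (u t) q volume ≤ ENNReal.ofReal (D * (1 + t) ^ (-decayExp n q)) := by
  obtain ⟨M, hM, h1⟩ := h.exists_eLpNorm_le
  obtain ⟨M', h2⟩ := hu.bounded_top
  set B := M + max M' 0 + 1 with hB
  have hB' : M' ≤ B := by linarith [le_max_left M' 0]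
  have hMB : M ≤ B := by linarith [le_max_right M' 0]
  have hB0 : 0 < B := by linarith [le_max_right M' 0]
  clear_value B
  have htwo : (1 : ℝ) ≤ 2 ^ ((n : ℝ) / 2) :=
    Real.one_le_rpow (by norm_num) (by positivity)
  refine ⟨B * 2 ^ ((n : ℝ) / 2), by positivity, ?_⟩
  rintro q (rfl | rfl) t ht
  · refine (h1 1 le_rfl t ht).trans (ENNReal.ofReal_le_ofReal ?_)
    rw [decayExp_one, neg_zero, Real.rpow_zero, Real.rpow_zero, mul_one, mul_one]
    nlinarith
  · rw [decayExp_top]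
    rcases le_total t 1 with ht1 | ht1
    · refine (h2 t ht).trans (ENNReal.ofReal_le_ofReal ?_)
      have : (2 : ℝ) ^ (-((n : ℝ) / 2)) ≤ (1 + t) ^ (-((n : ℝ) / 2)) :=
        Real.rpow_le_rpow_of_nonpos (by linarith) (by linarith) (by simp; positivity)
      calc M' ≤ B * (2 ^ ((n : ℝ) / 2) * 2 ^ (-((n : ℝ) / 2))) := by
            rw [← Real.rpow_add (by norm_num)]
            simpa using hB'
        _ ≤ B * (2 ^ ((n : ℝ) / 2) * (1 + t) ^ (-((n : ℝ) / 2))) := by gcongr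
        _ = _ := by ring
    · refine (h1 ∞ le_top t ht).trans (ENNReal.ofReal_le_ofReal ?_)
      rw [decayExp_top]
      have : (2 * t) ^ (-((n : ℝ) / 2)) ≤ (1 + t) ^ (-((n : ℝ) / 2)) :=
        Real.rpow_le_rpow_of_nonpos (by linarith) (by linarith) (by simp; positivity)
      calc M * t ^ (-((n : ℝ) / 2)) ≤ B * t ^ (-((n : ℝ) / 2)) := by gcongr
        _ = B * (2 ^ ((n : ℝ) / 2) * (2 * t) ^ (-((n : ℝ) / 2))) := by
            rw [Real.mul_rpow (by norm_num) ht.le, ← mul_assoc (2 ^ ((n : ℝ) / 2)),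
              ← Real.rpow_add (by norm_num)]
            simp
        _ ≤ B * (2 ^ ((n : ℝ) / 2) * (1 + t) ^ (-((n : ℝ) / 2))) := by gcongr
        _ = _ := by ring

theorem ae_norm_le_of_eLpNorm_top_le {n : ℕ} {g : Sp n → ℂ} {b : ℝ} (hb : 0 ≤ b)
    (h : eLpNorm g ∞ volume ≤ ENNReal.ofReal b) : ∀ᵐ x, ‖g x‖ ≤ b := by
  rw [eLpNorm_exponent_top] at h
  filter_upwards [ae_le_eLpNormEssSup (f := g) (μ := (volume : Measure (Sp n)))] with x hx
  have := hx.trans h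
  rwa [← ofReal_norm, ENNReal.ofReal_le_ofReal_iff hb] at this

/-! ### Consequences of the growth condition on the nonlinear term. -/

section Nonlinearity

variable {n : ℕ} {f : ℂ → ℂ} {K p D : ℝ} {u : ℝ → Lp ℂ 1 (volume : Measure (Sp n))}

theorem nonlin_ae_eq (hp : 1 < p) (hK : 0 < K) (hf0 : f 0 = 0) (hf : PowerLipschitz f K p)
    (hu : MemX u) {s : ℝ} (hs : 0 < s) : nonlin f u s =ᵐ[volume] fun x => f (u s x) :=
  coeFn_toL1 (memLp_nonlin hp hK hf0 hf (Lp.memLp (u s)) (hu.memLp_top s hs))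

/-- Taking η = 0 in the growth condition gives |f(u)| ≤ K|u|^{p-1}|u|. The sup-norm decay is spent
on the first p - 1 powers, and one factor u is kept to carry the moments. -/
theorem enorm_nonlin_le (hp : 1 < p) (hK : 0 < K) (hf0 : f 0 = 0) (hf : PowerLipschitz f K p)
    (hu : MemX u) (hD : 0 < D) (hdecay : ∀ t : ℝ, 0 < t →
      eLpNorm (u t) ∞ volume ≤ ENNReal.ofReal (D * (1 + t) ^ (-((n : ℝ) / 2))))
    {s : ℝ} (hs : 0 < s) : ∀ᵐ x, ‖nonlin f u s x‖ₑ ≤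
      ENNReal.ofReal (K * D ^ (p - 1) * (1 + s) ^ (-((n : ℝ) / 2 * (p - 1)))) * ‖u s x‖ₑ := by
  filter_upwards [nonlin_ae_eq hp hK hf0 hf hu hs,
    ae_norm_le_of_eLpNorm_top_le (by positivity) (hdecay s hs)] with x h1 h2
  rw [h1, ← ofReal_norm, ← ofReal_norm, ← ENNReal.ofReal_mul (by positivity)]
  refine ENNReal.ofReal_le_ofReal ?_
  have h3 := hf (u s x) 0
  rw [hf0, sub_zero, sub_zero, norm_zero, Real.zero_rpow (by linarith), add_zero] at h3
  refine h3.trans ?_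
  have h4 : ‖u s x‖ ^ (p - 1) ≤ D ^ (p - 1) * (1 + s) ^ (-((n : ℝ) / 2 * (p - 1))) := by
    refine (Real.rpow_le_rpow (norm_nonneg _) h2 (by linarith)).trans (le_of_eq ?_)
    rw [Real.mul_rpow hD.le (by positivity), ← Real.rpow_mul (by positivity), neg_mul]
  rw [mul_assoc K (D ^ (p - 1))]
  gcongr

/-- The nonlinear term is Lipschitz in L¹ on sets bounded in L^∞, so s ↦ f(u(s)) inherits continuity
in L¹ for s > 0. -/
theorem norm_nonlin_sub_le (hp : 1 < p) (hK : 0 < K) (hf0 : f 0 = 0) (hf : PowerLipschitz f K p)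
    (hu : MemX u) (hD : 0 < D)
    (hbdd : ∀ t : ℝ, 0 < t → eLpNorm (u t) ∞ volume ≤ ENNReal.ofReal D)
    {r s : ℝ} (hr : 0 < r) (hs : 0 < s) :
    ‖nonlin f u r - nonlin f u s‖ ≤ K * (D ^ (p - 1) + D ^ (p - 1)) * ‖u r - u s‖ := by
  have hm : ∀ t : ℝ, 0 < t → MemLp (fun x => f (u t x)) 1 volume := fun t ht =>
    memLp_nonlin hp hK hf0 hf (Lp.memLp (u t)) (hu.memLp_top t ht)
  unfold nonlin
  rw [toL1_sub (hm r hr) (hm s hs)]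
  refine norm_toL1_le (by positivity) ?_
  rw [ENNReal.ofReal_mul (by positivity), ofReal_norm, Lp.enorm_def]
  have := eLpNorm_le_mul_eLpNorm_of_ae_le_mul (p := 1)
    (f := fun x => f (u r x) - f (u s x)) (g := (u r - u s : Lp ℂ 1 (volume : Measure (Sp n))))
    (c := K * (D ^ (p - 1) + D ^ (p - 1))) (μ := (volume : Measure (Sp n))) ?_
  · simpa using this
  filter_upwards [Lp.coeFn_sub (u r) (u s), ae_norm_le_of_eLpNorm_top_le hD.le (hbdd r hr),
    ae_norm_le_of_eLpNorm_top_le hD.le (hbdd s hs)] with x h1 h2 h3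
  rw [h1]
  refine (hf _ _).trans ?_
  have h4 := Real.rpow_le_rpow (norm_nonneg _) h2 (z := p - 1) (by linarith)
  have h5 := Real.rpow_le_rpow (norm_nonneg _) h3 (z := p - 1) (by linarith)
  simp only [Pi.sub_apply]
  gcongr

theorem exists_decayingSolution {ν : ℂ} {u₀ : Sp n → ℂ} (hp : 1 < p) (hK : 0 < K)
    (hf0 : f 0 = 0) (hf : PowerLipschitz f K p) (hu₀ : MemLp u₀ 1 volume)
    (hu : IsGlobalSolution ν f u₀ u) (hdecay : HasFreeDecay u)
    (hσ : 0 < (n : ℝ) / 2 * (p - 1) - 1) :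
    ∃ κ D : ℝ, DecayingSolution ν u₀ u (nonlin f u) ((n : ℝ) / 2 * (p - 1) - 1) κ D := by
  obtain ⟨D, hD, h1⟩ := exists_eLpNorm_le_one_add_rpow hu.memX hdecay
  have htop : ∀ t : ℝ, 0 < t →
      eLpNorm (u t) ∞ volume ≤ ENNReal.ofReal (D * (1 + t) ^ (-((n : ℝ) / 2))) := fun t ht => by
    simpa [decayExp_top] using h1 ∞ (Or.inr rfl) t ht
  have hbdd : ∀ t : ℝ, 0 < t → eLpNorm (u t) ∞ volume ≤ ENNReal.ofReal D := fun t ht => by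
    refine (htop t ht).trans (ENNReal.ofReal_le_ofReal (mul_le_of_le_one_right hD.le ?_))
    exact Real.rpow_le_one_of_one_le_of_nonpos (by linarith) (by simp; positivity)
  refine ⟨K * D ^ (p - 1), D, hσ, by positivity, hD, hu.memX.continuousOn_L1, ?_, hu₀,
    hu.duhamel, h1, fun s hs => ?_⟩
  · intro s hs
    rw [ContinuousWithinAt, tendsto_iff_norm_sub_tendsto_zero]
    have h2 : ContinuousOn u (Ioi 0) := hu.memX.continuousOn_L1.mono Ioi_subset_Ici_self
    have h3 := ((tendsto_iff_norm_sub_tendsto_zero.mp (h2 s hs)).const_mul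
      (K * (D ^ (p - 1) + D ^ (p - 1))))
    rw [mul_zero] at h3
    exact squeeze_zero' (Eventually.of_forall fun _ => norm_nonneg _)
      (eventually_mem_nhdsWithin.mono fun r hr =>
        norm_nonlin_sub_le hp hK hf0 hf hu.memX hD hbdd hr hs) h3
  · simpa using enorm_nonlin_le hp hK hf0 hf hu.memX hD htop hs

end Nonlinearity

theorem profile_eq {n : ℕ} (ν : ℂ) (f : ℂ → ℂ) (u₀ : Sp n → ℂ)
    (u : ℝ → Lp ℂ 1 (volume : Measure (Sp n))) (m : ℕ) {t : ℝ} (ht : 0 < t) (x : Sp n) :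
    profile ν f u₀ u m t x =
      momentSum ν 0 m t u₀ x + coefSum ν m t (fun k β => moment β (psi f u k)) x := by
  unfold profile momentSum coefSum
  simp only [Lam_eq _ _ _ ht]

/-! ### The rate of convergence -/

theorem setIntegral_one_add_rpow {a b : ℝ} (ha : a ≠ 0) (hb : 0 ≤ b) :
    ∫ s in Ioo 0 b, (1 + s) ^ (a - 1) = ((1 + b) ^ a - 1) / a := by
  rw [← integral_Ioc_eq_integral_Ioo, ← intervalIntegral.integral_of_le hb,
    intervalIntegral.integral_comp_add_left (fun x : ℝ => x ^ (a - 1)), integral_rpow]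
  · simp
  · refine Or.inr ⟨fun h => ha (by linarith), ?_⟩
    rw [uIcc_of_le (by linarith)]
    exact fun h => by linarith [h.1]

theorem setIntegral_one_add_rpow_neg_one {b : ℝ} (hb : 0 ≤ b) :
    ∫ s in Ioo 0 b, (1 + s) ^ (-1 : ℝ) = Real.log (1 + b) := by
  rw [← integral_Ioc_eq_integral_Ioo, ← intervalIntegral.integral_of_le hb,
    intervalIntegral.integral_comp_add_left (fun x : ℝ => x ^ (-1 : ℝ))]
  simp only [Real.rpow_neg_one]
  rw [integral_inv_of_pos (by norm_num) (by linarith)]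
  simp

/-- The rate obtained from the estimates of the remainder. -/
noncomputable def rate (m : ℕ) (σ t : ℝ) : ℝ :=
  t ^ (-(1 : ℝ) / 2) * (1 + ∫ s in Ioo 0 (t / 2), (1 + s) ^ (((m : ℝ) + 1) / 2 - (σ + 1))) +
    t ^ ((m : ℝ) / 2 - σ)

/-- Here the integral grows like t^a with a = (m+1)/2 - σ, and t^{-1/2} t^a = t^{m/2-σ}: early and
late times contribute at the same rate. -/
theorem exists_rate_le_of_lt {m : ℕ} {σ : ℝ} (h : σ < ((m : ℝ) + 1) / 2) :
    ∃ C : ℝ, 0 < C ∧ ∀ t : ℝ, 1 ≤ t → rate m σ t ≤ C * t ^ (-(σ - (m : ℝ) / 2)) := by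
  set a := ((m : ℝ) + 1) / 2 - σ with ha
  have ha0 : 0 < a := by linarith
  refine ⟨1 + 2 ^ a / a + 1, by positivity, fun t ht => ?_⟩
  have ht0 : 0 < t := by linarith
  have h1 : ∫ s in Ioo 0 (t / 2), (1 + s) ^ (((m : ℝ) + 1) / 2 - (σ + 1)) ≤ 2 ^ a / a * t ^ a := by
    rw [show ((m : ℝ) + 1) / 2 - (σ + 1) = a - 1 by rw [ha]; ring,
      setIntegral_one_add_rpow ha0.ne' (by positivity)]
    have : (1 + t / 2) ^ a ≤ (2 * t) ^ a :=
      Real.rpow_le_rpow (by positivity) (by linarith) ha0.le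
    rw [Real.mul_rpow (by norm_num) ht0.le] at this
    rw [div_mul_eq_mul_div]
    gcongr
    linarith
  have h2 : (1 : ℝ) ≤ t ^ a := Real.one_le_rpow ht ha0.le
  have h3 : t ^ (-(1 : ℝ) / 2) * t ^ a = t ^ (-(σ - (m : ℝ) / 2)) := by
    rw [← Real.rpow_add ht0]
    congr 1
    rw [ha]
    ring
  unfold rate
  calc _ ≤ t ^ (-(1 : ℝ) / 2) * (t ^ a + 2 ^ a / a * t ^ a) + t ^ ((m : ℝ) / 2 - σ) := by gcongr
    _ = (1 + 2 ^ a / a) * (t ^ (-(1 : ℝ) / 2) * t ^ a) + t ^ ((m : ℝ) / 2 - σ) := by ring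
    _ = _ := by
      rw [h3, show (m : ℝ) / 2 - σ = -(σ - (m : ℝ) / 2) by ring]
      ring

/-- At the critical exponent the integrand is (1+s)⁻¹, whence the logarithm. -/
theorem exists_rate_le_of_eq {m : ℕ} {σ : ℝ} (h : σ = ((m : ℝ) + 1) / 2) :
    ∃ C : ℝ, 0 < C ∧ ∀ t : ℝ, 1 ≤ t →
      rate m σ t ≤ C * (t ^ (-(1 : ℝ) / 2) * Real.log (2 + t)) := by
  refine ⟨3, by norm_num, fun t ht => ?_⟩
  have ht0 : 0 < t := by linarith
  have h1 : ∫ s in Ioo 0 (t / 2), (1 + s) ^ (((m : ℝ) + 1) / 2 - (σ + 1)) ≤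
      Real.log (2 + t) := by
    rw [show ((m : ℝ) + 1) / 2 - (σ + 1) = -1 by rw [h]; ring,
      setIntegral_one_add_rpow_neg_one (by positivity)]
    exact Real.log_le_log (by positivity) (by linarith)
  -- For t ≥ 1 one has 2 + t ≥ 3 > e.
  have h2 : 1 ≤ Real.log (2 + t) := by
    rw [Real.le_log_iff_exp_le (by positivity)]
    linarith [Real.exp_one_lt_three]
  unfold rate
  rw [show (m : ℝ) / 2 - σ = -1 / 2 by rw [h]; ring]
  have h3 : 0 < t ^ (-(1 : ℝ) / 2) := by positivity
  calc _ ≤ t ^ (-(1 : ℝ) / 2) * (Real.log (2 + t) + Real.log (2 + t)) +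
        t ^ (-(1 : ℝ) / 2) * Real.log (2 + t) := by
        gcongr
        exact le_mul_of_one_le_right h3.le h2
    _ = _ := by ring

/-- The integral stays bounded, so t^{-1/2}, the gain of one parabolic order, dominates. -/
theorem exists_rate_le_of_gt {m : ℕ} {σ : ℝ} (h : ((m : ℝ) + 1) / 2 < σ) :
    ∃ C : ℝ, 0 < C ∧ ∀ t : ℝ, 1 ≤ t → rate m σ t ≤ C * t ^ (-(1 : ℝ) / 2) := by
  set a := σ - ((m : ℝ) + 1) / 2 with ha
  have ha0 : 0 < a := by linarith
  refine ⟨1 + 1 / a + 1, by positivity, fun t ht => ?_⟩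
  have ht0 : 0 < t := by linarith
  have h1 : ∫ s in Ioo 0 (t / 2), (1 + s) ^ (((m : ℝ) + 1) / 2 - (σ + 1)) ≤ 1 / a := by
    rw [show ((m : ℝ) + 1) / 2 - (σ + 1) = -a - 1 by rw [ha]; ring,
      setIntegral_one_add_rpow (by linarith) (by positivity), div_neg, ← neg_div, neg_sub]
    gcongr
    linarith [Real.rpow_nonneg (by positivity : 0 ≤ 1 + t / 2) (-a)]
  have h2 : t ^ ((m : ℝ) / 2 - σ) ≤ t ^ (-(1 : ℝ) / 2) :=
    Real.rpow_le_rpow_of_exponent_le ht (by linarith)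
  unfold rate
  calc _ ≤ t ^ (-(1 : ℝ) / 2) * (1 + 1 / a) + t ^ (-(1 : ℝ) / 2) := by gcongr
    _ = _ := by ring

/-! ### From the two endpoint norms to the rescaled remainder. -/

section Remainder

variable {n m : ℕ} {ν : ℂ} {f : ℂ → ℂ} {u₀ : Sp n → ℂ}
  {u : ℝ → Lp ℂ 1 (volume : Measure (Sp n))} {σ κ D : ℝ}

/-- With τ = t^{-n/2} the interpolated factor τ^{1-1/q} is exactly t^{-(n/2)(1-1/q)}, so one
constant serves all q. -/
theorem rescaledRemainder_le {C₁ C₂ ρ t : ℝ} (hC₁ : 0 < C₁) (hC₂ : 0 < C₂) (hρ : 0 < ρ)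
    (ht : 0 < t)
    (h₁ : eLpNorm (fun x => u t x - profile ν f u₀ u m t x) 1 volume ≤
      ENNReal.ofReal (C₁ * (t ^ (-decayExp n 1) * ρ)))
    (h₂ : eLpNorm (fun x => u t x - profile ν f u₀ u m t x) ∞ volume ≤
      ENNReal.ofReal (C₂ * (t ^ (-decayExp n ∞) * ρ))) {q : ℝ≥0∞} (hq : 1 ≤ q) :
    rescaledRemainder ν f u₀ u m q t ≤ ENNReal.ofReal ((C₁ + C₂) * (t ^ ((m : ℝ) / 2) * ρ)) := by
  rw [decayExp_one, neg_zero, Real.rpow_zero, one_mul] at h₁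
  rw [decayExp_top] at h₂
  have h := eLpNorm_interpolation (R := (C₁ + C₂) * ρ) (τ := t ^ (-((n : ℝ) / 2)))
    (by positivity) (by positivity)
    (h₁.trans (ENNReal.ofReal_le_ofReal (by gcongr; linarith)))
    (h₂.trans (ENNReal.ofReal_le_ofReal (by
      rw [mul_assoc, mul_comm ρ]
      gcongr
      linarith))) hq
  unfold rescaledRemainder
  refine (mul_le_mul_right h _).trans (le_of_eq ?_)
  rw [← ENNReal.ofReal_mul (by positivity), ← Real.rpow_mul ht.le, Real.rpow_add ht,
    show -((n : ℝ) / 2) * (1 - (q⁻¹).toReal) = -decayExp n q by unfold decayExp; ring,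
    Real.rpow_neg ht.le]
  congr 1
  field_simp

theorem exists_rescaledRemainder_le_rate
    (h : DecayingSolution ν u₀ u (nonlin f u) σ κ D) (hν : 0 < ν.re) (hσ : (m : ℝ) / 2 < σ)
    (hw : ∀ j ≤ m + 1, wnorm j u₀ < ∞) : ∃ C : ℝ, 0 < C ∧ ∀ q : ℝ≥0∞, 1 ≤ q → ∀ t : ℝ, 0 < t →
      rescaledRemainder ν f u₀ u m q t ≤ ENNReal.ofReal (C * rate m σ t) := by
  obtain ⟨C₁, hC₁, h₁⟩ := h.exists_eLpNorm_sub_profile_le hν (Or.inl rfl) hσ hw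
  obtain ⟨C₂, hC₂, h₂⟩ := h.exists_eLpNorm_sub_profile_le hν (Or.inr rfl) hσ hw
  refine ⟨C₁ + C₂, by positivity, fun q hq t ht => ?_⟩
  have hJ : 0 ≤ ∫ s in Ioo 0 (t / 2), (1 + s) ^ (((m : ℝ) + 1) / 2 - (σ + 1)) :=
    setIntegral_nonneg measurableSet_Ioo fun s hs => by
      have := hs.1
      positivity
  have e : (fun x => u t x - profile ν f u₀ u m t x) = fun x => u t x - (momentSum ν 0 m t u₀ x +
      coefSum ν m t (fun k β => moment β (psi f u k)) x) := by
    ext x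
    rw [profile_eq _ _ _ _ _ ht]
  have key := rescaledRemainder_le (m := m) (ν := ν) (f := f) (u₀ := u₀) (u := u)
    (ρ := t ^ (-(((m : ℝ) + 1) / 2)) * (1 + ∫ s in Ioo 0 (t / 2),
      (1 + s) ^ (((m : ℝ) + 1) / 2 - (σ + 1))) + t ^ (-σ)) hC₁ hC₂
    (by positivity) ht (by rw [e]; exact h₁ t ht) (by rw [e]; exact h₂ t ht) hq
  refine key.trans (le_of_eq ?_)
  unfold rate
  rw [mul_add (t ^ ((m : ℝ) / 2)), ← mul_assoc (t ^ ((m : ℝ) / 2)), ← Real.rpow_add ht,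
    ← Real.rpow_add ht]
  congr 5
  ring_nf

theorem exists_rescaledRemainder_le_of_le_one
    (h : DecayingSolution ν u₀ u (nonlin f u) σ κ D) (hν : 0 < ν.re) (m : ℕ) :
    ∃ C : ℝ, 0 < C ∧ ∀ q : ℝ≥0∞, 1 ≤ q → ∀ t : ℝ, 0 < t → t ≤ 1 →
      rescaledRemainder ν f u₀ u m q t ≤ ENNReal.ofReal C := by
  obtain ⟨C₁, hC₁, h₁⟩ := h.exists_eLpNorm_sub_profile_le_of_le_one hν (Or.inl rfl) m
    fun k => psi f u k
  obtain ⟨C₂, hC₂, h₂⟩ := h.exists_eLpNorm_sub_profile_le_of_le_one hν (Or.inr rfl) m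
    fun k => psi f u k
  refine ⟨C₁ + C₂, by positivity, fun q hq t ht ht1 => ?_⟩
  have e : (fun x => u t x - profile ν f u₀ u m t x) = fun x => u t x - (momentSum ν 0 m t u₀ x +
      coefSum ν m t (fun k β => moment β (psi f u k)) x) := by
    ext x
    rw [profile_eq _ _ _ _ _ ht]
  have key := rescaledRemainder_le (m := m) (ν := ν) (f := f) (u₀ := u₀) (u := u)
    (ρ := t ^ (-((m : ℝ) / 2))) hC₁ hC₂
    (by positivity) ht (by rw [e]; exact h₁ t ht ht1) (by rw [e]; exact h₂ t ht ht1) hq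
  rwa [← Real.rpow_add ht, add_neg_cancel, Real.rpow_zero, mul_one] at key

/-- Glues the two time ranges: for t ≤ 1 the remainder is bounded and w is bounded below, for t ≥ 1
`rate` is dominated by w. -/
theorem exists_rescaledRemainder_le
    (h : DecayingSolution ν u₀ u (nonlin f u) σ κ D) (hν : 0 < ν.re) (hσ : (m : ℝ) / 2 < σ)
    (hw : ∀ j ≤ m + 1, wnorm j u₀ < ∞) {w : ℝ → ℝ} {c : ℝ} (hc : 0 < c)
    (hw₁ : ∀ t : ℝ, 0 < t → t ≤ 1 → c ≤ w t)
    (hw₂ : ∃ C : ℝ, 0 < C ∧ ∀ t : ℝ, 1 ≤ t → rate m σ t ≤ C * w t) :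
    ∃ C : ℝ, 0 < C ∧ ∀ q : ℝ≥0∞, 1 ≤ q → ∀ t : ℝ, 0 < t →
      rescaledRemainder ν f u₀ u m q t ≤ ENNReal.ofReal (C * w t) := by
  obtain ⟨A, hA, h₁⟩ := exists_rescaledRemainder_le_rate h hν hσ hw
  obtain ⟨B, hB, h₂⟩ := exists_rescaledRemainder_le_of_le_one h hν m
  obtain ⟨C, hC, h₃⟩ := hw₂
  have hw0 : ∀ t : ℝ, 1 ≤ t → 0 ≤ w t := fun t ht => by
    have hrate : 0 ≤ rate m σ t := by
      unfold rate
      have hJ : 0 ≤ ∫ s in Ioo 0 (t / 2), (1 + s) ^ (((m : ℝ) + 1) / 2 - (σ + 1)) :=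
        setIntegral_nonneg measurableSet_Ioo fun s hs => by
          have := hs.1
          positivity
      positivity
    exact nonneg_of_mul_nonneg_right (hrate.trans (h₃ t ht)) hC
  refine ⟨A * C + B / c, by positivity, fun q hq t ht => ?_⟩
  rcases le_total t 1 with ht1 | ht1
  · refine (h₂ q hq t ht ht1).trans (ENNReal.ofReal_le_ofReal ?_)
    have h4 := hw₁ t ht ht1
    calc B = B / c * c := by field_simp
      _ ≤ B / c * w t := by gcongr
      _ ≤ (A * C + B / c) * w t := by
        have : 0 ≤ w t := hc.le.trans h4
        gcongr
        linarith [mul_pos hA hC]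
  · refine (h₁ q hq t ht).trans (ENNReal.ofReal_le_ofReal ?_)
    have h4 := hw0 t ht1
    calc A * rate m σ t ≤ A * (C * w t) := by gcongr; exact h₃ t ht1
      _ = A * C * w t := by ring
      _ ≤ (A * C + B / c) * w t := by
        gcongr
        linarith [div_pos hB hc]

end Remainder

end CGL

/-! ### The main theorem. -/

theorem theorem1p4 (n : ℕ) (hn : 0 < n) (m : ℕ) (ν : ℂ) (hν : 0 < ν.re)
    (p : ℝ) (hp : 1 + ((m : ℝ) + 2) / n < p)
    (f : ℂ → ℂ) (hf0 : f 0 = 0) (hf : ∃ K : ℝ, 0 < K ∧ CGL.PowerLipschitz f K p)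
    (u₀ : CGL.Sp n → ℂ) (hu₀ : CGL.MemWeightedL1 (m + 1) u₀) (hu₀' : MemLp u₀ ∞ volume)
    (u : ℝ → Lp ℂ 1 (volume : Measure (CGL.Sp n)))
    (hu : CGL.IsGlobalSolution ν f u₀ u) (hdecay : CGL.HasFreeDecay u)
    (σ : ℝ) (hσ : σ = (n : ℝ) / 2 * (p - 1) - 1) :
    -- the profile is well defined: the integrals in it converge
    (∀ k : ℕ, 2 * k ≤ m →
      IntegrableOn (fun s : ℝ => s ^ k • CGL.nonlin f u s) (Ioi 0) volume ∧
      ∀ β : CGL.MIdx n, CGL.len β ≤ m - 2 * k →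
        Integrable (fun y => (CGL.monom β y : ℂ) * CGL.psi f u k y) volume) ∧
    (m : ℝ) / 2 < σ ∧
    ∀ q : ℝ≥0∞, 1 ≤ q → ∃ C : ℝ, 0 < C ∧ ∀ t : ℝ, 0 < t →
      (p < 1 + ((m : ℝ) + 3) / n →
        CGL.rescaledRemainder ν f u₀ u m q t
          ≤ ENNReal.ofReal (C * t ^ (-(σ - (m : ℝ) / 2)))) ∧
      (p = 1 + ((m : ℝ) + 3) / n →
        CGL.rescaledRemainder ν f u₀ u m q t
          ≤ ENNReal.ofReal (C * t ^ (-(1 : ℝ) / 2) * Real.log (2 + t))) ∧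
      (1 + ((m : ℝ) + 3) / n < p →
        CGL.rescaledRemainder ν f u₀ u m q t
          ≤ ENNReal.ofReal (C * t ^ (-(1 : ℝ) / 2))) := by
  have hn' : (0 : ℝ) < n := by exact_mod_cast hn
  have hp1 : 1 < p := lt_trans (by linarith [show 0 < ((m : ℝ) + 2) / n by positivity]) hp
  -- This translates the thresholds for p: 1 + (m+2)/n corresponds to σ = m/2, and 1 + (m+3)/n to σ
  -- = (m+1)/2.
  have hpn : (n : ℝ) * (p - 1) = 2 * σ + 2 := by rw [hσ]; ring
  have hσm : (m : ℝ) / 2 < σ := by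
    have h1 : ((m : ℝ) + 2) / n < p - 1 := by linarith
    rw [div_lt_iff₀ hn'] at h1
    linarith
  have hσ0 : 0 < σ := lt_of_le_of_lt (by positivity) hσm
  obtain ⟨K, hK, hf⟩ := hf
  obtain ⟨κ, D, h⟩ := CGL.exists_decayingSolution hp1 hK hf0 hf hu₀.1 hu hdecay (hσ ▸ hσ0)
  rw [← hσ] at h
  have hw : ∀ j ≤ m + 1, CGL.wnorm j u₀ < ∞ := fun j hj =>
    CGL.wnorm_lt_top_of_memWeightedL1 hu₀ hj
  refine ⟨fun k hk => ?_, hσm, fun q hq => ?_⟩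
  · have hkm : 2 * (k : ℝ) ≤ m := by exact_mod_cast hk
    refine ⟨h.integrableOn_pow_smul (by linarith), fun β hβ => ?_⟩
    obtain ⟨A, hA, hwF⟩ := h.exists_forall_wnorm_source_le hν m fun j hj => hw j (by omega)
    refine (h.moment_integral_source hA hwF (by omega : CGL.len β ≤ m) ?_).1
    have h1 : 2 * k + CGL.len β ≤ m := by omega
    have h2 : 2 * (k : ℝ) + (CGL.len β : ℝ) ≤ m := by exact_mod_cast h1
    linarith
  · have hcrit : ((m : ℝ) + 3) / n * n = m + 3 := div_mul_cancel₀ _ hn'.ne'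
    rcases lt_trichotomy p (1 + ((m : ℝ) + 3) / n) with hlt | heq | hgt
    · have hσ' : σ < ((m : ℝ) + 1) / 2 := by nlinarith
      obtain ⟨C, hC, hle⟩ := CGL.exists_rescaledRemainder_le h hν hσm hw
        (w := fun t => t ^ (-(σ - (m : ℝ) / 2))) one_pos
        (fun t ht ht1 => Real.one_le_rpow_of_pos_of_le_one_of_nonpos ht ht1 (by linarith))
        (CGL.exists_rate_le_of_lt hσ')
      exact ⟨C, hC, fun t ht => ⟨fun _ => hle q hq t ht, fun h' => absurd h' hlt.ne,
        fun h' => absurd h' hlt.not_gt⟩⟩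
    · have hσ' : σ = ((m : ℝ) + 1) / 2 := by rw [heq] at hpn; nlinarith
      obtain ⟨C, hC, hle⟩ := CGL.exists_rescaledRemainder_le h hν hσm hw
        -- The shift by 2 inside the logarithm keeps this weight at least log 2 on (0, 1].
        (w := fun t => t ^ (-(1 : ℝ) / 2) * Real.log (2 + t)) (Real.log_pos one_lt_two)
        (fun t ht ht1 => by
          have h1 : 1 ≤ t ^ (-(1 : ℝ) / 2) :=
            Real.one_le_rpow_of_pos_of_le_one_of_nonpos ht ht1 (by norm_num)
          have h2 : Real.log 2 ≤ Real.log (2 + t) :=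
            Real.log_le_log (by norm_num) (by linarith)
          have h3 : 0 < Real.log 2 := Real.log_pos one_lt_two
          nlinarith)
        (CGL.exists_rate_le_of_eq hσ')
      exact ⟨C, hC, fun t ht => ⟨fun h' => absurd heq h'.ne,
        fun _ => by rw [mul_assoc]; exact hle q hq t ht, fun h' => absurd heq h'.ne'⟩⟩
    · have hσ' : ((m : ℝ) + 1) / 2 < σ := by nlinarith
      obtain ⟨C, hC, hle⟩ := CGL.exists_rescaledRemainder_le h hν hσm hw
        (w := fun t => t ^ (-(1 : ℝ) / 2)) one_pos
        (fun t ht ht1 => Real.one_le_rpow_of_pos_of_le_one_of_nonpos ht ht1 (by norm_num))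
        (CGL.exists_rate_le_of_gt hσ')
      exact ⟨C, hC, fun t ht => ⟨fun h' => absurd h' hgt.not_gt, fun h' => absurd h' hgt.ne',
        fun _ => hle q hq t ht⟩⟩
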